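/- **Conventions.** Local rings are Noetherian. For a local ring $(S,\mathfrak n,k)$ and an ideal $I\subseteq S$ set $\mathrm{BI}_S(I)=I\mathfrak n:(I:\mathfrak n)$. The relative Burch index $\mathrm{Burch}_S(I)$ is $0$ if $I=0$ or if $S/I$ does not have depth $0$, and $\dim_k \mathfrak n/\mathrm{BI}_S(I)$ otherwise. For a local ring $(R,\mathfrak m)$ of depth $0$, write its $\mathfrak m$-adic completion as $\hat R\cong T/I$ with $(T,\mathfrak n_T)$ a complete regular local ring and $\dim \mathfrak n_T/\mathfrak n_T^2=\dim \mathfrak m/\mathfrak m^2$, and let $\mathrm{Burch}(R)=\mathrm{Burch}_T(I)$; this does not depend on the choice of the presentation. If $\operatorname{depth}R>0$, let $R'=R[z]_{\mathfrak mR[z]}$, and let $\mathrm{Burch}(R)$ be the maximum of $\mathrm{Burch}(R'/\underline xR')$ over all maximal regular sequences $\underline x$ in $R'$. For a finitely generated $S$-module $M$ let $J(M)$ be the ideal generated by the entries of a minimal presentation matrix of $M$ (the unit ideal if that matrix has no columns), and let $\mathrm{lin}_1^S(M)=\dim_k\,(J(M)+\mathfrak n^2)/\mathfrak n^2$ when $J(M)\subseteq\mathfrak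 n$; this is the dimension of the space of linear entries of that matrix. **Theorem.** Let $(S,\mathfrak m)$ be a regular local ring and let $I\subseteq\mathfrak m^2$ be an ideal whose projective dimension as an $S$-module is $1$. Then $$\mathrm{Burch}(S/I)=\min\{\mathrm{lin}_1^S(I),\,2\}.$$ (A minimal presentation matrix of $I$ is here the Hilbert–Burch matrix of $I$.) -/

import Mathlib

universe u

namespace Burch

open IsLocalRing

/-- A module `M` over a local ring has depth zero: no element of the maximal ideal is a nonzerodivisor
on `M`. (The zero module does not satisfy this; its depth is infinite.) -/
def HasDepthZero (S : Type u) [CommRing S] [IsLocalRing S]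
    (M : Type u) [AddCommGroup M] [Module S M] : Prop :=
  ∀ x ∈ maximalIdeal S, ¬ IsSMulRegular M x

/-- The Burch ideal `BI_S(I) = I𝔫 : (I : 𝔫)` of an ideal `I` in a local ring `(S, 𝔫)`. -/
def burchIdeal {S : Type u} [CommRing S] [IsLocalRing S] (I : Ideal S) : Ideal S :=
  (I * maximalIdeal S).colon ((I.colon (maximalIdeal S : Set S) : Ideal S) : Set S)

open Classical in
/-- The relative Burch index `Burch_S(I)`: it is `0` if `I = 0` or `S/I` does not have depth zero,
and `dim_k (𝔫 / BI_S(I))` otherwise. In the latter case `𝔫² ⊆ BI_S(I) ⊆ 𝔫`, so that `𝔫 / BI_S(I)` is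
killed by `𝔫`, and its dimension over `k = S/𝔫` is its length as an `S`-module. -/
noncomputable def relBurchIndex {S : Type u} [CommRing S] [IsLocalRing S] (I : Ideal S) : ℕ∞ :=
  if I = ⊥ ∨ ¬ HasDepthZero S (S ⧸ I) then 0
  else Module.length S
    ((maximalIdeal S) ⧸ (burchIdeal I).submoduleOf (maximalIdeal S))

/-- `φ : T → R` is a minimal regular Cohen presentation of the local ring `R`: a surjective local
homomorphism from a complete regular local ring, with `dim 𝔫/𝔫² = dim 𝔪/𝔪²`. -/
structure IsMinimalCohenPresentation {T R : Type u} [CommRing T] [IsRegularLocalRing T]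
    [CommRing R] [IsLocalRing R] (φ : T →+* R) : Prop where
  complete : IsAdicComplete (maximalIdeal T) T
  isLocalHom : IsLocalHom φ
  surjective : Function.Surjective φ
  minimal : Module.finrank (ResidueField T) (CotangentSpace T) =
    Module.finrank (ResidueField R) (CotangentSpace R)

/-- The Burch index of a Noetherian local ring `R` of depth zero: the value `Burch_T(ker φ)` for a
minimal regular Cohen presentation `φ : T → R̂` of the completion of `R`. All of these presentations
give the same value; it is picked out as the supremum of the set of these values. -/
noncomputable def burchIndexDepthZero (R : Type u) [CommRing R] [IsLocalRing R]
    [IsNoetherianRing R] : ℕ∞ :=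
  sSup {b : ℕ∞ | ∃ (T : Type u) (_ : CommRing T) (_ : IsRegularLocalRing T)
    (φ : T →+* AdicCompletion (maximalIdeal R) R),
    IsMinimalCohenPresentation φ ∧ b = relBurchIndex (RingHom.ker φ)}

/-- The local ring `R' = R[z]_{𝔪R[z]}` of a local ring `(R, 𝔪)`. -/
abbrev ResidueExtension (R : Type u) [CommRing R] [IsLocalRing R] : Type u :=
  Localization.AtPrime ((maximalIdeal R).map (Polynomial.C : R →+* Polynomial R))

/-- A maximal regular sequence in a local ring: a regular sequence (it lies in the maximal ideal by
the requirement `(x₁, …, xₙ) ≠ R` in `IsRegular`) that cannot be prolonged. -/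
def IsMaximalRegularSequence {R : Type u} [CommRing R] (xs : List R) : Prop :=
  RingTheory.Sequence.IsRegular R xs ∧ ∀ y : R, ¬ RingTheory.Sequence.IsRegular R (xs ++ [y])

open Classical in
/-- The Burch index `Burch(R)` of a Noetherian local ring `R`. In positive depth it is the maximum of
the Burch indices of the depth zero local rings `R'/(x₁, …, xₙ)`, over all maximal regular sequences
`x₁, …, xₙ` in `R' = R[z]_{𝔪R[z]}`. -/
noncomputable def burchIndex (R : Type u) [CommRing R] [IsLocalRing R]
    [IsNoetherianRing R] : ℕ∞ :=
  if HasDepthZero R R then burchIndexDepthZero R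
  else sSup {b : ℕ∞ | ∃ xs : List (ResidueExtension R), IsMaximalRegularSequence xs ∧
    ∃ _ : IsLocalRing (ResidueExtension R ⧸ Ideal.ofList xs),
      b = burchIndexDepthZero (ResidueExtension R ⧸ Ideal.ofList xs)}

/-- `Sⁿ --A--> Sᵐ --π--> M → 0` is a minimal free presentation of the module `M` over the local ring
`(S, 𝔫)`: it is exact, and both free modules have the least possible rank, i.e. the kernels of `π` and
of `A` lie in `𝔫Sᵐ` and `𝔫Sⁿ`. -/
structure IsMinimalPresentation {S : Type u} [CommRing S] [IsLocalRing S]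
    {M : Type u} [AddCommGroup M] [Module S M] {m n : ℕ}
    (A : Matrix (Fin m) (Fin n) S) (π : (Fin m → S) →ₗ[S] M) : Prop where
  surjective : Function.Surjective π
  exact : LinearMap.range A.mulVecLin = LinearMap.ker π
  minimal_generators : LinearMap.ker π ≤ maximalIdeal S • (⊤ : Submodule S (Fin m → S))
  minimal_relations :
    LinearMap.ker A.mulVecLin ≤ maximalIdeal S • (⊤ : Submodule S (Fin n → S))

/-- The ideal generated by the entries of a matrix, with the convention that it is the whole ring
for a matrix without columns. -/
def entryIdeal {S : Type u} [CommRing S] {m n : ℕ} (A : Matrix (Fin m) (Fin n) S) : Ideal S :=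
  if n = 0 then ⊤ else Ideal.span {a | ∃ i j, a = A i j}

/-- The ideal `J(M)` generated by the entries of a minimal presentation matrix of `M`. All minimal
presentation matrices give the same ideal; it is picked out as the supremum of these ideals. -/
def presentationIdeal (S : Type u) [CommRing S] [IsLocalRing S]
    (M : Type u) [AddCommGroup M] [Module S M] : Ideal S :=
  sSup {K : Ideal S | ∃ (m n : ℕ) (A : Matrix (Fin m) (Fin n) S) (π : (Fin m → S) →ₗ[S] M),
    IsMinimalPresentation A π ∧ K = entryIdeal A}

/-- The space `LinSp₁(M) = (J(M) + 𝔫²)/𝔫²` of linear entries in a minimal presentation matrix of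
`M`, as a submodule of `S/𝔫²`. -/
def linSp₁ (S : Type u) [CommRing S] [IsLocalRing S]
    (M : Type u) [AddCommGroup M] [Module S M] : Submodule S (S ⧸ maximalIdeal S ^ 2) :=
  Submodule.map (Submodule.mkQ (maximalIdeal S ^ 2)) (presentationIdeal S M ⊔ maximalIdeal S ^ 2)

/-- `lin₁(M) = dim_k LinSp₁(M)`. The module `LinSp₁(M)` is killed by `𝔫` if the minimal presentation
matrix has columns, and its dimension over `k = S/𝔫` is then its length as an `S`-module. -/
noncomputable def lin₁ (S : Type u) [CommRing S] [IsLocalRing S]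
    (M : Type u) [AddCommGroup M] [Module S M] : ℕ∞ :=
  Module.length S (linSp₁ S M)

theorem isLocalRing_quotient {S : Type u} [CommRing S] [IsLocalRing S] {I : Ideal S}
    (hI : I ≤ maximalIdeal S ^ 2) : IsLocalRing (S ⧸ I) :=
  have : Nontrivial (S ⧸ I) := Ideal.Quotient.nontrivial_iff.mpr fun h =>
    (Ideal.IsPrime.ne_top' : maximalIdeal S ≠ ⊤)
      (top_le_iff.mp (h ▸ hI.trans (Ideal.pow_le_self two_ne_zero)))
  IsLocalRing.of_surjective' (Ideal.Quotient.mk I) Ideal.Quotient.mk_surjective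

end Burch

/-! ### Koszul relations -/

namespace Burch

open IsLocalRing

/-! Let `A` be the Hilbert–Burch matrix and `f` the row of generators of `I`. The claim splits into
upper bounds (the Burch index is at most 2, and at most `l` for `l = 0, 1` if the entries of `A`
span at most `l` dimensions modulo 𝔫²) and lower bounds (it exceeds `l < 2` if they span more than
`l` dimensions).

The Burch index in depth zero is intrinsic. Let `φ : T → R` be surjective with `T` regular local and
`y` minimal generators of 𝔫. If `z = ∑ cᵢyᵢ` and `s` lifts a socle element, then `zs ∈ (ker φ)𝔫`
means that `sc` agrees modulo `ker φ` with a relation on `y`. Relations on `y` are Koszul, so the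
condition says that the image of `sc` is a Koszul relation over `R` (`mem_burchIdeal_ker_iff`). The
resulting ideal `innerBurchIdeal` depends on `R` alone and is compatible with completion. Hence
incomplete presentations, and for upper bounds non-minimal ones, can be used.

Upper bounds (`HilbertBurchCone`). Let `L = I + X` with `X` generated by a sequence that is regular
on `S/I`. Iterated mapping cones resolve `S/L` far enough. Let `z₁, …, zₑ` be a basis of 𝔫 modulo 𝔫²
+ L; then `e ≥ 2`. For a socle lift `s` write `szᵢ = d₁(aᵢ)`. Then `zⱼaᵢ - zᵢaⱼ` is a relation
`d₂(cᵢⱼ)`, whose part at the generators `f` is modulo `X` a combination of the columns of `A`. If `e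
≥ 3`, the second syzygy built from three indices forces the coefficients of this combination into 𝔫,
so `aᵢ` has entries in 𝔫 and the Burch ideal is 𝔫. If `e = 2`, two elements span; and if the linear
entries of `A` are spanned by a single `w`, then `w`, up to 𝔫² + L, lies in the Burch ideal.

Lower bounds. In a regular ring of dimension two, write the entries as `z₁a - z₀b`. Each column then
gives an `s` with `f·a = z₀s` and `f·b = z₁s`, and `p z₀ + q z₁` can lie in the Burch ideal only if
all `pa + qb` lie in 𝔫. One entry outside 𝔫² yields index at least 1, two independent ones yield
index 2 (`not_isSpannedMod_burchIdeal`). In higher dimension `S/I` has no socle, and over the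
infinite residue field of `R'` general elements outside 𝔫² cut down to dimension two while the
chosen entries stay independent (`exists_isRegularMod`). -/

/-- The submodule of Koszul relations among the members of a family of ring elements. -/
def koszul {S ι : Type*} [CommRing S] [DecidableEq ι] (x : ι → S) : Submodule S (ι → S) :=
  Submodule.span S {v | ∃ i j, v = x j • Pi.single i 1 - x i • Pi.single j 1}

section Koszul

variable {S ι κ : Type*} [CommRing S] [DecidableEq ι] [DecidableEq κ]

theorem koszul_gen_mem (x : ι → S) (i j : ι) :
    x j • (Pi.single i 1 : ι → S) - x i • Pi.single j 1 ∈ koszul x :=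
  Submodule.subset_span ⟨i, j, rfl⟩

theorem sum_mul_eq_zero_of_mem_koszul [Fintype ι] {x : ι → S} {v : ι → S} (hv : v ∈ koszul x) :
    ∑ i, v i * x i = 0 := by
  induction hv using Submodule.span_induction with
  | mem v hv =>
    obtain ⟨i, j, rfl⟩ := hv
    simp only [Pi.sub_apply, Pi.smul_apply, smul_eq_mul, sub_mul, Finset.sum_sub_distrib,
      Pi.single_apply, mul_ite, mul_one, mul_zero, ite_mul, zero_mul, Finset.sum_ite_eq',
      Finset.mem_univ, if_true]
    ring
  | zero => simp
  | add v w _ _ hv hw => simp [add_mul, Finset.sum_add_distrib, hv, hw]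
  | smul a v _ hv => simp [mul_assoc, ← Finset.mul_sum, hv]

/-- The expression is bilinear and alternating in `a` and `b`; on pairs of basis vectors it is a
generating relation. -/
theorem smul_sub_smul_mem_koszul [Fintype κ] (y : κ → S) (a b : κ → S) :
    (∑ k, b k * y k) • a - (∑ k, a k * y k) • b ∈ koszul y := by
  have : (∑ k, b k * y k) • a - (∑ k, a k * y k) • b =
      ∑ k, ∑ l, (b k * a l) • (y k • (Pi.single l 1 : κ → S) - y l • Pi.single k 1) := by
    funext m
    simp only [Pi.sub_apply, Pi.smul_apply, smul_eq_mul, Finset.sum_apply, mul_sub,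
      Finset.sum_sub_distrib, Pi.single_apply, mul_ite, mul_one, mul_zero, Finset.sum_ite_eq,
      Finset.mem_univ, if_true, Finset.sum_mul]
    congr 1
    · exact Finset.sum_congr rfl fun k _ => by ring
    · rw [Finset.sum_comm]
      simp only [Finset.sum_ite_eq, Finset.mem_univ, if_true]
      exact Finset.sum_congr rfl fun k _ => by ring
  rw [this]
  exact Submodule.sum_mem _ fun k _ => Submodule.sum_mem _ fun l _ =>
    Submodule.smul_mem _ _ (koszul_gen_mem y l k)

/-- A generating relation on `x` becomes the expression of the previous lemma for two rows of `g`.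
This is what makes later constructions independent of the choice of generators. -/
theorem vecMul_mem_koszul [Fintype ι] [Fintype κ] {x : ι → S} {y : κ → S} (g : Matrix ι κ S)
    (hg : ∀ i, x i = ∑ j, g i j * y j) {v : ι → S} (hv : v ∈ koszul x) :
    Matrix.vecMul v g ∈ koszul y := by
  induction hv using Submodule.span_induction with
  | mem v hv =>
    obtain ⟨i, j, rfl⟩ := hv
    rw [Matrix.sub_vecMul, Matrix.smul_vecMul, Matrix.smul_vecMul, Matrix.single_one_vecMul,
      Matrix.single_one_vecMul, hg i, hg j]
    exact smul_sub_smul_mem_koszul y (g.row i) (g.row j)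
  | zero => simp
  | add v w _ _ hv hw => rw [Matrix.add_vecMul]; exact add_mem hv hw
  | smul a v _ hv => rw [Matrix.smul_vecMul]; exact Submodule.smul_mem _ _ hv

theorem map_mem_koszul {R : Type*} [CommRing R] (φ : S →+* R) {x : ι → S} {v : ι → S}
    (hv : v ∈ koszul x) : (fun i => φ (v i)) ∈ koszul (fun i => φ (x i)) := by
  induction hv using Submodule.span_induction with
  | mem v hv =>
    obtain ⟨i, j, rfl⟩ := hv
    convert koszul_gen_mem (fun i => φ (x i)) i j using 1
    funext k
    simp [Pi.single_apply, apply_ite φ]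
  | zero => convert (koszul fun i => φ (x i)).zero_mem using 1; ext i; simp
  | add v w _ _ hv hw => convert add_mem hv hw using 1; ext i; simp
  | smul a v _ hv => convert Submodule.smul_mem _ (φ a) hv using 1; ext i; simp

theorem exists_lift_mem_koszul {R : Type*} [CommRing R] {φ : S →+* R}
    (hφ : Function.Surjective φ) {x : ι → S} {v : ι → R} (hv : v ∈ koszul (fun i => φ (x i))) :
    ∃ w ∈ koszul x, ∀ i, φ (w i) = v i := by
  induction hv using Submodule.span_induction with
  | mem v hv =>
    obtain ⟨i, j, rfl⟩ := hv
    exact ⟨_, koszul_gen_mem x i j, fun k => by simp [Pi.single_apply, apply_ite φ]⟩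
  | zero => exact ⟨0, zero_mem _, by simp⟩
  | add v w _ _ hv hw =>
    obtain ⟨v', hv', h1⟩ := hv
    obtain ⟨w', hw', h2⟩ := hw
    exact ⟨_, add_mem hv' hw', fun i => by simp [h1, h2]⟩
  | smul a v _ hv =>
    obtain ⟨v', hv', h1⟩ := hv
    obtain ⟨a', rfl⟩ := hφ a
    exact ⟨_, Submodule.smul_mem _ a' hv', fun i => by simp [h1]⟩

end Koszul

/-! ### Minimal generators over local rings -/

section LocalRing

variable {S : Type*} [CommRing S] [IsLocalRing S]

theorem isUnit_of_notMem {a : S} (h : a ∉ maximalIdeal S) : IsUnit a := by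
  simpa [mem_maximalIdeal] using h

/-- A submodule that contains a finitely generated submodule up to `𝔫` times it contains it. -/
theorem le_of_le_sup_maximalIdeal_smul {M : Type*} [AddCommGroup M] [Module S M]
    {N N' : Submodule S M} (hfg : N'.FG) (h : N' ≤ N ⊔ maximalIdeal S • N') : N' ≤ N :=
  Submodule.le_of_le_smul_of_le_jacobson_bot hfg (maximalIdeal_le_jacobson ⊥) h

/-- A set of generators contains a minimal system of generators modulo an ideal. -/
theorem exists_minimal_generators_mod [IsNoetherianRing S] (E : Set S) (N : Ideal S) :
    ∃ (e : ℕ) (z : Fin e → S), (∀ i, z i ∈ E) ∧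
      Ideal.span E ≤ N ⊔ Ideal.span (Set.range z) ∧
      ∀ α : Fin e → S, ∑ i, α i * z i ∈ N → ∀ i, α i ∈ maximalIdeal S := by
  classical
  let P : ℕ → Prop := fun e => ∃ z : Fin e → S, (∀ i, z i ∈ E) ∧
    Ideal.span E ≤ N ⊔ Ideal.span (Set.range z)
  have hP : ∃ e, P e := by
    obtain ⟨E', hE', hspan⟩ := Submodule.fg_span_iff_fg_span_finset_subset E |>.mp
      (IsNoetherian.noetherian (Ideal.span E))
    refine ⟨E'.card, fun i => (E'.equivFin.symm i : S), fun i => hE' (E'.equivFin.symm i).2, ?_⟩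
    refine le_trans (le_of_eq ?_) le_sup_right
    rw [show Set.range (fun i => (E'.equivFin.symm i : S)) = E' by
      rw [show (fun i => (E'.equivFin.symm i : S)) = Subtype.val ∘ E'.equivFin.symm from rfl,
        E'.equivFin.symm.surjective.range_comp, Subtype.range_coe]]
    exact hspan
  obtain ⟨z, hz, hspan⟩ := Nat.find_spec hP
  refine ⟨Nat.find hP, z, hz, hspan, fun α hα i => ?_⟩
  -- A unit coefficient would make `z i` redundant, against the minimality of the number of
  -- generators.
  by_contra hi
  obtain ⟨u, hu⟩ := isUnit_of_notMem hi
  generalize he : Nat.find hP = e at *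
  cases e with
  | zero => exact i.elim0
  | succ e =>
    have : P e := by
      refine ⟨fun j => z (i.succAbove j), fun j => hz _, hspan.trans ?_⟩
      refine sup_le le_sup_left (Ideal.span_le.mpr ?_)
      have hmem : ∀ j : Fin e, z (i.succAbove j) ∈
          N ⊔ Ideal.span (Set.range fun j => z (i.succAbove j)) := fun j =>
        Ideal.mem_sup_right (Ideal.subset_span ⟨j, rfl⟩)
      rintro _ ⟨k, rfl⟩
      rcases Fin.eq_self_or_eq_succAbove i k with rfl | ⟨j, rfl⟩
      · have h1 : α k * z k = (∑ i, α i * z i) - ∑ j, α (k.succAbove j) * z (k.succAbove j) := by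
          rw [Fin.sum_univ_succAbove _ k]; ring
        have h2 : α k * z k ∈ N ⊔ Ideal.span (Set.range fun j => z (k.succAbove j)) := by
          rw [h1]
          exact sub_mem (Ideal.mem_sup_left hα)
            (Ideal.sum_mem _ fun j _ => Ideal.mul_mem_left _ _ (hmem j))
        rw [← hu] at h2
        simpa using Ideal.mul_mem_left _ (↑u⁻¹ : S) h2
      · exact hmem j
    have := Nat.find_min' hP this
    omega

variable (S) in
theorem exists_fin_spanFinrank_generators [IsNoetherianRing S] :
    ∃ z : Fin (maximalIdeal S).spanFinrank → S, Ideal.span (Set.range z) = maximalIdeal S := by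
  have hfg : (maximalIdeal S).FG := IsNoetherian.noetherian _
  have h1 := Submodule.FG.generators_ncard hfg
  have h2 := Submodule.FG.finite_generators hfg
  have := h2.fintype
  let e : Fin (maximalIdeal S).spanFinrank ≃ (maximalIdeal S).generators :=
    (finCongr (by rw [← h1, Set.ncard_eq_toFinset_card', Set.toFinset_card])).trans
      (Fintype.equivFin _).symm
  refine ⟨fun i => e i, ?_⟩
  rw [show Set.range (fun i => (e i : S)) = (maximalIdeal S).generators by
    rw [show (fun i => (e i : S)) = Subtype.val ∘ e from rfl, e.surjective.range_comp,
      Subtype.range_coe]]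
  exact Submodule.span_generators _

theorem spanFinrank_le_of_span_eq {S : Type*} [CommRing S] {d : ℕ} {z : Fin d → S} {I : Ideal S}
    (hz : Ideal.span (Set.range z) = I) : I.spanFinrank ≤ d := by
  rw [← hz]
  refine (Submodule.spanFinrank_span_le_ncard_of_finite (Set.finite_range z)).trans ?_
  rw [← Set.image_univ]
  exact (Set.ncard_image_le Set.finite_univ).trans (by simp [Set.ncard_univ])

/-- A family of generators of `𝔫` of the least possible cardinality is independent modulo `𝔫²`. -/
theorem mem_maximalIdeal_of_sum_mem_sq [IsNoetherianRing S] {d : ℕ} {z : Fin d → S}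
    (hz : Ideal.span (Set.range z) = maximalIdeal S) (hd : (maximalIdeal S).spanFinrank = d)
    {α : Fin d → S} (hα : ∑ i, α i * z i ∈ maximalIdeal S ^ 2) (i : Fin d) :
    α i ∈ maximalIdeal S := by
  by_contra hi
  obtain ⟨u, hu⟩ := isUnit_of_notMem hi
  cases d with
  | zero => exact i.elim0
  | succ d =>
    -- The relation expresses `z i` through the others modulo 𝔫², so by Nakayama they generate 𝔫
    -- without it.
    have hle : maximalIdeal S ≤ Ideal.span (Set.range fun j => z (i.succAbove j)) := by
      refine le_of_le_sup_maximalIdeal_smul (IsNoetherian.noetherian _) ?_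
      rw [smul_eq_mul, ← pow_two]
      conv_lhs => rw [← hz]
      refine Ideal.span_le.mpr ?_
      have hmem : ∀ j : Fin d, z (i.succAbove j) ∈
          Ideal.span (Set.range fun j => z (i.succAbove j)) ⊔ maximalIdeal S ^ 2 := fun j =>
        Ideal.mem_sup_left (Ideal.subset_span ⟨j, rfl⟩)
      rintro _ ⟨k, rfl⟩
      rcases Fin.eq_self_or_eq_succAbove i k with rfl | ⟨j, rfl⟩
      · have h1 : α k * z k = (∑ i, α i * z i) - ∑ j, α (k.succAbove j) * z (k.succAbove j) := by
          rw [Fin.sum_univ_succAbove _ k]; ring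
        have h2 : α k * z k ∈
            Ideal.span (Set.range fun j => z (k.succAbove j)) ⊔ maximalIdeal S ^ 2 := by
          rw [h1]
          exact sub_mem (Ideal.mem_sup_right hα)
            (Ideal.sum_mem _ fun j _ => Ideal.mul_mem_left _ _ (hmem j))
        rw [← hu] at h2
        simpa using Ideal.mul_mem_left _ (↑u⁻¹ : S) h2
      · exact hmem j
    have heq : Ideal.span (Set.range fun j => z (i.succAbove j)) = maximalIdeal S := by
      refine le_antisymm (Ideal.span_le.mpr ?_) hle
      rintro _ ⟨j, rfl⟩
      rw [← hz]
      exact Ideal.subset_span ⟨_, rfl⟩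
    have := spanFinrank_le_of_span_eq heq
    omega

end LocalRing

end Burch

/-! ### Regular local rings: domains with acyclic Koszul relations -/

namespace Burch

open IsLocalRing

section Regular

variable {S : Type u} [CommRing S] [IsRegularLocalRing S]

theorem isLocalRing_quotient_of_le {S : Type*} [CommRing S] [IsLocalRing S] {I : Ideal S}
    (hI : I ≤ maximalIdeal S) : IsLocalRing (S ⧸ I) :=
  have : Nontrivial (S ⧸ I) := Ideal.Quotient.nontrivial_iff.mpr fun h =>
    (Ideal.IsPrime.ne_top' : maximalIdeal S ≠ ⊤) (top_le_iff.mp (h ▸ hI))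
  IsLocalRing.of_surjective' (Ideal.Quotient.mk I) Ideal.Quotient.mk_surjective

theorem map_mem_maximalIdeal {S R : Type*} [CommRing S] [IsLocalRing S] [CommRing R]
    [IsLocalRing R] {φ : S →+* R} (hφ : Function.Surjective φ) {x : S}
    (hx : x ∈ maximalIdeal S) : φ x ∈ maximalIdeal R := by
  rw [← map_maximalIdeal_of_surjective φ hφ]
  exact Ideal.mem_map_of_mem φ hx

theorem map_mem_maximalIdeal_iff {S R : Type*} [CommRing S] [IsLocalRing S] [CommRing R]
    [IsLocalRing R] {φ : S →+* R} (hφ : Function.Surjective φ) {x : S} :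
    φ x ∈ maximalIdeal R ↔ x ∈ maximalIdeal S := by
  refine ⟨fun h => ?_, map_mem_maximalIdeal hφ⟩
  by_contra hx
  exact (mem_maximalIdeal _).mp h ((isUnit_of_notMem hx).map φ)

/-- The quotient of a regular local ring of dimension `d + 1` by an element outside `𝔫²` is
regular of dimension `d`. -/
theorem isRegularLocalRing_quotient_span_singleton {x : S} (hx : x ∈ maximalIdeal S)
    (hx2 : x ∉ maximalIdeal S ^ 2) : IsRegularLocalRing (S ⧸ Ideal.span {x}) ∧
    ∀ [IsLocalRing (S ⧸ Ideal.span {x})],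
      (maximalIdeal (S ⧸ Ideal.span {x})).spanFinrank + 1 = (maximalIdeal S).spanFinrank := by
  have hle : Ideal.span {x} ≤ maximalIdeal S := by simpa [Ideal.span_le] using hx
  have := isLocalRing_quotient_of_le hle
  have hsurj := Ideal.Quotient.mk_surjective (I := Ideal.span {x})
  obtain ⟨z, hz⟩ := exists_fin_spanFinrank_generators S
  have hdim := (isRegularLocalRing_iff S).mp inferInstance
  generalize (maximalIdeal S).spanFinrank = d at z hz hdim ⊢
  obtain ⟨c, hc⟩ := Ideal.mem_span_range_iff_exists_fun.mp (hz ▸ hx)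
  -- As `x ∉ 𝔫²`, some coefficient is a unit, and that generator becomes redundant modulo `x`.
  have hex : ∃ i, c i ∉ maximalIdeal S := by
    by_contra! h
    refine hx2 ?_
    rw [← hc, pow_two]
    exact Ideal.sum_mem _ fun i _ => Ideal.mul_mem_mul (h i) (hz ▸ Ideal.subset_span ⟨i, rfl⟩)
  obtain ⟨i, hi⟩ := hex
  obtain ⟨u, hu⟩ := isUnit_of_notMem hi
  cases d with
  | zero => exact i.elim0
  | succ d =>
    have hspan : Ideal.span (Set.range fun j =>
        Ideal.Quotient.mk (Ideal.span {x}) (z (i.succAbove j))) =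
        maximalIdeal (S ⧸ Ideal.span {x}) := by
      rw [← map_maximalIdeal_of_surjective _ hsurj, ← hz, Ideal.map_span]
      refine le_antisymm (Ideal.span_mono ?_) (Ideal.span_le.mpr ?_)
      · rintro _ ⟨j, rfl⟩; exact ⟨_, ⟨_, rfl⟩, rfl⟩
      · rintro _ ⟨_, ⟨k, rfl⟩, rfl⟩
        rcases Fin.eq_self_or_eq_succAbove i k with rfl | ⟨j, rfl⟩
        · have h1 : z k = ↑u⁻¹ * x - ∑ j, ↑u⁻¹ * c (k.succAbove j) * z (k.succAbove j) := by
            rw [← hc, Fin.sum_univ_succAbove _ k, ← hu, mul_add, ← mul_assoc]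
            simp [Finset.mul_sum, mul_assoc]
          have h2 : Ideal.Quotient.mk (Ideal.span {x}) x = 0 :=
            Ideal.Quotient.eq_zero_iff_mem.mpr (Ideal.mem_span_singleton_self x)
          rw [h1, map_sub, map_mul _ _ x, h2, mul_zero, zero_sub, map_sum]
          exact neg_mem (Ideal.sum_mem _ fun j _ => by
            rw [map_mul]; exact Ideal.mul_mem_left _ _ (Ideal.subset_span ⟨j, rfl⟩))
        · exact Ideal.subset_span ⟨j, rfl⟩
    have h1 := spanFinrank_le_of_span_eq hspan
    have h2 := ringKrullDim_le_ringKrullDim_quotient_add_spanFinrank (Ideal.span {x})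
      (by rwa [IsLocalRing.ringJacobson_eq_maximalIdeal])
    have h3 : (Ideal.span {x}).spanFinrank ≤ 1 :=
      (Submodule.spanFinrank_span_le_ncard_of_finite (Set.finite_singleton x)).trans (by simp)
    have h4 : ((d : WithBot ℕ∞) + 1) ≤ ringKrullDim (S ⧸ Ideal.span {x}) + 1 := by
      rw [← hdim] at h2
      push_cast at h2
      exact h2.trans (by gcongr; exact_mod_cast h3)
    have h5 : (d : WithBot ℕ∞) ≤ ringKrullDim (S ⧸ Ideal.span {x}) :=
      ENat.WithBot.add_le_add_one_right_iff.mp h4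
    -- The maximal ideal of the quotient has `d` generators, and the dimension is at least `d`
    -- because one equation lowers it by at most one.
    have hreg : IsRegularLocalRing (S ⧸ Ideal.span {x}) :=
      IsRegularLocalRing.of_spanFinrank_maximalIdeal_le _
        ((by exact_mod_cast h1 : ((maximalIdeal (S ⧸ Ideal.span {x})).spanFinrank :
          WithBot ℕ∞) ≤ d).trans h5)
    refine ⟨hreg, ?_⟩
    intro _
    have h6 := (isRegularLocalRing_iff _).mp hreg
    rw [← h6] at h5
    have : d ≤ (maximalIdeal (S ⧸ Ideal.span {x})).spanFinrank := by exact_mod_cast h5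
    omega

theorem maximalIdeal_eq_bot_of_spanFinrank_eq_zero {S : Type*} [CommRing S] [IsLocalRing S]
    [IsNoetherianRing S] (h : (maximalIdeal S).spanFinrank = 0) : maximalIdeal S = ⊥ := by
  obtain ⟨z, hz⟩ := exists_fin_spanFinrank_generators S
  rw [← hz, Ideal.span_eq_bot]
  rintro _ ⟨i, rfl⟩
  exact (Fin.cast h i).elim0

/-- A regular local ring is a domain. -/
theorem isDomain_of_isRegularLocalRing : ∀ (d : ℕ) (S : Type u) [CommRing S]
    [IsRegularLocalRing S], (maximalIdeal S).spanFinrank = d → IsDomain S := by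
  intro d
  induction d with
  | zero =>
    intro S _ _ hd
    exact (isField_iff_maximalIdeal_eq.mpr
      (maximalIdeal_eq_bot_of_spanFinrank_eq_zero hd)).isDomain
  | succ d ih =>
    intro S _ _ hd
    have hdim := (isRegularLocalRing_iff S).mp inferInstance
    rw [hd] at hdim
    have hfg : (maximalIdeal S).FG := IsNoetherian.noetherian _
    -- Prime avoidance tolerates the non-prime ideal 𝔫²; no minimal prime contains 𝔫, which has
    -- height `d + 1`.
    have hex : ∃ x ∈ maximalIdeal S, x ∉ maximalIdeal S ^ 2 ∧ ∀ P ∈ minimalPrimes S, x ∉ P := by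
      by_contra! h
      have hsub : (maximalIdeal S : Set S) ⊆
          ⋃ i ∈ insert (maximalIdeal S ^ 2) (minimalPrimes S), ((id i : Ideal S) : Set S) := by
        intro x hx
        by_cases hx2 : x ∈ maximalIdeal S ^ 2
        · exact Set.mem_biUnion (Set.mem_insert _ _) hx2
        · obtain ⟨P, hP, hxP⟩ := h x hx hx2
          exact Set.mem_biUnion (Set.mem_insert_of_mem _ hP) hxP
      obtain ⟨P, hP, hle⟩ := (Ideal.subset_union_prime_finite
        ((minimalPrimes.finite_of_isNoetherianRing S).insert _) (f := id) (maximalIdeal S ^ 2)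
        (maximalIdeal S ^ 2)
        (fun i hi hne _ => (Set.mem_of_mem_insert_of_ne hi hne).1.1)).mp hsub
      rcases hP with rfl | hP
      · have hbot : maximalIdeal S ≤ ⊥ := le_of_le_sup_maximalIdeal_smul hfg (by
          rw [bot_sup_eq, smul_eq_mul, ← pow_two]; exact hle)
        rw [le_bot_iff.mp hbot] at hd
        simp at hd
      · have hprime : P.IsPrime := hP.1.1
        have : P = maximalIdeal S := le_antisymm (le_maximalIdeal hprime.ne_top) hle
        subst this
        have h0 : (maximalIdeal S).height = 0 := Ideal.height_eq_zero_iff.mpr hP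
        have := maximalIdeal_height_eq_ringKrullDim (R := S)
        rw [h0, ← hdim] at this
        have : (0 : ℕ) = d + 1 := by exact_mod_cast this
        omega
    obtain ⟨x, hx, hx2, hxP⟩ := hex
    obtain ⟨hreg, hrank⟩ := isRegularLocalRing_quotient_span_singleton hx hx2
    have hdom := ih (S ⧸ Ideal.span {x}) (by have := hrank; omega)
    have hprime : (Ideal.span {x}).IsPrime := (Ideal.Quotient.isDomain_iff_prime _).mp hdom
    obtain ⟨P, hP, hle⟩ := Ideal.exists_minimalPrimes_le (J := Ideal.span {x}) (I := ⊥) bot_le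
    have hPp : P.IsPrime := hP.1.1
    -- Here `P ⊆ (x)` and `x ∉ P`, so every element of `P` is `x` times an element of `P`; Nakayama
    -- gives `P = 0`.
    have hbot : P ≤ ⊥ := le_of_le_sup_maximalIdeal_smul (IsNoetherian.noetherian _) (by
      intro p hp
      obtain ⟨y, rfl⟩ := Ideal.mem_span_singleton.mp (hle hp)
      exact Submodule.mem_sup_right (Submodule.smul_mem_smul hx
        ((hPp.mem_or_mem hp).resolve_left (hxP P hP))))
    rw [le_bot_iff.mp hbot] at hPp
    exact IsDomain.of_bot_isPrime S

instance (priority := 50) instIsDomainOfIsRegularLocalRing : IsDomain S :=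
  isDomain_of_isRegularLocalRing _ S rfl

theorem notMem_sq_of_generator {d : ℕ} {z : Fin d → S}
    (hz : Ideal.span (Set.range z) = maximalIdeal S) (hd : (maximalIdeal S).spanFinrank = d)
    (i : Fin d) : z i ∉ maximalIdeal S ^ 2 := by
  intro h
  have := mem_maximalIdeal_of_sum_mem_sq hz hd (α := Pi.single i 1)
    (by simpa [Pi.single_apply] using h) i
  rw [Pi.single_eq_same] at this
  exact (Ideal.ne_top_iff_one _).mp Ideal.IsPrime.ne_top' this

/-- The first Koszul homology of a regular system of parameters vanishes. -/
theorem mem_koszul_of_sum_mul_eq_zero : ∀ (d : ℕ) (S : Type u) [CommRing S]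
    [IsRegularLocalRing S] (z : Fin d → S), Ideal.span (Set.range z) = maximalIdeal S →
    (maximalIdeal S).spanFinrank = d → ∀ c : Fin d → S, ∑ i, c i * z i = 0 → c ∈ koszul z := by
  intro d
  induction d with
  | zero =>
    intro S _ _ z _ _ c _
    rw [Subsingleton.elim c 0]
    exact zero_mem _
  | succ d ih =>
    intro S _ _ z hz hd c hc
    have hx : z 0 ∈ maximalIdeal S := hz ▸ Ideal.subset_span ⟨0, rfl⟩
    have hx2 := notMem_sq_of_generator hz hd 0
    obtain ⟨hreg, hrank⟩ := isRegularLocalRing_quotient_span_singleton hx hx2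
    have hsurj := Ideal.Quotient.mk_surjective (I := Ideal.span {z 0})
    have h0 : Ideal.Quotient.mk (Ideal.span {z 0}) (z 0) = 0 :=
      Ideal.Quotient.eq_zero_iff_mem.mpr (Ideal.mem_span_singleton_self _)
    have hk := ih (S ⧸ Ideal.span {z 0}) (fun i => Ideal.Quotient.mk _ (z i.succ)) (by
        rw [← map_maximalIdeal_of_surjective _ hsurj, ← hz, Ideal.map_span]
        refine le_antisymm (Ideal.span_mono ?_) (Ideal.span_le.mpr ?_)
        · rintro _ ⟨j, rfl⟩; exact ⟨_, ⟨_, rfl⟩, rfl⟩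
        · rintro _ ⟨_, ⟨k, rfl⟩, rfl⟩
          cases k using Fin.cases with
          | zero => rw [h0]; exact zero_mem _
          | succ j => exact Ideal.subset_span ⟨j, rfl⟩)
      (by have := hrank; omega) (fun i => Ideal.Quotient.mk _ (c i.succ)) (by
        have := congrArg (Ideal.Quotient.mk (Ideal.span {z 0})) hc
        rw [Fin.sum_univ_succ, map_add, map_mul, h0, mul_zero, zero_add, map_zero] at this
        simpa using this)
    -- The Koszul relation modulo `z 0` is lifted. Off the coordinate 0 it differs from `c` by
    -- multiples of `z 0`, which `G` absorbs by Koszul relations involving `z 0`.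
    obtain ⟨w, hw, hwc⟩ := exists_lift_mem_koszul hsurj hk
    have hg : ∀ i : Fin d, ∃ g, c i.succ = w i + z 0 * g := fun i => by
      obtain ⟨g, hg⟩ := Ideal.mem_span_singleton.mp (Ideal.Quotient.eq.mp (hwc i).symm)
      exact ⟨g, by rw [← hg]; ring⟩
    choose g hg using hg
    let W : Fin (d + 1) → S := Matrix.vecMul w (Matrix.of fun (i : Fin d) => Pi.single i.succ 1)
    have hW : W ∈ koszul z := vecMul_mem_koszul _ (by simp [Pi.single_apply]) hw
    have hW0 : W 0 = 0 := by simp [W, Matrix.vecMul, dotProduct]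
    have hWs : ∀ i : Fin d, W i.succ = w i := fun i => by
      simp [W, Matrix.vecMul, dotProduct, Pi.single_apply]
    let G : Fin (d + 1) → S :=
      ∑ i : Fin d, g i • (z 0 • Pi.single i.succ 1 - z i.succ • Pi.single 0 1)
    have hG : G ∈ koszul z := Submodule.sum_mem _ fun i _ =>
      Submodule.smul_mem _ _ (koszul_gen_mem z i.succ 0)
    have hGs : ∀ i : Fin d, G i.succ = z 0 * g i := fun i => by
      simp [G, Finset.sum_apply, Pi.single_apply, mul_comm]
    have hD : ∀ i : Fin d, (c - W - G) i.succ = 0 := fun i => by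
      simp only [Pi.sub_apply, hWs, hGs, hg]; ring
    have hsum : ∑ i, (c - W - G) i * z i = 0 := by
      simp only [Pi.sub_apply, sub_mul, Finset.sum_sub_distrib, hc,
        sum_mul_eq_zero_of_mem_koszul hW, sum_mul_eq_zero_of_mem_koszul hG, sub_self]
    rw [Fin.sum_univ_succ] at hsum
    simp only [hD, zero_mul, Finset.sum_const_zero, add_zero] at hsum
    -- Only the coordinate at 0 is left, and `z 0` kills it in a domain.
    have hne : z 0 ≠ 0 := fun h => hx2 (h ▸ zero_mem _)
    have hD0 := (mul_eq_zero.mp hsum).resolve_right hne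
    have : c = W + G := by
      rw [← sub_eq_zero, ← sub_sub]
      funext i
      cases i using Fin.cases with
      | zero => exact hD0
      | succ i => exact hD i
    rw [this]
    exact add_mem hW hG

end Regular

end Burch

/-! ### Completions of rings: functoriality, Noetherianity, regularity -/

namespace Burch

open IsLocalRing

section Completion

variable {P Q : Type*} [CommRing P] [CommRing Q]

/-- The maps from an adic completion to the truncations of the target of a ring homomorphism. -/
noncomputable def completionMapAux (g : P →+* Q) (J : Ideal P) (K : Ideal Q) (h : J.map g ≤ K)
    (n : ℕ) : AdicCompletion J P →+* Q ⧸ K ^ n :=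
  (Ideal.quotientMap (K ^ n) g (I := J ^ n) (by
    rw [← Ideal.map_le_iff_le_comap, Ideal.map_pow]
    exact Ideal.pow_right_mono h n)).comp (AdicCompletion.evalₐ J n : _ →+* _)

theorem factorPow_comp_completionMapAux (g : P →+* Q) (J : Ideal P) (K : Ideal Q)
    (h : J.map g ≤ K) {m n : ℕ} (hmn : m ≤ n) :
    (Ideal.Quotient.factorPow K hmn).comp (completionMapAux g J K h n) =
      completionMapAux g J K h m := by
  ext x
  induction x using AdicCompletion.induction_on with
  | _ a =>
    have := AdicCompletion.Ideal.mk_eq_mk J hmn a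
    simp [completionMapAux, ← this]

/-- The ring homomorphism between adic completions induced by a ring homomorphism. -/
noncomputable def completionMap (g : P →+* Q) (J : Ideal P) (K : Ideal Q) (h : J.map g ≤ K) :
    AdicCompletion J P →+* AdicCompletion K Q :=
  AdicCompletion.liftRingHom K (completionMapAux g J K h)
    (factorPow_comp_completionMapAux g J K h)

theorem evalₐ_completionMap (g : P →+* Q) (J : Ideal P) (K : Ideal Q) (h : J.map g ≤ K) (n : ℕ)
    {x : AdicCompletion J P} {p : P} (hp : AdicCompletion.evalₐ J n x = Ideal.Quotient.mk _ p) :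
    AdicCompletion.evalₐ K n (completionMap g J K h x) = Ideal.Quotient.mk _ (g p) := by
  refine (AdicCompletion.evalₐ_liftRingHom K _
    (factorPow_comp_completionMapAux g J K h) n x).trans ?_
  simp [completionMapAux, hp]

theorem completionMap_algebraMap (g : P →+* Q) (J : Ideal P) (K : Ideal Q) (h : J.map g ≤ K)
    (p : P) : completionMap g J K h (algebraMap P _ p) = algebraMap Q _ (g p) := by
  refine AdicCompletion.ext_evalₐ fun n => ?_
  rw [evalₐ_completionMap g J K h n (p := p) (by simp)]
  simp

/-- Successive approximation: the source is complete and the target separated, so surjectivity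
modulo `J` is enough. -/
theorem completionMap_surjective (g : P →+* Q) (J : Ideal P) (hJ : J.FG)
    (hg : ∀ q, ∃ p, q - g p ∈ J.map g) :
    Function.Surjective (completionMap g J (J.map g) le_rfl) := by
  have h1 := AdicCompletion.isAdicComplete_self J hJ
  have h2 := AdicCompletion.isAdicComplete_self (J.map g) (hJ.map g)
  have hmap : (J.map (algebraMap P (AdicCompletion J P))).map
      (completionMap g J (J.map g) le_rfl) =
      (J.map g).map (algebraMap Q (AdicCompletion (J.map g) Q)) := by
    rw [Ideal.map_map, Ideal.map_map]
    exact congrArg (Ideal.map · J) (RingHom.ext (completionMap_algebraMap g J (J.map g) le_rfl))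
  have : IsHausdorff ((J.map (algebraMap P (AdicCompletion J P))).map
      (completionMap g J (J.map g) le_rfl)) (AdicCompletion (J.map g) Q) := by
    rw [hmap]; infer_instance
  refine surjective_of_mk_map_comp_surjective _
    (I := J.map (algebraMap P (AdicCompletion J P))) ?_
  intro y
  obtain ⟨y, rfl⟩ := Ideal.Quotient.mk_surjective y
  obtain ⟨q, hq⟩ := Ideal.Quotient.mk_surjective (AdicCompletion.evalₐ (J.map g) 1 y)
  obtain ⟨p, hp⟩ := hg q
  refine ⟨algebraMap P _ p, ?_⟩
  rw [RingHom.comp_apply, completionMap_algebraMap, Ideal.Quotient.eq, hmap,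
    ← AdicCompletion.ker_evalOneₐ_eq_map _ (hJ.map g)]
  change AdicCompletion.evalOneₐ _ _ = 0
  rw [map_sub, ← AdicCompletion.factorₐ_evalₐ_one (x := y), ← hq]
  have : AdicCompletion.evalOneₐ (J.map g) (algebraMap Q _ (g p)) = Ideal.Quotient.mk _ (g p) := by
    simp
  rw [this, Ideal.Quotient.factor_mk, ← map_sub, Ideal.Quotient.eq_zero_iff_mem,
    ← neg_mem_iff, neg_sub]
  exact hp

theorem completionMap_surjective_of_map_eq (g : P →+* Q) (J : Ideal P) (hJ : J.FG) (K : Ideal Q)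
    (hK : J.map g = K) (hg : Function.Surjective g) :
    Function.Surjective (completionMap g J K hK.le) := by
  subst hK
  exact completionMap_surjective g J hJ fun q => by
    obtain ⟨p, rfl⟩ := hg q
    exact ⟨p, by simp⟩

/-- The completion of a Noetherian ring is Noetherian. -/
theorem isNoetherianRing_adicCompletion [IsNoetherianRing Q] (K : Ideal Q) :
    IsNoetherianRing (AdicCompletion K Q) := by
  obtain ⟨n, z, hz⟩ := Submodule.fg_iff_exists_fin_generating_family.mp
    (IsNoetherian.noetherian K)
  let g : MvPolynomial (Fin n) Q →+* Q := MvPolynomial.eval z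
  have hg : (MvPolynomial.idealOfVars (Fin n) Q).map g = K := by
    rw [MvPolynomial.idealOfVars, Ideal.map_span, ← Set.range_comp, ← hz]
    congr
    funext i
    simp [g]
  -- The polynomial ring completed along its variables is a power series ring; sending the variables
  -- to generators of `K` makes the completion of `Q` a quotient of it.
  have : IsNoetherianRing (AdicCompletion (MvPolynomial.idealOfVars (Fin n) Q)
      (MvPolynomial (Fin n) Q)) :=
    isNoetherianRing_of_ringEquiv _ (MvPowerSeries.toAdicCompletionAlgEquiv (Fin n) Q).toRingEquiv
  rw [← hg]
  refine isNoetherianRing_of_surjective _ _ _ (completionMap_surjective g _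
    (IsNoetherian.noetherian _) fun q => ⟨MvPolynomial.C q, by simp [g]⟩)

end Completion

/-- The completion of a regular local ring is regular. -/
theorem isRegularLocalRing_adicCompletion (S : Type*) [CommRing S] [IsRegularLocalRing S] :
    IsRegularLocalRing (AdicCompletion (maximalIdeal S) S) := by
  have := isNoetherianRing_adicCompletion (maximalIdeal S)
  refine IsRegularLocalRing.of_spanFinrank_maximalIdeal_le _ ?_
  rw [AdicCompletion.spanFinrank_maximalIdeal_eq, (isRegularLocalRing_iff S).mp inferInstance,
    ← maximalIdeal_height_eq_ringKrullDim, ← maximalIdeal_height_eq_ringKrullDim]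
  have : (maximalIdeal (AdicCompletion (maximalIdeal S) S)).LiesOver (maximalIdeal S) :=
    ⟨(maximalIdeal_comap (algebraMap S (AdicCompletion (maximalIdeal S) S))).symm⟩
  -- Completion is flat, so going down holds and the height of the maximal ideal cannot drop, while
  -- the number of generators is unchanged.
  rw [Ideal.height_eq_height_add_of_liesOver_of_hasGoingDown (maximalIdeal S)
    (maximalIdeal (AdicCompletion (maximalIdeal S) S))]
  exact_mod_cast le_self_add

end Burch

/-! ### Lengths as numbers of spanning elements -/

namespace Burch

open IsLocalRing

section Length

variable {S : Type*} [CommRing S] [IsLocalRing S]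

/-- A module killed by 𝔫 is a vector space, and its length is its dimension. The form `≤ l` is
convenient: spanning by `l` elements, zeros allowed, transfers along ring maps without a choice of
bases. -/
theorem length_le_natCast_iff {M : Type*} [AddCommGroup M] [Module S M]
    (hM : ∀ x ∈ maximalIdeal S, ∀ m : M, x • m = 0) (l : ℕ) :
    Module.length S M ≤ l ↔ ∃ w : Fin l → M, Submodule.span S (Set.range w) = ⊤ := by
  have htor : Module.IsTorsionBySet S M (maximalIdeal S) := fun m x => hM x x.2 m
  let _ : Field (S ⧸ maximalIdeal S) := Ideal.Quotient.field _
  let _ : Module (S ⧸ maximalIdeal S) M := htor.module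
  have : IsScalarTower S (S ⧸ maximalIdeal S) M := htor.isScalarTower
  have hsurj : Function.Surjective (algebraMap S (S ⧸ maximalIdeal S)) :=
    Ideal.Quotient.mk_surjective
  rw [Module.length_eq_of_surjective hsurj]
  have hspan : ∀ s : Set M, Submodule.span S s = ⊤ ↔
      Submodule.span (S ⧸ maximalIdeal S) s = ⊤ := by
    intro s
    rw [← Submodule.restrictScalars_eq_top_iff S (S ⧸ maximalIdeal S) M,
      Submodule.restrictScalars_span S (S ⧸ maximalIdeal S) hsurj]
  simp only [hspan]
  constructor
  · intro h
    have hfin : Module.Finite (S ⧸ maximalIdeal S) M := by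
      have h1 := Module.length_ne_top_iff.mp (ne_top_of_le_ne_top (ENat.natCast_ne_top l) h)
      have := (isFiniteLength_iff_isNoetherian_isArtinian.mp h1).1
      infer_instance
    rw [Module.length_eq_finrank, Nat.cast_le] at h
    let b := Module.finBasis (S ⧸ maximalIdeal S) M
    refine ⟨fun i => if hi : (i : ℕ) < Module.finrank (S ⧸ maximalIdeal S) M then b ⟨i, hi⟩
      else 0, ?_⟩
    rw [← top_le_iff, ← b.span_eq]
    refine Submodule.span_mono ?_
    rintro _ ⟨i, rfl⟩
    exact ⟨⟨i, i.2.trans_le h⟩, by simp⟩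
  · rintro ⟨w, hw⟩
    refine (Module.length_le_of_surjective
      (Fintype.linearCombination (S ⧸ maximalIdeal S) w) ?_).trans ?_
    · rw [← LinearMap.range_eq_top, Fintype.range_linearCombination, hw]
    · rw [Module.length_eq_finrank]; simp

/-- `N` is generated by `l` of its elements modulo `B`. -/
def IsSpannedMod (N B : Ideal S) (l : ℕ) : Prop :=
  ∃ w : Fin l → S, (∀ i, w i ∈ N) ∧ N ≤ B ⊔ Ideal.span (Set.range w)

theorem length_quotient_submoduleOf_le_iff {N B : Ideal S} (h : maximalIdeal S * N ≤ B) (l : ℕ) :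
    Module.length S (N ⧸ B.submoduleOf N) ≤ l ↔ IsSpannedMod N B l := by
  rw [length_le_natCast_iff (by
    intro x hx m
    obtain ⟨m, rfl⟩ := Submodule.Quotient.mk_surjective _ m
    rw [← Submodule.Quotient.mk_smul, Submodule.Quotient.mk_eq_zero, Submodule.submoduleOf,
      Submodule.mem_comap]
    exact h (Ideal.mul_mem_mul hx m.2))]
  have key : ∀ w : Fin l → N, Submodule.span S (Set.range fun i =>
      (Submodule.Quotient.mk (w i) : N ⧸ B.submoduleOf N)) = ⊤ ↔
      N ≤ B ⊔ Ideal.span (Set.range fun i => (w i : S)) := by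
    intro w
    rw [show (Set.range fun i => (Submodule.Quotient.mk (w i) : N ⧸ B.submoduleOf N)) =
      (B.submoduleOf N).mkQ '' Set.range w by rw [← Set.range_comp]; rfl, ← Submodule.map_span,
      Submodule.map_mkQ_eq_top]
    have hle : Ideal.span (Set.range fun i => (w i : S)) ≤ N :=
      Ideal.span_le.mpr (by rintro _ ⟨i, rfl⟩; exact (w i).2)
    have hmap : (B.submoduleOf N ⊔ Submodule.span S (Set.range w)).map N.subtype =
        N ⊓ (B ⊔ Ideal.span (Set.range fun i => (w i : S))) := by
      rw [Submodule.map_sup, Submodule.submoduleOf, Submodule.map_comap_subtype,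
        Submodule.map_span, ← Set.range_comp]
      exact inf_sup_assoc_of_le _ hle
    rw [← (Submodule.map_injective_of_injective N.injective_subtype).eq_iff, hmap,
      Submodule.map_subtype_top, inf_eq_left]
  constructor
  · rintro ⟨w, hw⟩
    choose v hv using fun i => Submodule.Quotient.mk_surjective _ (w i)
    refine ⟨fun i => v i, fun i => (v i).2, (key v).mp ?_⟩
    simpa [hv] using hw
  · rintro ⟨w, hw, hN⟩
    exact ⟨_, (key fun i => ⟨w i, hw i⟩).mpr hN⟩

end Length
end Burch

/-! ### The Burch ideal in terms of the presented ring -/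

namespace Burch

open IsLocalRing

section Intrinsic

variable {R ι : Type*} [CommRing R] [IsLocalRing R] [Fintype ι] [DecidableEq ι]

/-- The vectors whose multiples by socle elements are Koszul relations. -/
def socleKoszul (y : ι → R) : Submodule R (ι → R) where
  carrier := {c | ∀ s : R, (∀ x ∈ maximalIdeal R, s * x = 0) → s • c ∈ koszul y}
  add_mem' ha hb s hs := by rw [smul_add]; exact add_mem (ha s hs) (hb s hs)
  zero_mem' s _ := by rw [smul_zero]; exact zero_mem _
  smul_mem' a c hc s hs := by rw [smul_comm]; exact Submodule.smul_mem _ a (hc s hs)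

/-- The Burch ideal of a local ring in terms of generators `y` of its maximal ideal; it is the image
of the Burch ideal of the defining ideal in any regular presentation. -/
def innerBurchIdeal (y : ι → R) : Ideal R :=
  (socleKoszul y).map (Fintype.linearCombination R y)

theorem mem_innerBurchIdeal {y : ι → R} {z : R} :
    z ∈ innerBurchIdeal y ↔ ∃ c ∈ socleKoszul y, ∑ i, c i * y i = z := by
  simp [innerBurchIdeal, Submodule.mem_map, Fintype.linearCombination_apply]

/-- If `x = g y`, a coefficient vector `c` for `x` becomes `c g` for `y`, and `g` carries Koszul
relations to Koszul relations. -/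
theorem innerBurchIdeal_mono {κ : Type*} [Fintype κ] [DecidableEq κ] {x : ι → R} {y : κ → R}
    (h : ∀ i, x i ∈ Ideal.span (Set.range y)) : innerBurchIdeal x ≤ innerBurchIdeal y := by
  choose g hg using fun i => Ideal.mem_span_range_iff_exists_fun.mp (h i)
  intro z hz
  obtain ⟨c, hc, rfl⟩ := mem_innerBurchIdeal.mp hz
  refine mem_innerBurchIdeal.mpr ⟨Matrix.vecMul c (Matrix.of g), fun s hs => ?_, ?_⟩
  · rw [← Matrix.smul_vecMul]
    exact vecMul_mem_koszul (Matrix.of g) (fun i => (hg i).symm) (hc s hs)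
  · simp only [Matrix.vecMul, dotProduct, Matrix.of_apply, ← hg, Finset.sum_mul, Finset.mul_sum]
    rw [Finset.sum_comm]
    exact Finset.sum_congr rfl fun i _ => Finset.sum_congr rfl fun j _ => by ring

theorem innerBurchIdeal_eq {κ : Type*} [Fintype κ] [DecidableEq κ] {x : ι → R} {y : κ → R}
    (h : Ideal.span (Set.range x) = Ideal.span (Set.range y)) :
    innerBurchIdeal x = innerBurchIdeal y :=
  le_antisymm (innerBurchIdeal_mono fun i => h ▸ Ideal.subset_span ⟨i, rfl⟩)
    (innerBurchIdeal_mono fun i => h ▸ Ideal.subset_span ⟨i, rfl⟩)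

/-- The coefficients may be chosen in the maximal ideal, and socle elements then annihilate them. -/
theorem maximalIdeal_sq_le_innerBurchIdeal {y : ι → R}
    (hy : Ideal.span (Set.range y) = maximalIdeal R) :
    maximalIdeal R * maximalIdeal R ≤ innerBurchIdeal y := by
  refine Ideal.mul_le.mpr fun x hx z hz => ?_
  obtain ⟨c, rfl⟩ := Ideal.mem_span_range_iff_exists_fun.mp (hy ▸ hz)
  refine mem_innerBurchIdeal.mpr ⟨x • c, fun s hs => ?_, ?_⟩
  · rw [smul_smul, hs x hx, zero_smul]; exact zero_mem _
  · simp [Finset.mul_sum, mul_assoc]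

end Intrinsic

section Presentation

variable {S R : Type*} [CommRing S] [IsLocalRing S] [CommRing R] [IsLocalRing R]

theorem mem_burchIdeal {I : Ideal S} {x : S} : x ∈ burchIdeal I ↔
    ∀ s, (∀ y ∈ maximalIdeal S, s * y ∈ I) → x * s ∈ I * maximalIdeal S := by
  simp only [burchIdeal, Submodule.mem_colon, SetLike.mem_coe, smul_eq_mul]

/-- A unit `s` would put the maximal ideal into the kernel, making `R` a field. -/
theorem mem_maximalIdeal_of_mul_mem {φ : S →+* R} (hφ : Function.Surjective φ)
    (hR : maximalIdeal R ≠ ⊥) {s : S} (hs : ∀ y ∈ maximalIdeal S, s * y ∈ RingHom.ker φ) :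
    s ∈ maximalIdeal S := by
  by_contra h
  obtain ⟨u, rfl⟩ := isUnit_of_notMem h
  refine hR (le_bot_iff.mp fun r hr => ?_)
  obtain ⟨y, rfl⟩ := hφ r
  have := hs y ((map_mem_maximalIdeal_iff hφ).mp hr)
  rw [RingHom.mem_ker, map_mul] at this
  have h1 : IsUnit (φ u) := u.isUnit.map φ
  exact (h1.mul_right_eq_zero).mp this

theorem mem_mul_maximalIdeal_iff {ι : Type*} [Fintype ι] {L : Ideal S} {y : ι → S}
    (hy : Ideal.span (Set.range y) = maximalIdeal S) {z : S} :
    z ∈ L * maximalIdeal S ↔ ∃ l : ι → S, (∀ i, l i ∈ L) ∧ ∑ i, l i * y i = z := by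
  constructor
  · intro h
    rw [← hy] at h
    induction h using Submodule.mul_induction_on' with
    | mem_mul_mem a ha b hb =>
      obtain ⟨c, rfl⟩ := Ideal.mem_span_range_iff_exists_fun.mp hb
      exact ⟨fun i => a * c i, fun i => Ideal.mul_mem_right _ _ ha, by
        simp [Finset.mul_sum, mul_assoc]⟩
    | add a _ b _ ha hb =>
      obtain ⟨l, hl, rfl⟩ := ha
      obtain ⟨l', hl', rfl⟩ := hb
      exact ⟨l + l', fun i => add_mem (hl i) (hl' i), by simp [add_mul, Finset.sum_add_distrib]⟩
  · rintro ⟨l, hl, rfl⟩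
    exact Ideal.sum_mem _ fun i _ => Ideal.mul_mem_mul (hl i) (hy ▸ Ideal.subset_span ⟨i, rfl⟩)

/-- The Burch ideal of a presentation in terms of the presented ring. -/
theorem mem_burchIdeal_ker_iff {ι : Type*} [Fintype ι] [DecidableEq ι] {φ : S →+* R}
    (hφ : Function.Surjective φ) (hR : maximalIdeal R ≠ ⊥) {y : ι → S}
    (hy : Ideal.span (Set.range y) = maximalIdeal S)
    (hk : ∀ c : ι → S, ∑ i, c i * y i = 0 → c ∈ koszul y) {z : S} (hz : z ∈ maximalIdeal S) :
    z ∈ burchIdeal (RingHom.ker φ) ↔ φ z ∈ innerBurchIdeal (fun i => φ (y i)) := by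
  have hlift : ∀ s, (∀ x ∈ maximalIdeal R, φ s * x = 0) ↔
      ∀ x ∈ maximalIdeal S, s * x ∈ RingHom.ker φ := by
    intro s
    simp only [RingHom.mem_ker, map_mul]
    refine ⟨fun h x hx => h _ (map_mem_maximalIdeal hφ hx), fun h x hx => ?_⟩
    obtain ⟨x, rfl⟩ := hφ x
    exact h x ((map_mem_maximalIdeal_iff hφ).mp hx)
  have key : ∀ (c : ι → S) (s : S), (∑ i, c i * y i) * s ∈ RingHom.ker φ * maximalIdeal S ↔
      (φ s • fun i => φ (c i)) ∈ koszul (fun i => φ (y i)) := by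
    intro c s
    rw [mem_mul_maximalIdeal_iff hy]
    constructor
    · rintro ⟨l, hl, hsum⟩
      -- Two expressions of one element in the generators `y` differ by a relation, which is Koszul;
      -- applying `φ` kills `l`.
      have h1 : (fun i => s * c i - l i) ∈ koszul y := hk _ (by
        simp only [sub_mul, Finset.sum_sub_distrib, hsum, Finset.sum_mul]
        rw [sub_eq_zero]
        exact Finset.sum_congr rfl fun i _ => by ring)
      convert map_mem_koszul φ h1 using 1
      funext i
      simp [RingHom.mem_ker.mp (hl i)]
    · intro h
      obtain ⟨w, hw, hwc⟩ := exists_lift_mem_koszul hφ h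
      refine ⟨fun i => s * c i - w i, fun i => ?_, ?_⟩
      · simp [RingHom.mem_ker, hwc]
      · simp only [sub_mul, Finset.sum_sub_distrib, sum_mul_eq_zero_of_mem_koszul hw, sub_zero,
          Finset.sum_mul]
        exact Finset.sum_congr rfl fun i _ => by ring
  rw [mem_burchIdeal, mem_innerBurchIdeal]
  constructor
  · intro h
    obtain ⟨c, rfl⟩ := Ideal.mem_span_range_iff_exists_fun.mp (hy ▸ hz)
    refine ⟨fun i => φ (c i), fun s hs => ?_, by simp⟩
    obtain ⟨s, rfl⟩ := hφ s
    exact (key c s).mp (h s ((hlift s).mp hs))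
  · rintro ⟨c, hc, hcz⟩ s hs
    choose c' hc' using fun i => hφ (c i)
    obtain rfl : (fun i => φ (c' i)) = c := funext hc'
    have h1 := (key c' s).mpr (hc (φ s) ((hlift s).mpr hs))
    -- The lifted coefficients represent `z` only up to the kernel; the error is harmless because `s
    -- ∈ 𝔫`.
    have h2 : z - ∑ i, c' i * y i ∈ RingHom.ker φ := by
      rw [RingHom.mem_ker, map_sub, ← hcz]; simp
    have h3 := Ideal.mul_mem_mul h2 (mem_maximalIdeal_of_mul_mem hφ hR hs)
    have := add_mem h3 h1
    rwa [← add_mul, sub_add_cancel] at this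

/-- Inside the maximal ideal `B` is the full preimage of `B'`, so spanning families can be pushed
forward and lifted. -/
theorem isSpannedMod_iff_of_surjective {φ : S →+* R} (hφ : Function.Surjective φ)
    {B : Ideal S} {B' : Ideal R} (h : ∀ z ∈ maximalIdeal S, z ∈ B ↔ φ z ∈ B') (l : ℕ) :
    IsSpannedMod (maximalIdeal S) B l ↔ IsSpannedMod (maximalIdeal R) B' l := by
  have key : ∀ w : Fin l → S, (∀ i, w i ∈ maximalIdeal S) →
      (maximalIdeal S ≤ B ⊔ Ideal.span (Set.range w) ↔
        maximalIdeal R ≤ B' ⊔ Ideal.span (Set.range fun i => φ (w i))) := by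
    intro w hw
    have hs : ∀ a : Fin l → S, ∑ i, a i * w i ∈ maximalIdeal S := fun a =>
      Ideal.sum_mem _ fun i _ => Ideal.mul_mem_left _ _ (hw i)
    constructor
    · intro H r hr
      obtain ⟨z, rfl⟩ := hφ r
      have hz := (map_mem_maximalIdeal_iff hφ).mp hr
      obtain ⟨b, hb, v, hv, rfl⟩ := Submodule.mem_sup.mp (H hz)
      obtain ⟨a, rfl⟩ := Ideal.mem_span_range_iff_exists_fun.mp hv
      have hbm : b ∈ maximalIdeal S := by simpa using sub_mem hz (hs a)
      rw [map_add]
      refine Submodule.add_mem_sup ((h b hbm).mp hb) ?_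
      exact Ideal.mem_span_range_iff_exists_fun.mpr ⟨fun i => φ (a i), by simp⟩
    · intro H z hz
      obtain ⟨b, hb, v, hv, hbv⟩ := Submodule.mem_sup.mp (H (map_mem_maximalIdeal hφ hz))
      obtain ⟨a, rfl⟩ := Ideal.mem_span_range_iff_exists_fun.mp hv
      choose a' ha' using fun i => hφ (a i)
      have h1 : z - ∑ i, a' i * w i ∈ B := (h _ (sub_mem hz (hs a'))).mpr (by
        rw [map_sub, ← hbv, map_sum]
        simpa [ha'] using hb)
      rw [← sub_add_cancel z (∑ i, a' i * w i)]
      exact Submodule.add_mem_sup h1 (Ideal.mem_span_range_iff_exists_fun.mpr ⟨a', rfl⟩)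
  constructor
  · rintro ⟨w, hw, H⟩
    exact ⟨_, fun i => map_mem_maximalIdeal hφ (hw i), (key w hw).mp H⟩
  · rintro ⟨w, hw, H⟩
    choose w' hw' using fun i => hφ (w i)
    obtain rfl : (fun i => φ (w' i)) = w := funext hw'
    have hwm := fun i => (map_mem_maximalIdeal_iff hφ).mp (hw i)
    exact ⟨w', hwm, (key w' hwm).mpr H⟩

end Presentation

end Burch

/-! ### The intrinsic Burch ideal and completion -/

namespace Burch

open IsLocalRing

theorem mem_smul_top_pi_iff {R ι : Type*} [CommRing R] [Fintype ι] [DecidableEq ι] (J : Ideal R)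
    (v : ι → R) : v ∈ J • (⊤ : Submodule R (ι → R)) ↔ ∀ i, v i ∈ J := by
  constructor
  · intro h i
    induction h using Submodule.smul_induction_on' with
    | smul r hr n _ => exact Ideal.mul_mem_right _ _ hr
    | add x _ y _ hx hy => exact add_mem hx hy
  · intro h
    rw [pi_eq_sum_univ' v]
    exact Submodule.sum_mem _ fun i _ => Submodule.smul_mem_smul (h i) trivial

section Completion

variable {R ι : Type*} [CommRing R] [IsLocalRing R] [IsNoetherianRing R] [Fintype ι]
  [DecidableEq ι]

theorem mem_maximalIdeal_pow_of_algebraMap_mem {n : ℕ} {r : R}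
    (h : algebraMap R (AdicCompletion (maximalIdeal R) R) r ∈
      maximalIdeal (AdicCompletion (maximalIdeal R) R) ^ n) : r ∈ maximalIdeal R ^ n := by
  rw [AdicCompletion.maximalIdeal_eq_map, ← Ideal.map_pow] at h
  have hle : (maximalIdeal R ^ n).map (algebraMap R (AdicCompletion (maximalIdeal R) R)) ≤
      RingHom.ker (AdicCompletion.evalₐ (maximalIdeal R) n) := by
    rw [Ideal.map_le_iff_le_comap]
    intro x hx
    rw [Ideal.mem_comap, RingHom.mem_ker, AlgHom.commutes]
    exact Ideal.Quotient.eq_zero_iff_mem.mpr hx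
  have := hle h
  rw [RingHom.mem_ker, AlgHom.commutes] at this
  exact Ideal.Quotient.eq_zero_iff_mem.mp this

theorem exists_sub_algebraMap_mem_pow (a : AdicCompletion (maximalIdeal R) R) (n : ℕ) :
    ∃ r : R, a - algebraMap R _ r ∈ maximalIdeal (AdicCompletion (maximalIdeal R) R) ^ n := by
  obtain ⟨r, hr⟩ := Ideal.Quotient.mk_surjective (AdicCompletion.eval (maximalIdeal R) R n a)
  refine ⟨r, ?_⟩
  have hk : a - algebraMap R _ r ∈ (AdicCompletion.eval (maximalIdeal R) R n).ker := by
    rw [LinearMap.mem_ker, map_sub, ← hr, sub_eq_zero]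
    rfl
  rw [← AdicCompletion.pow_smul_top_eq_ker_eval (IsNoetherian.noetherian _),
    Ideal.smul_top_eq_map] at hk
  rwa [AdicCompletion.maximalIdeal_eq_map, ← Ideal.map_pow]

/-- Approximating its coefficients modulo powers of the maximal ideal shows that a Koszul relation
over the completion is a limit of Koszul relations over `R`. These form a closed submodule by
Krull's intersection theorem. -/
theorem mem_koszul_of_algebraMap_mem {y v : ι → R}
    (h : (fun i => algebraMap R (AdicCompletion (maximalIdeal R) R) (v i)) ∈
      koszul (fun i => algebraMap R (AdicCompletion (maximalIdeal R) R) (y i))) :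
    v ∈ koszul y := by
  have key : ∀ n : ℕ, ∀ w ∈ koszul (fun i =>
      algebraMap R (AdicCompletion (maximalIdeal R) R) (y i)), ∃ u ∈ koszul y, ∀ i,
      w i - algebraMap R _ (u i) ∈ maximalIdeal (AdicCompletion (maximalIdeal R) R) ^ n := by
    intro n w hw
    induction hw using Submodule.span_induction with
    | mem w hw =>
      obtain ⟨i, j, rfl⟩ := hw
      refine ⟨_, koszul_gen_mem y i j, fun k => ?_⟩
      simp only [Pi.sub_apply, Pi.smul_apply, smul_eq_mul, Pi.single_apply, mul_ite, mul_one,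
        mul_zero, map_sub, apply_ite (algebraMap R (AdicCompletion (maximalIdeal R) R)), map_zero,
        sub_self, zero_mem]
    | zero => exact ⟨0, zero_mem _, by simp⟩
    | add w w' _ _ hw hw' =>
      obtain ⟨u, hu, h1⟩ := hw
      obtain ⟨u', hu', h2⟩ := hw'
      refine ⟨u + u', add_mem hu hu', fun i => ?_⟩
      convert add_mem (h1 i) (h2 i) using 1
      simp only [Pi.add_apply, map_add]; ring
    | smul a w _ hw =>
      obtain ⟨u, hu, h1⟩ := hw
      obtain ⟨r, hr⟩ := exists_sub_algebraMap_mem_pow a n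
      refine ⟨r • u, Submodule.smul_mem _ _ hu, fun i => ?_⟩
      convert add_mem (Ideal.mul_mem_right (w i) _ hr)
        (Ideal.mul_mem_left _ (algebraMap R _ r) (h1 i)) using 1
      simp only [Pi.smul_apply, smul_eq_mul, map_mul]; ring
  have hn : ∀ n : ℕ, v ∈ koszul y ⊔ maximalIdeal R ^ n • (⊤ : Submodule R (ι → R)) := by
    intro n
    obtain ⟨u, hu, h1⟩ := key n _ h
    rw [← add_sub_cancel u v]
    refine Submodule.add_mem_sup hu ?_
    refine (mem_smul_top_pi_iff _ _).mpr fun i => mem_maximalIdeal_pow_of_algebraMap_mem ?_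
    simpa using h1 i
  have hq : (koszul y).mkQ v = 0 := by
    have h0 := Ideal.iInf_pow_smul_eq_bot_of_isLocalRing (M := (ι → R) ⧸ koszul y)
      (maximalIdeal R) Ideal.IsPrime.ne_top'
    rw [← Submodule.mem_bot R, ← h0, Submodule.mem_iInf]
    intro n
    obtain ⟨u, hu, w, hw, rfl⟩ := Submodule.mem_sup.mp (hn n)
    rw [map_add, Submodule.mkQ_apply, (Submodule.Quotient.mk_eq_zero _).mpr hu, zero_add]
    have := Submodule.mem_map_of_mem (f := (koszul y).mkQ) hw
    rw [Submodule.map_smul''] at this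
    exact Submodule.smul_mono le_rfl le_top this
  exact (Submodule.Quotient.mk_eq_zero _).mp hq

/-- The socle of the completion is generated by the socle. -/
theorem exists_socle_combination {s : AdicCompletion (maximalIdeal R) R}
    (hs : ∀ x ∈ maximalIdeal (AdicCompletion (maximalIdeal R) R), s * x = 0) :
    ∃ (k : ℕ) (a : Fin k → AdicCompletion (maximalIdeal R) R) (t : Fin k → R),
      (∀ j, ∀ x ∈ maximalIdeal R, t j * x = 0) ∧ s = ∑ j, a j * algebraMap R _ (t j) := by
  obtain ⟨n, z, hz⟩ := Submodule.fg_iff_exists_fin_generating_family.mp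
    (IsNoetherian.noetherian (maximalIdeal R))
  -- The equations `s zᵢ = 0` are a linear system over `R`; by flatness `s` is a combination of
  -- solutions in `R`, which are socle elements.
  obtain ⟨k, a, y, hxy, haf⟩ := Module.Flat.exists_factorization_of_comp_eq_zero_of_free
    (f := Fintype.linearCombination R z)
    (x := LinearMap.toSpanSingleton R (AdicCompletion (maximalIdeal R) R) s) (by
      refine LinearMap.pi_ext' fun i => LinearMap.ext_ring ?_
      simp only [LinearMap.comp_apply, LinearMap.single_apply, LinearMap.zero_apply,
        Fintype.linearCombination_apply_single, one_smul, LinearMap.toSpanSingleton_apply]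
      rw [Algebra.smul_def, mul_comm]
      refine hs _ ?_
      rw [AdicCompletion.maximalIdeal_eq_map]
      exact Ideal.mem_map_of_mem _ (hz ▸ Submodule.subset_span ⟨i, rfl⟩))
  refine ⟨k, fun j => y (Finsupp.single j 1), fun j => a 1 j, fun j x hx => ?_, ?_⟩
  · have hx' : x ∈ LinearMap.range (Fintype.linearCombination R z) := by
      rw [Fintype.range_linearCombination, hz]; exact hx
    obtain ⟨c, rfl⟩ := hx'
    have h1 := LinearMap.congr_fun haf c
    rw [LinearMap.comp_apply, ← mul_one (Fintype.linearCombination R z c), ← smul_eq_mul, map_smul,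
      LinearMap.zero_apply] at h1
    have := DFunLike.congr_fun h1 j
    simpa [mul_comm] using this
  · have h1 := LinearMap.congr_fun hxy 1
    rw [LinearMap.toSpanSingleton_apply, one_smul, LinearMap.comp_apply] at h1
    rw [h1, ← Finsupp.sum_single (a 1), Finsupp.sum_fintype _ _ (by simp), map_sum]
    refine Finset.sum_congr rfl fun j _ => ?_
    rw [← mul_one ((a 1) j), ← smul_eq_mul, ← Finsupp.smul_single, map_smul, Algebra.smul_def,
      mul_comm]
    simp

theorem algebraMap_mul_eq_zero {s : R} (hs : ∀ x ∈ maximalIdeal R, s * x = 0)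
    {x : AdicCompletion (maximalIdeal R) R}
    (hx : x ∈ maximalIdeal (AdicCompletion (maximalIdeal R) R)) :
    algebraMap R (AdicCompletion (maximalIdeal R) R) s * x = 0 := by
  rw [AdicCompletion.maximalIdeal_eq_map] at hx
  induction hx using Submodule.span_induction with
  | mem x hx =>
    obtain ⟨r, hr, rfl⟩ := hx
    rw [← map_mul, hs r hr, map_zero]
  | zero => simp
  | add a b _ _ ha hb => rw [mul_add, ha, hb, add_zero]
  | smul a b _ hb => rw [smul_eq_mul, mul_left_comm, hb, mul_zero]

/-- Descent: coefficients matter only modulo the maximal ideal, because socle elements kill the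
error and the resulting change of `z` lies in the square of the maximal ideal, which the ideal
contains. Ascent: the socle of `R` generates that of the completion. -/
theorem algebraMap_mem_innerBurchIdeal_iff {y : ι → R}
    (hy : Ideal.span (Set.range y) = maximalIdeal R) {z : R} (hz : z ∈ maximalIdeal R) :
    algebraMap R (AdicCompletion (maximalIdeal R) R) z ∈
      innerBurchIdeal (fun i => algebraMap R (AdicCompletion (maximalIdeal R) R) (y i)) ↔
      z ∈ innerBurchIdeal y := by
  have hy' : ∀ i, algebraMap R (AdicCompletion (maximalIdeal R) R) (y i) ∈
      maximalIdeal (AdicCompletion (maximalIdeal R) R) := fun i => by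
    rw [AdicCompletion.maximalIdeal_eq_map, ← hy]
    exact Ideal.mem_map_of_mem _ (Ideal.subset_span ⟨i, rfl⟩)
  constructor
  · intro h
    obtain ⟨c, hc, hcz⟩ := mem_innerBurchIdeal.mp h
    choose d hd using fun i => exists_sub_algebraMap_mem_pow (c i) 1
    have h1 : ∑ i, d i * y i ∈ innerBurchIdeal y := by
      refine mem_innerBurchIdeal.mpr ⟨d, fun s hs => mem_koszul_of_algebraMap_mem ?_, rfl⟩
      convert hc _ fun x hx => algebraMap_mul_eq_zero hs hx using 1
      funext i
      have := algebraMap_mul_eq_zero hs (x := c i - algebraMap R _ (d i)) (by simpa using hd i)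
      rw [mul_sub, sub_eq_zero] at this
      simp [this]
    have h2 : z - ∑ i, d i * y i ∈ maximalIdeal R ^ 2 := by
      refine mem_maximalIdeal_pow_of_algebraMap_mem ?_
      have : algebraMap R (AdicCompletion (maximalIdeal R) R) (z - ∑ i, d i * y i) =
          ∑ i, (c i - algebraMap R _ (d i)) * algebraMap R _ (y i) := by
        simp [← hcz, sub_mul]
      rw [this, pow_two]
      exact Ideal.sum_mem _ fun i _ => Ideal.mul_mem_mul (by simpa using hd i) (hy' i)
    rw [← sub_add_cancel z (∑ i, d i * y i)]
    exact add_mem (maximalIdeal_sq_le_innerBurchIdeal hy (by rwa [← pow_two])) h1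
  · intro h
    obtain ⟨c, hc, rfl⟩ := mem_innerBurchIdeal.mp h
    refine mem_innerBurchIdeal.mpr ⟨fun i => algebraMap R _ (c i), fun s hs => ?_, by simp⟩
    obtain ⟨k, a, t, ht, rfl⟩ := exists_socle_combination hs
    rw [Finset.sum_smul]
    refine Submodule.sum_mem _ fun j _ => ?_
    rw [mul_smul]
    refine Submodule.smul_mem _ _ ?_
    convert map_mem_koszul (algebraMap R (AdicCompletion (maximalIdeal R) R)) (hc _ (ht j)) using 1
    funext i
    simp

/-- Both ideals contain the square of the maximal ideal, modulo which every element of the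
completion comes from `R`. -/
theorem isSpannedMod_completion_iff {y : ι → R}
    (hy : Ideal.span (Set.range y) = maximalIdeal R) (l : ℕ) :
    IsSpannedMod (maximalIdeal (AdicCompletion (maximalIdeal R) R))
      (innerBurchIdeal fun i => algebraMap R (AdicCompletion (maximalIdeal R) R) (y i)) l ↔
    IsSpannedMod (maximalIdeal R) (innerBurchIdeal y) l := by
  have hspan : Ideal.span (Set.range fun i =>
      algebraMap R (AdicCompletion (maximalIdeal R) R) (y i)) =
      maximalIdeal (AdicCompletion (maximalIdeal R) R) := by
    rw [AdicCompletion.maximalIdeal_eq_map, ← hy, Ideal.map_span, ← Set.range_comp]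
    rfl
  have hsq := maximalIdeal_sq_le_innerBurchIdeal hspan
  have hmap : ∀ z : R, algebraMap R (AdicCompletion (maximalIdeal R) R) z ∈
      maximalIdeal (AdicCompletion (maximalIdeal R) R) ↔ z ∈ maximalIdeal R := fun z => by
    rw [← Ideal.mem_comap, maximalIdeal_comap]
  have happrox : ∀ z ∈ maximalIdeal (AdicCompletion (maximalIdeal R) R), ∃ r ∈ maximalIdeal R,
      z - algebraMap R _ r ∈ maximalIdeal (AdicCompletion (maximalIdeal R) R) *
        maximalIdeal (AdicCompletion (maximalIdeal R) R) := fun z hz => by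
    obtain ⟨r, hr⟩ := exists_sub_algebraMap_mem_pow z 2
    refine ⟨r, (hmap r).mp ?_, by rwa [← pow_two]⟩
    have := sub_mem hz (Ideal.pow_le_self two_ne_zero hr)
    simpa using this
  constructor
  · rintro ⟨w, hw, H⟩
    choose w' hw' hww' using fun i => happrox (w i) (hw i)
    refine ⟨w', hw', fun z hz => ?_⟩
    obtain ⟨b, hb, v, hv, hbv⟩ := Submodule.mem_sup.mp (H ((hmap z).mpr hz))
    obtain ⟨a, rfl⟩ := Ideal.mem_span_range_iff_exists_fun.mp hv
    choose r hr using fun i => exists_sub_algebraMap_mem_pow (a i) 1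
    rw [← sub_add_cancel z (∑ i, r i * w' i)]
    refine Submodule.add_mem_sup ((algebraMap_mem_innerBurchIdeal_iff hy (sub_mem hz
      (Ideal.sum_mem _ fun i _ => Ideal.mul_mem_left _ _ (hw' i)))).mp ?_)
      (Ideal.mem_span_range_iff_exists_fun.mpr ⟨r, rfl⟩)
    have : algebraMap R (AdicCompletion (maximalIdeal R) R) (z - ∑ i, r i * w' i) =
        b + ∑ i, ((a i - algebraMap R _ (r i)) * w i +
          algebraMap R _ (r i) * (w i - algebraMap R _ (w' i))) := by
      rw [map_sub, ← hbv, map_sum, add_sub_assoc, ← Finset.sum_sub_distrib]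
      congr 1
      refine Finset.sum_congr rfl fun i _ => ?_
      rw [map_mul]; ring
    rw [this]
    refine add_mem hb (hsq (Ideal.sum_mem _ fun i _ => add_mem ?_ ?_))
    · exact Ideal.mul_mem_mul (by simpa using hr i) (hw i)
    · exact Ideal.mul_mem_left _ _ (hww' i)
  · rintro ⟨w, hw, H⟩
    refine ⟨fun i => algebraMap R _ (w i), fun i => (hmap _).mpr (hw i), fun z hz => ?_⟩
    obtain ⟨r, hr, hzr⟩ := happrox z hz
    obtain ⟨b, hb, v, hv, rfl⟩ := Submodule.mem_sup.mp (H hr)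
    obtain ⟨a, rfl⟩ := Ideal.mem_span_range_iff_exists_fun.mp hv
    have hbm : b ∈ maximalIdeal R := by
      simpa using sub_mem hr (Ideal.sum_mem (t := Finset.univ) (f := fun i => a i * w i) _
        fun i _ => Ideal.mul_mem_left _ _ (hw i))
    rw [← sub_add_cancel z (algebraMap R _ (b + ∑ i, a i * w i)), map_add, ← add_assoc]
    refine Submodule.add_mem_sup (add_mem (hsq ?_)
      ((algebraMap_mem_innerBurchIdeal_iff hy hbm).mpr hb)) ?_
    · rwa [map_add] at hzr
    · exact Ideal.mem_span_range_iff_exists_fun.mpr ⟨fun i => algebraMap R _ (a i), by simp⟩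

end Completion

end Burch

/-! ### The Burch index in depth zero -/

namespace Burch

open IsLocalRing

section DepthZero

variable {R : Type u} [CommRing R] [IsLocalRing R] [IsNoetherianRing R]

theorem algebraMap_completion_injective :
    Function.Injective (algebraMap R (AdicCompletion (maximalIdeal R) R)) := by
  rw [injective_iff_map_eq_zero]
  intro r hr
  have h0 := Ideal.iInf_pow_eq_bot_of_isLocalRing (maximalIdeal R) Ideal.IsPrime.ne_top'
  rw [← Ideal.mem_bot, ← h0, Submodule.mem_iInf]
  exact fun n => mem_maximalIdeal_pow_of_algebraMap_mem (hr ▸ zero_mem _)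

theorem maximalIdeal_completion_ne_bot (hR : maximalIdeal R ≠ ⊥) :
    maximalIdeal (AdicCompletion (maximalIdeal R) R) ≠ ⊥ := by
  intro h
  rw [AdicCompletion.maximalIdeal_eq_map,
    Ideal.map_eq_bot_iff_of_injective algebraMap_completion_injective] at h
  exact hR h

theorem span_algebraMap_eq_maximalIdeal {ι : Type*} {y : ι → R}
    (hy : Ideal.span (Set.range y) = maximalIdeal R) :
    Ideal.span (Set.range fun i => algebraMap R (AdicCompletion (maximalIdeal R) R) (y i)) =
      maximalIdeal (AdicCompletion (maximalIdeal R) R) := by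
  rw [AdicCompletion.maximalIdeal_eq_map, ← hy, Ideal.map_span, ← Set.range_comp]
  rfl

theorem span_map_eq_maximalIdeal {S R ι : Type*} [CommRing S] [IsLocalRing S] [CommRing R]
    [IsLocalRing R] {φ : S →+* R} (hφ : Function.Surjective φ) {y : ι → S}
    (hy : Ideal.span (Set.range y) = maximalIdeal S) :
    Ideal.span (Set.range fun i => φ (y i)) = maximalIdeal R := by
  rw [← map_maximalIdeal_of_surjective φ hφ, ← hy, Ideal.map_span, ← Set.range_comp]
  rfl

theorem maximalIdeal_mul_self_le_burchIdeal {S : Type*} [CommRing S] [IsLocalRing S]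
    (I : Ideal S) : maximalIdeal S * maximalIdeal S ≤ burchIdeal I := by
  refine Ideal.mul_le.mpr fun x hx y hy => mem_burchIdeal.mpr fun s hs => ?_
  rw [show x * y * s = s * y * x by ring]
  exact Ideal.mul_mem_mul (hs y hy) hx

/-- In a regular presentation, the Burch ideal of the defining ideal and the Burch ideal of the
presented ring have the same numbers of complementary generators. -/
theorem isSpannedMod_burchIdeal_ker_iff {T : Type u} [CommRing T] [IsRegularLocalRing T]
    {R : Type*} [CommRing R] [IsLocalRing R] {φ : T →+* R} (hφ : Function.Surjective φ)
    (hR : maximalIdeal R ≠ ⊥) {ι : Type*} [Fintype ι] [DecidableEq ι] {y : ι → R}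
    (hy : Ideal.span (Set.range y) = maximalIdeal R) (l : ℕ) :
    IsSpannedMod (maximalIdeal T) (burchIdeal (RingHom.ker φ)) l ↔
      IsSpannedMod (maximalIdeal R) (innerBurchIdeal y) l := by
  obtain ⟨t, ht⟩ := exists_fin_spanFinrank_generators T
  rw [← innerBurchIdeal_eq ((span_map_eq_maximalIdeal hφ ht).trans hy.symm)]
  exact isSpannedMod_iff_of_surjective hφ (fun z hz => mem_burchIdeal_ker_iff hφ hR ht
    (mem_koszul_of_sum_mul_eq_zero _ T t ht rfl) hz) l

/-- All presentations of the completion compute the same intrinsic quantity, so one spanning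
statement over `R` bounds every member of the supremum. -/
theorem burchIndexDepthZero_le (hR : maximalIdeal R ≠ ⊥) {ι : Type*} [Fintype ι] [DecidableEq ι]
    {y : ι → R} (hy : Ideal.span (Set.range y) = maximalIdeal R) {l : ℕ}
    (h : IsSpannedMod (maximalIdeal R) (innerBurchIdeal y) l) : burchIndexDepthZero R ≤ l := by
  refine sSup_le ?_
  rintro _ ⟨T, _, _, φ, hφ, rfl⟩
  rw [relBurchIndex]
  split_ifs with hc
  · exact zero_le
  · rw [length_quotient_submoduleOf_le_iff (maximalIdeal_mul_self_le_burchIdeal _),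
      isSpannedMod_burchIdeal_ker_iff hφ.surjective (maximalIdeal_completion_ne_bot hR)
        (span_algebraMap_eq_maximalIdeal hy), isSpannedMod_completion_iff hy]
    exact h

/-- Lifts of generators generate the maximal ideal up to the kernel, hence up to its square;
Nakayama does the rest. -/
theorem spanFinrank_eq_of_ker_le_sq {S R : Type*} [CommRing S] [IsLocalRing S]
    [IsNoetherianRing S] [CommRing R] [IsLocalRing R] [IsNoetherianRing R] {φ : S →+* R}
    (hφ : Function.Surjective φ) (hk : RingHom.ker φ ≤ maximalIdeal S ^ 2) :
    (maximalIdeal S).spanFinrank = (maximalIdeal R).spanFinrank := by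
  apply le_antisymm
  · obtain ⟨y, hy⟩ := exists_fin_spanFinrank_generators R
    choose z hz using fun i => hφ (y i)
    have hzm : ∀ i, z i ∈ maximalIdeal S := fun i => by
      rw [← map_mem_maximalIdeal_iff hφ, hz, ← hy]
      exact Ideal.subset_span ⟨i, rfl⟩
    refine spanFinrank_le_of_span_eq (z := z) (le_antisymm (Ideal.span_le.mpr ?_) ?_)
    · rintro _ ⟨i, rfl⟩; exact hzm i
    · refine le_of_le_sup_maximalIdeal_smul (IsNoetherian.noetherian _) fun x hx => ?_
      obtain ⟨c, hc⟩ := Ideal.mem_span_range_iff_exists_fun.mp (hy ▸ map_mem_maximalIdeal hφ hx)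
      choose c' hc' using fun i => hφ (c i)
      rw [smul_eq_mul, ← pow_two, ← add_sub_cancel (∑ i, c' i * z i) x]
      refine Submodule.add_mem_sup (Ideal.mem_span_range_iff_exists_fun.mpr ⟨c', rfl⟩) (hk ?_)
      simp [RingHom.mem_ker, hc', hz, hc]
  · obtain ⟨y, hy⟩ := exists_fin_spanFinrank_generators S
    exact spanFinrank_le_of_span_eq (span_map_eq_maximalIdeal hφ hy)

/-- The completion of `φ` is a Cohen presentation of the completion of `R`, minimal because `ker φ ⊆
𝔫²`. Thus a regular presentation that need not be complete detects a large index. -/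
theorem lt_burchIndexDepthZero {T : Type u} [CommRing T] [IsRegularLocalRing T] {φ : T →+* R}
    (hφ : Function.Surjective φ) (hR : maximalIdeal R ≠ ⊥)
    (hk : RingHom.ker φ ≤ maximalIdeal T ^ 2) (hk0 : RingHom.ker φ ≠ ⊥)
    (hs : ∃ s ∉ RingHom.ker φ, ∀ y ∈ maximalIdeal T, s * y ∈ RingHom.ker φ) {l : ℕ}
    (h : ¬ IsSpannedMod (maximalIdeal T) (burchIdeal (RingHom.ker φ)) l) :
    (l : ℕ∞) < burchIndexDepthZero R := by
  have hreg := isRegularLocalRing_adicCompletion T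
  have hnoeth := isNoetherianRing_adicCompletion (maximalIdeal R)
  let ψ := completionMap φ (maximalIdeal T) (maximalIdeal R)
    (map_maximalIdeal_of_surjective φ hφ).le
  have hψ : Function.Surjective ψ := completionMap_surjective_of_map_eq φ _
    (IsNoetherian.noetherian _) _ (map_maximalIdeal_of_surjective φ hφ) hφ
  have hψa : ∀ t, ψ (algebraMap T _ t) = algebraMap R _ (φ t) := completionMap_algebraMap φ _ _ _
  have hcohen : IsMinimalCohenPresentation ψ :=
    { complete := inferInstance
      isLocalHom := hψ.isLocalHom
      surjective := hψ
      minimal := by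
        rw [← spanFinrank_maximalIdeal_eq_finrank_cotangentSpace,
          ← spanFinrank_maximalIdeal_eq_finrank_cotangentSpace,
          AdicCompletion.spanFinrank_maximalIdeal_eq, AdicCompletion.spanFinrank_maximalIdeal_eq,
          spanFinrank_eq_of_ker_le_sq hφ hk] }
  refine lt_of_lt_of_le ?_ (le_sSup ⟨_, _, _, ψ, hcohen, rfl⟩)
  obtain ⟨y, hy⟩ := exists_fin_spanFinrank_generators R
  -- The default value 0 of `relBurchIndex` is excluded: after completion the kernel stays nonzero
  -- and `s` stays a nonzero socle element.
  have hc : ¬ (RingHom.ker ψ = ⊥ ∨ ¬ HasDepthZero (AdicCompletion (maximalIdeal T) T)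
      (AdicCompletion (maximalIdeal T) T ⧸ RingHom.ker ψ)) := by
    rw [not_or, not_not]
    constructor
    · intro h0
      refine hk0 (le_bot_iff.mp fun t ht => ?_)
      have : algebraMap T (AdicCompletion (maximalIdeal T) T) t ∈ RingHom.ker ψ := by
        rw [RingHom.mem_ker, hψa, RingHom.mem_ker.mp ht, map_zero]
      rw [h0, Ideal.mem_bot] at this
      exact algebraMap_completion_injective (this.trans (map_zero _).symm)
    · obtain ⟨s, hs, hsy⟩ := hs
      intro x hx hreg
      have hs' : algebraMap T (AdicCompletion (maximalIdeal T) T) s ∉ RingHom.ker ψ := by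
        intro h
        rw [RingHom.mem_ker, hψa] at h
        exact hs (algebraMap_completion_injective (h.trans (map_zero _).symm))
      refine hs' (Ideal.Quotient.eq_zero_iff_mem.mp (hreg (a₂ := 0) ?_))
      dsimp only
      rw [smul_zero]
      change Ideal.Quotient.mk _ (x * _) = 0
      rw [Ideal.Quotient.eq_zero_iff_mem, RingHom.mem_ker, map_mul, hψa, mul_comm]
      refine algebraMap_mul_eq_zero (fun r hr => ?_) (map_mem_maximalIdeal hψ hx)
      obtain ⟨t, rfl⟩ := hφ r
      rw [← map_mul]
      exact hsy t ((map_mem_maximalIdeal_iff hφ).mp hr)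
  rw [relBurchIndex, if_neg hc, ← not_le,
    length_quotient_submoduleOf_le_iff (maximalIdeal_mul_self_le_burchIdeal _),
    isSpannedMod_burchIdeal_ker_iff hψ (maximalIdeal_completion_ne_bot hR)
      (span_algebraMap_eq_maximalIdeal hy), isSpannedMod_completion_iff hy,
    ← isSpannedMod_burchIdeal_ker_iff hφ hR hy]
  exact h

end DepthZero

end Burch

/-! ### Hilbert–Burch resolutions and mapping cones -/

namespace Burch

open IsLocalRing
open scoped Matrix

/-- The ideal `(f)` has the minimal free resolution `0 → Sʳ --A--> Sᵐ --f--> (f) → 0` with `r > 0`,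
and is contained in `𝔫²`. -/
structure IsHilbertBurch {S : Type*} [CommRing S] [IsLocalRing S] {m r : ℕ} (f : Fin m → S)
    (A : Matrix (Fin m) (Fin r) S) : Prop where
  pos : 0 < r
  entry_mem : ∀ i j, A i j ∈ maximalIdeal S
  generator_mem : ∀ i, f i ∈ maximalIdeal S ^ 2
  comp_eq_zero : ∀ c, f ⬝ᵥ (A *ᵥ c) = 0
  exact : ∀ u, f ⬝ᵥ u = 0 → ∃ c, u = A *ᵥ c
  injective : ∀ c, A *ᵥ c = 0 → c = 0

/-- The members of a list are successively nonzerodivisors modulo `I` and their predecessors. -/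
def IsRegularMod {S : Type*} [CommRing S] : Ideal S → List S → Prop
  | _, [] => True
  | I, x :: xs => (∀ a, x * a ∈ I → a ∈ I) ∧ IsRegularMod (I ⊔ Ideal.span {x}) xs

/-- The beginning of a free resolution of `S/L`, where `L = (f) + X`, obtained from the
Hilbert–Burch resolution by iterated mapping cones. -/
structure HilbertBurchCone {S : Type u} [CommRing S] {m r : ℕ} (f : Fin m → S)
    (A : Matrix (Fin m) (Fin r) S) (X L : Ideal S) (t : ℕ) (G₂ G₃ : Type u) [AddCommGroup G₂]
    [Module S G₂] [AddCommGroup G₃] [Module S G₃] where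
  /-- the generators -/
  d₁ : (Fin m → S) × (Fin t → S) →ₗ[S] S
  /-- the relations -/
  d₂ : G₂ →ₗ[S] (Fin m → S) × (Fin t → S)
  /-- the second syzygies -/
  d₃ : G₃ →ₗ[S] G₂
  /-- the component belonging to the Hilbert–Burch matrix -/
  p : G₂ →ₗ[S] (Fin r → S)
  range_d₁ : LinearMap.range d₁ = L
  d₁_fst : ∀ u, d₁ (u, 0) = f ⬝ᵥ u
  exists_d₁_snd : ∀ x ∈ X, ∃ v, d₁ (0, v) = x
  exact₁ : Function.Exact d₂ d₁
  exact₂ : Function.Exact d₃ d₂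
  -- The Hilbert–Burch matrix is injective, so second syzygies meet its component only in multiples
  -- of the adjoined elements.
  p_d₃ : ∀ b i, p (d₃ b) i ∈ X
  d₂_fst : ∀ c i, (d₂ c).1 i - (A *ᵥ p c) i ∈ X
  d₂_snd : ∀ c i, (d₂ c).2 i ∈ L

namespace HilbertBurchCone

variable {S : Type u} [CommRing S] {m r : ℕ} {f : Fin m → S} {A : Matrix (Fin m) (Fin r) S}
  {X L : Ideal S} {t : ℕ} {G₂ G₃ : Type u} [AddCommGroup G₂] [Module S G₂] [AddCommGroup G₃]
  [Module S G₃]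

theorem d₁_mem (F : HilbertBurchCone f A X L t G₂ G₃) (a : (Fin m → S) × (Fin t → S)) :
    F.d₁ a ∈ L :=
  F.range_d₁.le (LinearMap.mem_range_self _ a)

theorem exists_d₁_eq (F : HilbertBurchCone f A X L t G₂ G₃) {x : S} (hx : x ∈ L) :
    ∃ a, F.d₁ a = x :=
  F.range_d₁.ge hx

/-- The first differential of the mapping cone. -/
def coneD₁ (F : HilbertBurchCone f A X L t G₂ G₃) (x : S) :
    (Fin m → S) × (Fin (t + 1) → S) →ₗ[S] S where
  toFun a := F.d₁ (a.1, Fin.tail a.2) + x * a.2 0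
  map_add' a b := by
    have : (a.1 + b.1, Fin.tail (a.2 + b.2)) = (a.1, Fin.tail a.2) + (b.1, Fin.tail b.2) := rfl
    simp only [Prod.fst_add, Prod.snd_add, this, map_add, Pi.add_apply]
    ring
  map_smul' k a := by
    have : (k • a.1, Fin.tail (k • a.2)) = k • (a.1, Fin.tail a.2) := rfl
    simp only [Prod.smul_fst, Prod.smul_snd, this, map_smul, Pi.smul_apply, smul_eq_mul,
      RingHom.id_apply]
    ring

/-- The second differential of the mapping cone. -/
def coneD₂ (F : HilbertBurchCone f A X L t G₂ G₃) (x : S) :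
    G₂ × ((Fin m → S) × (Fin t → S)) →ₗ[S] (Fin m → S) × (Fin (t + 1) → S) where
  toFun c := ((F.d₂ c.1 + x • c.2).1, Fin.cons (-F.d₁ c.2) (F.d₂ c.1 + x • c.2).2)
  map_add' a b := by
    refine Prod.ext ?_ (funext fun i => ?_)
    · simp only [Prod.fst_add, Prod.snd_add, map_add, smul_add]
      abel
    · cases i using Fin.cases with
      | zero => simp only [Prod.snd_add, Pi.add_apply, Fin.cons_zero, map_add]; ring
      | succ i =>
        simp only [Prod.snd_add, Prod.fst_add, Pi.add_apply, Fin.cons_succ, map_add, smul_add]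
        ring
  map_smul' k a := by
    refine Prod.ext ?_ (funext fun i => ?_)
    · simp only [Prod.smul_fst, Prod.smul_snd, map_smul, RingHom.id_apply, Prod.fst_add, smul_add,
        smul_comm x k]
    · cases i using Fin.cases with
      | zero => simp
      | succ i =>
        simp only [Prod.smul_fst, Prod.smul_snd, map_smul, RingHom.id_apply, Prod.snd_add,
          Pi.add_apply, Pi.smul_apply, Fin.cons_succ, smul_eq_mul]
        ring

/-- The third differential of the mapping cone. -/
def coneD₃ (F : HilbertBurchCone f A X L t G₂ G₃) (x : S) :
    G₃ × G₂ →ₗ[S] G₂ × ((Fin m → S) × (Fin t → S)) :=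
  (F.d₃.coprod (x • LinearMap.id)).prod (-(F.d₂ ∘ₗ LinearMap.snd S G₃ G₂))

/-- The mapping cone of multiplication by an element that is regular modulo `L`. -/
def cone (F : HilbertBurchCone f A X L t G₂ G₃) (x : S) (hx : ∀ a, x * a ∈ L → a ∈ L) :
    HilbertBurchCone f A (X ⊔ Ideal.span {x}) (L ⊔ Ideal.span {x}) (t + 1)
      (G₂ × ((Fin m → S) × (Fin t → S))) (G₃ × G₂) where
  d₁ := F.coneD₁ x
  d₂ := F.coneD₂ x
  d₃ := F.coneD₃ x
  p := F.p ∘ₗ LinearMap.fst S _ _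
  range_d₁ := by
    ext y
    rw [LinearMap.mem_range, Submodule.mem_sup]
    constructor
    · rintro ⟨a, rfl⟩
      exact ⟨_, F.d₁_mem (a.1, Fin.tail a.2), _,
        Ideal.mem_span_singleton.mpr (dvd_mul_right x (a.2 0)), rfl⟩
    · rintro ⟨y, hy, z, hz, rfl⟩
      obtain ⟨a, rfl⟩ := F.exists_d₁_eq hy
      obtain ⟨b, rfl⟩ := Ideal.mem_span_singleton.mp hz
      exact ⟨(a.1, Fin.cons b a.2), by simp [coneD₁]⟩
  d₁_fst u := by
    rw [← F.d₁_fst u]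
    simp [coneD₁, Fin.tail_def]
    rfl
  exists_d₁_snd w hw := by
    obtain ⟨y, hy, z, hz, rfl⟩ := Submodule.mem_sup.mp hw
    obtain ⟨v, rfl⟩ := F.exists_d₁_snd y hy
    obtain ⟨b, rfl⟩ := Ideal.mem_span_singleton.mp hz
    exact ⟨Fin.cons b v, by simp [coneD₁]⟩
  exact₁ := by
    intro a
    constructor
    · intro h
      change F.d₁ (a.1, Fin.tail a.2) + x * a.2 0 = 0 at h
      -- By regularity the coefficient of `x` lies in `L`; writing it as `d₁ u`, the remaining
      -- coefficients plus `x • u` form a relation of the old complex.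
      have h1 : x * a.2 0 ∈ L := by
        rw [eq_neg_of_add_eq_zero_right h]
        exact neg_mem (F.d₁_mem _)
      obtain ⟨u, hu⟩ := F.exists_d₁_eq (hx _ h1)
      obtain ⟨c, hc⟩ := (F.exact₁ ((a.1, Fin.tail a.2) + x • u)).mp (by
        rw [map_add, map_smul, hu]; exact h)
      refine ⟨(c, -u), Prod.ext ?_ (funext fun i => ?_)⟩
      · simp [coneD₂, hc]
      · cases i using Fin.cases with
        | zero => simp [coneD₂, hu]
        | succ i => simp [coneD₂, hc, Fin.tail]
    · rintro ⟨c, rfl⟩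
      change F.d₁ ((F.d₂ c.1 + x • c.2).1, Fin.tail (Fin.cons (α := fun _ => S) (-F.d₁ c.2)
        (F.d₂ c.1 + x • c.2).2)) + x * -F.d₁ c.2 = 0
      rw [Fin.tail_cons, Prod.mk.eta, map_add, map_smul, (F.exact₁ _).mpr ⟨c.1, rfl⟩, smul_eq_mul]
      ring
  exact₂ := by
    intro c
    constructor
    · intro h
      have h1 : F.d₁ c.2 = 0 := by
        have := congrFun (congrArg Prod.snd (show F.coneD₂ x c = 0 from h)) 0
        simpa [coneD₂] using this
      have h2 : F.d₂ c.1 + x • c.2 = 0 := by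
        refine Prod.ext (congrArg Prod.fst (show F.coneD₂ x c = 0 from h) :) (funext fun i => ?_)
        have := congrFun (congrArg Prod.snd (show F.coneD₂ x c = 0 from h)) i.succ
        simpa [coneD₂] using this
      obtain ⟨u, hu⟩ := (F.exact₁ c.2).mp h1
      obtain ⟨b, hb⟩ := (F.exact₂ (c.1 + x • u)).mp (by rw [map_add, map_smul, hu, h2])
      refine ⟨(b, -u), Prod.ext ?_ ?_⟩
      · simp [coneD₃, hb]
      · simp [coneD₃, hu]
    · rintro ⟨b, rfl⟩
      have h1 : F.d₂ (F.d₃ b.1) = 0 := (F.exact₂ _).mpr ⟨b.1, rfl⟩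
      have h2 : F.d₁ (F.d₂ b.2) = 0 := (F.exact₁ _).mpr ⟨b.2, rfl⟩
      refine Prod.ext ?_ (funext fun i => ?_)
      · simp [coneD₂, coneD₃, h1]
      · cases i using Fin.cases with
        | zero => simp [coneD₂, coneD₃, h2]
        | succ i => simp [coneD₂, coneD₃, h1]
  p_d₃ b i := by
    change F.p (F.d₃ b.1 + x • b.2) i ∈ _
    rw [map_add, map_smul]
    exact Submodule.add_mem_sup (F.p_d₃ _ _) (Ideal.mem_span_singleton.mpr (dvd_mul_right _ _))
  d₂_fst c i := by
    change (F.d₂ c.1).1 i + x * c.2.1 i - (A *ᵥ F.p c.1) i ∈ _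
    rw [add_sub_right_comm]
    exact Submodule.add_mem_sup (F.d₂_fst _ _) (Ideal.mem_span_singleton.mpr (dvd_mul_right _ _))
  d₂_snd c i := by
    cases i using Fin.cases with
    | zero =>
      refine Ideal.mem_sup_left ?_
      change -F.d₁ c.2 ∈ L
      exact neg_mem (F.d₁_mem _)
    | succ i =>
      change (F.d₂ c.1).2 i + x * c.2.2 i ∈ _
      exact Submodule.add_mem_sup (F.d₂_snd _ _) (Ideal.mem_span_singleton.mpr (dvd_mul_right _ _))

theorem exists_of_isRegularMod (xs : List S) {X L : Ideal S} {t : ℕ} {G₂ G₃ : Type u}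
    [AddCommGroup G₂] [Module S G₂] [AddCommGroup G₃] [Module S G₃]
    (F : HilbertBurchCone f A X L t G₂ G₃) (h : IsRegularMod L xs) :
    ∃ (t' : ℕ) (H₂ H₃ : Type u) (_ : AddCommGroup H₂) (_ : Module S H₂) (_ : AddCommGroup H₃)
      (_ : Module S H₃),
      Nonempty (HilbertBurchCone f A (X ⊔ Ideal.ofList xs) (L ⊔ Ideal.ofList xs) t' H₂ H₃) := by
  induction xs generalizing X L t G₂ G₃ with
  | nil =>
    rw [Ideal.ofList_nil, sup_bot_eq, sup_bot_eq]
    exact ⟨t, G₂, G₃, _, _, _, _, ⟨F⟩⟩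
  | cons x xs ih =>
    rw [Ideal.ofList_cons, ← sup_assoc, ← sup_assoc]
    exact ih (F.cone x h.1) h.2

end HilbertBurchCone

/-- The Hilbert–Burch resolution itself. -/
def IsHilbertBurch.baseCone {S : Type u} [CommRing S] [IsLocalRing S] {m r : ℕ} {f : Fin m → S}
    {A : Matrix (Fin m) (Fin r) S} (h : IsHilbertBurch f A) :
    HilbertBurchCone f A ⊥ (Ideal.span (Set.range f)) 0 (Fin r → S) PUnit where
  d₁ := Fintype.linearCombination S f ∘ₗ LinearMap.fst S _ _
  d₂ := A.mulVecLin.prod 0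
  d₃ := 0
  p := LinearMap.id
  range_d₁ := by
    rw [LinearMap.range_comp_of_range_eq_top _ (LinearMap.range_eq_top.mpr Prod.fst_surjective),
      Fintype.range_linearCombination, Ideal.span]
  d₁_fst u := by simp [Fintype.linearCombination_apply, dotProduct, mul_comm]
  exists_d₁_snd x hx := ⟨0, by simpa using (Ideal.mem_bot.mp hx).symm⟩
  exact₁ := by
    intro a
    have : (Fintype.linearCombination S f ∘ₗ LinearMap.fst S _ (Fin 0 → S)) a = f ⬝ᵥ a.1 := by
      simp [Fintype.linearCombination_apply, dotProduct, mul_comm]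
    rw [this]
    constructor
    · intro ha
      obtain ⟨c, hc⟩ := h.exact _ ha
      exact ⟨c, Prod.ext (by simp [hc]) (Subsingleton.elim _ _)⟩
    · rintro ⟨c, rfl⟩
      simpa using h.comp_eq_zero c
  exact₂ := by
    intro c
    constructor
    · intro hc
      exact ⟨0, by simpa using (h.injective c (congrArg Prod.fst hc)).symm⟩
    · rintro ⟨b, rfl⟩
      simp
  p_d₃ b i := by simp
  d₂_fst c i := by simp
  d₂_snd c i := i.elim0

end Burch

/-! ### Upper bounds for quotients by regular sequences -/

namespace Burch

open IsLocalRing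
open scoped Matrix

namespace IsHilbertBurch

variable {S : Type u} [CommRing S] [IsLocalRing S] {m r : ℕ} {f : Fin m → S}
  {A : Matrix (Fin m) (Fin r) S}

theorem entry_mem_vec (h : IsHilbertBurch f A) (c : Fin r → S) (i : Fin m) :
    (A *ᵥ c) i ∈ maximalIdeal S := by
  change ∑ j, A i j * c j ∈ _
  exact Ideal.sum_mem _ fun j _ => Ideal.mul_mem_right _ _ (h.entry_mem i j)

/-- A Hilbert–Burch ideal is not principal. -/
theorem two_le (h : IsHilbertBurch f A) : 2 ≤ m := by
  have hr := h.pos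
  by_contra! hm
  interval_cases m
  · have h0 := congrFun (h.injective (Pi.single ⟨0, hr⟩ 1) (Subsingleton.elim _ _)) ⟨0, hr⟩
    simp at h0
  -- With one generator, `f 0` kills a column, so injectivity gives `f 0 = 0`; but then 1 would be a
  -- relation, while relations have coefficients in 𝔫.
  · have h1 : f 0 * A 0 ⟨0, hr⟩ = 0 := by
      simpa [dotProduct] using h.comp_eq_zero (Pi.single ⟨0, hr⟩ 1)
    have h2 : f 0 = 0 := by
      have h3 := congrFun (h.injective (Pi.single ⟨0, hr⟩ (f 0)) (by
        funext i
        rw [Subsingleton.elim i 0]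
        simp [mul_comm, h1])) ⟨0, hr⟩
      simpa using h3
    obtain ⟨c, hc⟩ := h.exact (Pi.single 0 1) (by simp [h2])
    have h3 := h.entry_mem_vec c 0
    rw [← hc, Pi.single_eq_same] at h3
    exact (Ideal.ne_top_iff_one _).mp Ideal.IsPrime.ne_top' h3

end IsHilbertBurch

/-- In a Noetherian local ring whose maximal ideal is principal, every nonzero element is a unit
times a power of the generator. -/
theorem exists_eq_mul_pow_of_principal {Q : Type*} [CommRing Q] [IsLocalRing Q]
    [IsNoetherianRing Q] {z : Q} (hzm : z ∈ maximalIdeal Q)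
    (hz : maximalIdeal Q ≤ Ideal.span {z}) {a : Q} (ha : a ≠ 0) :
    ∃ (k : ℕ) (v : Qˣ), a = v * z ^ k := by
  classical
  have hex : ∃ k, ¬ z ^ k ∣ a := by
    by_contra! hall
    have h0 := Ideal.iInf_pow_eq_bot_of_isLocalRing (maximalIdeal Q) Ideal.IsPrime.ne_top'
    refine ha ?_
    rw [← Ideal.mem_bot, ← h0, Submodule.mem_iInf]
    exact fun k => Ideal.mem_of_dvd _ (hall k) (Ideal.pow_mem_pow hzm k)
  obtain ⟨k, hk⟩ : ∃ k, Nat.find hex = k + 1 :=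
    Nat.exists_eq_succ_of_ne_zero fun h0 => by
      have := Nat.find_spec hex
      rw [h0] at this
      simp at this
  have h1 : z ^ k ∣ a := by
    by_contra hn
    have := Nat.find_min' hex hn
    omega
  obtain ⟨v, rfl⟩ := h1
  have hv : IsUnit v := isUnit_of_notMem fun hv => by
    obtain ⟨w, rfl⟩ := Ideal.mem_span_singleton.mp (hz hv)
    refine Nat.find_spec hex ?_
    rw [hk, pow_succ]
    exact mul_dvd_mul_left _ (dvd_mul_right _ _)
  obtain ⟨v, rfl⟩ := hv
  exact ⟨k, v, mul_comm _ _⟩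

theorem dvd_or_dvd_of_principal {Q : Type*} [CommRing Q] [IsLocalRing Q]
    [IsNoetherianRing Q] {z : Q} (hzm : z ∈ maximalIdeal Q)
    (hz : maximalIdeal Q ≤ Ideal.span {z}) (a b : Q) : a ∣ b ∨ b ∣ a := by
  by_cases ha : a = 0
  · exact Or.inr (ha ▸ dvd_zero b)
  by_cases hb : b = 0
  · exact Or.inl (hb ▸ dvd_zero a)
  obtain ⟨k, v, rfl⟩ := exists_eq_mul_pow_of_principal hzm hz ha
  obtain ⟨l, w, rfl⟩ := exists_eq_mul_pow_of_principal hzm hz hb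
  rcases le_total k l with h | h
  · exact Or.inl (by simpa using pow_dvd_pow z h)
  · exact Or.inr (by simpa using pow_dvd_pow z h)

section Upper

variable {S : Type u} [CommRing S] [IsLocalRing S] {m r : ℕ}
  {f : Fin m → S} {A : Matrix (Fin m) (Fin r) S} {X L : Ideal S} {t : ℕ} {G₂ G₃ : Type u}
  [AddCommGroup G₂] [Module S G₂] [AddCommGroup G₃] [Module S G₃]

namespace HilbertBurchCone

/-- If `f ⬝ᵥ u = d₁ (0, v)`, then `(u, -v)` is a relation, and its first component is modulo `X` a
combination of the columns of `A`. So the `f i` remain minimal generators modulo `X`. -/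
theorem coeff_mem_of_dotProduct_mem (h : IsHilbertBurch f A)
    (F : HilbertBurchCone f A X L t G₂ G₃) (hX : X ≤ maximalIdeal S) {u : Fin m → S}
    (hu : f ⬝ᵥ u ∈ X) (i : Fin m) : u i ∈ maximalIdeal S := by
  obtain ⟨v, hv⟩ := F.exists_d₁_snd _ hu
  obtain ⟨c, hc⟩ := (F.exact₁ (u, -v)).mp (by
    rw [show (u, -v) = (u, 0) - ((0 : Fin m → S), v) by simp, map_sub, F.d₁_fst, hv, sub_self])
  have h1 := hX (F.d₂_fst c i)
  rw [hc] at h1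
  simpa using add_mem h1 (h.entry_mem_vec (F.p c) i)

theorem d₁_mem_mul (F : HilbertBurchCone f A X L t G₂ G₃) {a : (Fin m → S) × (Fin t → S)}
    (h1 : ∀ i, a.1 i ∈ maximalIdeal S) (h2 : ∀ i, a.2 i ∈ maximalIdeal S) :
    F.d₁ a ∈ L * maximalIdeal S := by
  have ha : a ∈ maximalIdeal S • (⊤ : Submodule S ((Fin m → S) × (Fin t → S))) := by
    have hmap1 := Submodule.mem_map_of_mem (f := LinearMap.inl S (Fin m → S) (Fin t → S))
      ((mem_smul_top_pi_iff _ _).mpr h1)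
    have hmap2 := Submodule.mem_map_of_mem (f := LinearMap.inr S (Fin m → S) (Fin t → S))
      ((mem_smul_top_pi_iff _ _).mpr h2)
    rw [Submodule.map_smul''] at hmap1 hmap2
    have := add_mem (Submodule.smul_mono le_rfl le_top hmap1)
      (Submodule.smul_mono le_rfl le_top hmap2)
    simpa using this
  have := Submodule.mem_map_of_mem (f := F.d₁) ha
  rwa [Submodule.map_smul'', Submodule.map_top, F.range_d₁, smul_eq_mul, mul_comm] at this

variable [IsNoetherianRing S]

/-- The maximal ideal is not generated by one element modulo a regular sequence. -/
theorem not_le_sup_span_singleton (h : IsHilbertBurch f A)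
    (F : HilbertBurchCone f A X L t G₂ G₃) (hX : X ≤ maximalIdeal S)
    (hL : L = Ideal.span (Set.range f) ⊔ X) {z : S} (hz : z ∈ maximalIdeal S) :
    ¬ maximalIdeal S ≤ maximalIdeal S ^ 2 ⊔ L ⊔ Ideal.span {z} := by
  intro hle
  -- Nakayama removes 𝔫², which contains the `f i` as well.
  have hle' : maximalIdeal S ≤ X ⊔ Ideal.span {z} := by
    refine le_of_le_sup_maximalIdeal_smul (IsNoetherian.noetherian _) (hle.trans ?_)
    rw [smul_eq_mul, ← pow_two, hL]
    refine sup_le (sup_le le_sup_right (sup_le ?_ (le_sup_left.trans le_sup_left)))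
      (le_sup_right.trans le_sup_left)
    refine le_trans (Ideal.span_le.mpr ?_) le_sup_right
    rintro _ ⟨i, rfl⟩
    exact h.generator_mem i
  have := isLocalRing_quotient_of_le hX
  have hsurj := Ideal.Quotient.mk_surjective (I := X)
  have hprin : maximalIdeal (S ⧸ X) ≤ Ideal.span {Ideal.Quotient.mk X z} := by
    intro q hq
    obtain ⟨q, rfl⟩ := hsurj q
    obtain ⟨x, hx, y, hy, rfl⟩ := Submodule.mem_sup.mp
      (hle' ((map_mem_maximalIdeal_iff hsurj).mp hq))
    obtain ⟨c, rfl⟩ := Ideal.mem_span_singleton.mp hy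
    rw [map_add, Ideal.Quotient.eq_zero_iff_mem.mpr hx, zero_add, map_mul]
    exact Ideal.mem_span_singleton.mpr (dvd_mul_right _ _)
  have hm := h.two_le
  -- If the maximal ideal modulo `X` were principal, any two elements would be comparable for
  -- divisibility; between two of the `f i` this is a relation modulo `X` with a coefficient 1.
  have key : ∀ i j : Fin m, i ≠ j →
      ¬ Ideal.Quotient.mk X (f i) ∣ Ideal.Quotient.mk X (f j) := by
    rintro i j hij ⟨c, hc⟩
    obtain ⟨c, rfl⟩ := hsurj c
    have hmem : f ⬝ᵥ (Pi.single j 1 - Pi.single i c) ∈ X := by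
      rw [dotProduct_sub, dotProduct_single, dotProduct_single, mul_one, ← Ideal.Quotient.eq, hc,
        map_mul]
    have := F.coeff_mem_of_dotProduct_mem h hX hmem j
    rw [Pi.sub_apply, Pi.single_eq_same, Pi.single_eq_of_ne hij.symm, sub_zero] at this
    exact (Ideal.ne_top_iff_one _).mp Ideal.IsPrime.ne_top' this
  rcases dvd_or_dvd_of_principal (map_mem_maximalIdeal hsurj hz) hprin
    (Ideal.Quotient.mk X (f ⟨0, by omega⟩)) (Ideal.Quotient.mk X (f ⟨1, by omega⟩)) with h1 | h1
  · exact key _ _ (by simp) h1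
  · exact key _ _ (by simp) h1

/-- The description of the products of socle elements with generators of `𝔫` that is obtained from
the mapping cone resolution. -/
theorem exists_socle_coefficients (h : IsHilbertBurch f A)
    (F : HilbertBurchCone f A X L t G₂ G₃) (hX : X ≤ maximalIdeal S)
    (hL : L = Ideal.span (Set.range f) ⊔ X) :
    ∃ (e : ℕ) (z : Fin e → S), 2 ≤ e ∧ (∀ i, z i ∈ maximalIdeal S) ∧
      maximalIdeal S ≤ maximalIdeal S ^ 2 ⊔ L ⊔ Ideal.span (Set.range z) ∧
      maximalIdeal S ^ 2 ⊔ L ≤ burchIdeal L ∧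
      (∀ α : Fin e → S, ∑ i, α i * z i ∈ maximalIdeal S ^ 2 ⊔ L → ∀ i, α i ∈ maximalIdeal S) ∧
      ∀ s, (∀ y ∈ maximalIdeal S, s * y ∈ L) → ∃ a : Fin e → Fin m → S,
        (∀ α : Fin e → S, (∀ k, ∑ i, α i * a i k ∈ maximalIdeal S) →
          (∑ i, α i * z i) * s ∈ L * maximalIdeal S) ∧
        (∀ i j, i ≠ j → ∀ k, z j * a i k - z i * a j k ∈
          Ideal.span {x | ∃ i j, x = A i j} ⊔ (maximalIdeal S ^ 2 ⊔ L)) ∧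
        (3 ≤ e → ∀ i j, i ≠ j → ∀ k, z j * a i k - z i * a j k ∈ maximalIdeal S ^ 2 ⊔ L) := by
  obtain ⟨e, z, hz, hspan, hind⟩ := exists_minimal_generators_mod
    (maximalIdeal S : Set S) (maximalIdeal S ^ 2 ⊔ L)
  rw [Ideal.span_eq] at hspan
  simp only [SetLike.mem_coe] at hz
  have he : 2 ≤ e := by
    by_contra! he
    interval_cases e
    · exact F.not_le_sup_span_singleton h hX hL (zero_mem _) (hspan.trans (by simp))
    · refine F.not_le_sup_span_singleton h hX hL (hz 0) (hspan.trans ?_)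
      rw [Set.range_unique]
      rfl
  have hsoc : ∀ s, (∀ y ∈ maximalIdeal S, s * y ∈ L) → s ∈ maximalIdeal S := by
    intro s hs
    by_contra hn
    obtain ⟨u, rfl⟩ := isUnit_of_notMem hn
    refine F.not_le_sup_span_singleton h hX hL (zero_mem _) fun y hy => ?_
    refine Ideal.mem_sup_left (Ideal.mem_sup_right ?_)
    simpa using Ideal.mul_mem_left _ (↑u⁻¹ : S) (hs y hy)
  have hNB : maximalIdeal S ^ 2 ⊔ L ≤ burchIdeal L := by
    refine sup_le ?_ fun l hl => mem_burchIdeal.mpr fun s hs => Ideal.mul_mem_mul hl (hsoc s hs)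
    rw [pow_two]
    exact maximalIdeal_mul_self_le_burchIdeal L
  have hXN : X ≤ maximalIdeal S ^ 2 ⊔ L := hL ▸ le_sup_right.trans le_sup_right
  have hpair : ∀ {i j : Fin e}, i ≠ j → ∀ {x y : S},
      z j * x - z i * y ∈ maximalIdeal S ^ 2 ⊔ L → x ∈ maximalIdeal S := by
    intro i j hij x y hxy
    have := hind (Pi.single j x - Pi.single i y) (by
      simp only [Pi.sub_apply, sub_mul, Finset.sum_sub_distrib, Pi.single_apply, ite_mul,
        zero_mul, Finset.sum_ite_eq', Finset.mem_univ, if_true]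
      rwa [mul_comm x, mul_comm y]) j
    simpa [Pi.single_eq_of_ne hij.symm] using this
  refine ⟨e, z, he, hz, hspan, hNB, hind, fun s hs => ?_⟩
  choose a ha using fun i => F.exists_d₁_eq (hs (z i) (hz i))
  -- The two ways of expressing `s zᵢ zⱼ` through the generators of `L` differ by a relation.
  have hc : ∀ i j, ∃ c, F.d₂ c = z j • a i - z i • a j := fun i j => (F.exact₁ _).mp (by
    rw [map_sub, map_smul, map_smul, ha, ha, smul_eq_mul, smul_eq_mul]; ring)
  choose c hc using hc
  -- Coefficients of the adjoined generators in a relation lie in `L`, and the `z i` are independent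
  -- modulo 𝔫² + L. Only the part of `a i` at `f` can therefore contain units.
  have hsnd : ∀ i k, (a i).2 k ∈ maximalIdeal S := by
    intro i k
    obtain ⟨j, hj⟩ : ∃ j, i ≠ j := by
      have : Nontrivial (Fin e) := Fin.nontrivial_iff_two_le.mpr he
      obtain ⟨j, hj⟩ := exists_ne i
      exact ⟨j, hj.symm⟩
    refine hpair hj (y := (a j).2 k) (Ideal.mem_sup_right ?_)
    have := F.d₂_snd (c i j) k
    rw [hc] at this
    exact this
  have hfst : ∀ i j k, z j * (a i).1 k - z i * (a j).1 k - (A *ᵥ F.p (c i j)) k ∈ X := by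
    intro i j k
    have := F.d₂_fst (c i j) k
    rw [hc] at this
    exact this
  refine ⟨fun i => (a i).1, fun α hα => ?_, fun i j _ k => ?_, fun he3 i j hij k => ?_⟩
  · have h1 : (∑ i, α i * z i) * s = F.d₁ (∑ i, α i • a i) := by
      rw [map_sum, Finset.sum_mul]
      refine Finset.sum_congr rfl fun i _ => ?_
      rw [map_smul, ha, smul_eq_mul]; ring
    rw [h1]
    refine F.d₁_mem_mul (fun k => ?_) (fun k => ?_)
    · have := hα k
      simpa [Prod.fst_sum] using this
    · rw [Prod.snd_sum, Finset.sum_apply]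
      exact Ideal.sum_mem _ fun i _ => Ideal.mul_mem_left _ _ (hsnd i k)
  · rw [← add_sub_cancel ((A *ᵥ F.p (c i j)) k) (z j * (a i).1 k - z i * (a j).1 k)]
    refine Submodule.add_mem_sup ?_ (hXN (hfst i j k))
    change ∑ q, A k q * F.p (c i j) q ∈ _
    exact Ideal.sum_mem _ fun q _ => Ideal.mul_mem_right _ _ (Ideal.subset_span ⟨k, q, rfl⟩)
  · obtain ⟨l, hli, hlj⟩ : ∃ l, l ≠ i ∧ l ≠ j := by
      obtain ⟨l, -, hl⟩ := Finset.exists_mem_notMem_of_card_lt_card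
        (s := ({i, j} : Finset (Fin e))) (t := (Finset.univ : Finset (Fin e)))
        (Finset.card_le_two.trans_lt (by rwa [Finset.card_univ, Fintype.card_fin]))
      simp only [Finset.mem_insert, Finset.mem_singleton, not_or] at hl
      exact ⟨l, hl⟩
    -- The alternating sum over three indices is a second syzygy, so its Hilbert–Burch component
    -- lies in `X`. Independence of the `z` then forces the component of `c i j` into 𝔫, and `A`
    -- sends it into 𝔫².
    have hcyc : F.d₂ (z l • c i j - z j • c i l + z i • c j l) = 0 := by
      rw [map_add, map_sub, map_smul, map_smul, map_smul, hc, hc, hc]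
      module
    obtain ⟨b, hb⟩ := (F.exact₂ _).mp hcyc
    have hp : ∀ q, F.p (c i j) q ∈ maximalIdeal S := by
      intro q
      have h1 := hXN (F.p_d₃ b q)
      rw [hb] at h1
      have h2 := hind (Pi.single l (F.p (c i j) q) - Pi.single j (F.p (c i l) q) +
        Pi.single i (F.p (c j l) q)) (by
          convert h1 using 1
          simp only [Pi.add_apply, Pi.sub_apply, add_mul, sub_mul, Finset.sum_add_distrib,
            Finset.sum_sub_distrib, Pi.single_apply, ite_mul, zero_mul, Finset.sum_ite_eq',
            Finset.mem_univ, if_true, map_add, map_sub, map_smul, Pi.smul_apply, smul_eq_mul]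
          ring) l
      simpa [Pi.single_eq_of_ne hli, Pi.single_eq_of_ne hlj] using h2
    rw [← add_sub_cancel ((A *ᵥ F.p (c i j)) k) (z j * (a i).1 k - z i * (a j).1 k)]
    refine add_mem (Ideal.mem_sup_left ?_) (hXN (hfst i j k))
    rw [pow_two]
    change ∑ q, A k q * F.p (c i j) q ∈ _
    exact Ideal.sum_mem _ fun q _ => Ideal.mul_mem_mul (h.entry_mem k q) (hp q)

end HilbertBurchCone

end Upper

end Burch

namespace Burch

open IsLocalRing
open scoped Matrix

theorem IsSpannedMod.of_le {S : Type*} [CommRing S] {N B : Ideal S} (h : N ≤ B) (l : ℕ) :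
    IsSpannedMod N B l :=
  ⟨fun _ => 0, fun _ => zero_mem _, h.trans le_sup_left⟩

namespace HilbertBurchCone

variable {S : Type u} [CommRing S] [IsLocalRing S] [IsNoetherianRing S] {m r : ℕ}
  {f : Fin m → S} {A : Matrix (Fin m) (Fin r) S} {X L : Ideal S} {t : ℕ} {G₂ G₃ : Type u}
  [AddCommGroup G₂] [Module S G₂] [AddCommGroup G₃] [Module S G₃]

/-- The maximal ideal is spanned by two elements modulo the Burch ideal; one of them is enough if
the entries of the Hilbert–Burch matrix are spanned by one element modulo `𝔫²`, and the maximal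
ideal equals the Burch ideal if they lie in `𝔫²`. -/
theorem isSpannedMod_burchIdeal (h : IsHilbertBurch f A)
    (F : HilbertBurchCone f A X L t G₂ G₃) (hX : X ≤ maximalIdeal S)
    (hL : L = Ideal.span (Set.range f) ⊔ X) :
    IsSpannedMod (maximalIdeal S) (burchIdeal L) 2 ∧
    ((∃ w ∈ maximalIdeal S, ∀ i j, A i j ∈ maximalIdeal S ^ 2 ⊔ Ideal.span {w}) →
      IsSpannedMod (maximalIdeal S) (burchIdeal L) 1) ∧
    ((∀ i j, A i j ∈ maximalIdeal S ^ 2) → IsSpannedMod (maximalIdeal S) (burchIdeal L) 0) := by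
  obtain ⟨e, z, he, hz, hspan, hNB, hind, hs⟩ := F.exists_socle_coefficients h hX hL
  have hpair : ∀ {i j : Fin e}, i ≠ j → ∀ {x y : S},
      z j * x - z i * y ∈ maximalIdeal S ^ 2 ⊔ L → x ∈ maximalIdeal S := by
    intro i j hij x y hxy
    have := hind (Pi.single j x - Pi.single i y) (by
      simp only [Pi.sub_apply, sub_mul, Finset.sum_sub_distrib, Pi.single_apply, ite_mul,
        zero_mul, Finset.sum_ite_eq', Finset.mem_univ, if_true]
      rwa [mul_comm x, mul_comm y]) j
    simpa [Pi.single_eq_of_ne hij.symm] using this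
  have hne : ∀ i : Fin e, ∃ j, i ≠ j := fun i => by
    have : Nontrivial (Fin e) := Fin.nontrivial_iff_two_le.mpr he
    obtain ⟨j, hj⟩ := exists_ne i
    exact ⟨j, hj.symm⟩
  have hspan' := hspan.trans (sup_le_sup_right hNB _)
  -- If all `z j * a i k - z i * a j k` lie in 𝔫² + L, independence gives `a i k ∈ 𝔫`; then every `z
  -- i * s` lies in `L𝔫`, and the Burch ideal contains 𝔫.
  have key : (∀ s (a : Fin e → Fin m → S), (∀ y ∈ maximalIdeal S, s * y ∈ L) →
      (∀ i j, i ≠ j → ∀ k, z j * a i k - z i * a j k ∈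
          Ideal.span {x | ∃ i j, x = A i j} ⊔ (maximalIdeal S ^ 2 ⊔ L)) →
      (3 ≤ e → ∀ i j, i ≠ j → ∀ k, z j * a i k - z i * a j k ∈ maximalIdeal S ^ 2 ⊔ L) →
      ∀ i j, i ≠ j → ∀ k, z j * a i k - z i * a j k ∈ maximalIdeal S ^ 2 ⊔ L) →
      maximalIdeal S ≤ burchIdeal L := by
    intro hall
    refine hspan'.trans (sup_le le_rfl (Ideal.span_le.mpr ?_))
    rintro _ ⟨i, rfl⟩
    refine mem_burchIdeal.mpr fun s hsL => ?_
    obtain ⟨a, h1, h2, h3⟩ := hs s hsL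
    have h4 := hall s a hsL h2 h3
    obtain ⟨j, hij⟩ := hne i
    have := h1 (Pi.single i 1) (fun k => by
      simpa [Pi.single_apply] using hpair hij (h4 i j hij k))
    simpa [Pi.single_apply] using this
  have hbig : 3 ≤ e → maximalIdeal S ≤ burchIdeal L := fun he3 => key fun s a _ _ h3 => h3 he3
  refine ⟨?_, ?_, fun hA => .of_le (key fun s a _ h2 _ i j hij k => ?_) 0⟩
  · by_cases he3 : 3 ≤ e
    · exact .of_le (hbig he3) 2
    · obtain rfl : e = 2 := by omega
      exact ⟨z, hz, hspan'⟩
  · rintro ⟨w, hw, hA⟩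
    by_cases he3 : 3 ≤ e
    · exact .of_le (hbig he3) 1
    obtain rfl : e = 2 := by omega
    obtain ⟨ν, hν, y, hy, rfl⟩ := Submodule.mem_sup.mp (hspan hw)
    obtain ⟨c, rfl⟩ := (Ideal.mem_span_range_iff_exists_fun).mp hy
    have hAw : Ideal.span {x | ∃ i j, x = A i j} ⊔ (maximalIdeal S ^ 2 ⊔ L) ≤
        maximalIdeal S ^ 2 ⊔ L ⊔ Ideal.span {∑ i, c i * z i} := by
      refine sup_le (Ideal.span_le.mpr ?_) le_sup_left
      rintro _ ⟨i, j, rfl⟩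
      refine (sup_le (le_sup_left.trans le_sup_left) ?_ :
        maximalIdeal S ^ 2 ⊔ Ideal.span {ν + ∑ i, c i * z i} ≤ _) (hA i j)
      rw [Ideal.span_singleton_le_iff_mem]
      exact Submodule.add_mem_sup hν (Ideal.mem_span_singleton_self _)
    -- Comparing coefficients in `z 1 * a 0 - z 0 * a 1 ≡ q * (c 0 * z 0 + c 1 * z 1)` gives `a 0 ≡
    -- q * c 1` and `a 1 ≡ -q * c 0` modulo 𝔫. Hence `c 0 * a 0 + c 1 * a 1 ∈ 𝔫`, which puts the
    -- spanning linear form into the Burch ideal.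
    have hcoef : ∀ (a : Fin 2 → Fin m → S), (∀ i j, i ≠ j → ∀ k, z j * a i k - z i * a j k ∈
          Ideal.span {x | ∃ i j, x = A i j} ⊔ (maximalIdeal S ^ 2 ⊔ L)) → ∀ k, ∃ q,
        a 0 k - q * c 1 ∈ maximalIdeal S ∧ a 1 k + q * c 0 ∈ maximalIdeal S := by
      intro a ha k
      obtain ⟨x, hx, y, hy, hxy⟩ := Submodule.mem_sup.mp (hAw (ha 0 1 (by decide) k))
      obtain ⟨q, rfl⟩ := Ideal.mem_span_singleton'.mp hy
      have h0 := hind ![-(a 1 k + q * c 0), a 0 k - q * c 1] (by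
        have : ∑ i, (![-(a 1 k + q * c 0), a 0 k - q * c 1] : Fin 2 → S) i * z i = x := by
          rw [Fin.sum_univ_two] at hxy ⊢
          simp only [Matrix.cons_val_zero, Matrix.cons_val_one]
          linear_combination -hxy
        rwa [this])
      exact ⟨q, h0 1, by simpa using neg_mem (h0 0)⟩
    have hmem : ∑ i, c i * z i ∈ burchIdeal L := by
      refine mem_burchIdeal.mpr fun s hsL => ?_
      obtain ⟨a, h1, h2, -⟩ := hs s hsL
      refine h1 c fun k => ?_
      obtain ⟨q, h3, h4⟩ := hcoef a h2 k
      rw [Fin.sum_univ_two]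
      convert add_mem (Ideal.mul_mem_left _ (c 0) h3) (Ideal.mul_mem_left _ (c 1) h4) using 1
      ring
    have hunit : ∀ i j : Fin 2, i ≠ j → IsUnit (c i) →
        IsSpannedMod (maximalIdeal S) (burchIdeal L) 1 := by
      intro i j hij hc
      refine ⟨fun _ => z j, fun _ => hz j, hspan'.trans (sup_le le_sup_left
        (Ideal.span_le.mpr ?_))⟩
      have hj : z j ∈ burchIdeal L ⊔ Ideal.span (Set.range fun _ : Fin 1 => z j) :=
        Ideal.mem_sup_right (Ideal.subset_span ⟨0, rfl⟩)
      have hi : z i ∈ burchIdeal L ⊔ Ideal.span (Set.range fun _ : Fin 1 => z j) := by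
        rw [← Ideal.unit_mul_mem_iff_mem _ hc]
        have hsum : c i * z i = ∑ i, c i * z i - c j * z j := by
          rw [Fin.sum_univ_two]
          fin_cases i <;> fin_cases j <;> simp at hij ⊢
        rw [hsum]
        exact sub_mem (Ideal.mem_sup_left hmem) (Ideal.mul_mem_left _ _ hj)
      rintro _ ⟨k, rfl⟩
      obtain rfl | rfl : k = i ∨ k = j := by omega
      · exact hi
      · exact hj
    by_cases h0 : IsUnit (c 0)
    · exact hunit 0 1 (by decide) h0
    by_cases h1 : IsUnit (c 1)
    · exact hunit 1 0 (by decide) h1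
    -- If neither `c 0` nor `c 1` is a unit, the linear form vanishes modulo 𝔫² + L and all
    -- coefficients `a` lie in 𝔫.
    refine .of_le (key fun s a _ h2 _ i j _ k => Ideal.mem_sup_left ?_) 1
    have ha : ∀ i, a i k ∈ maximalIdeal S := by
      obtain ⟨q, h3, h4⟩ := hcoef a h2 k
      intro i
      fin_cases i
      · have := add_mem h3 (Ideal.mul_mem_left _ q ((mem_maximalIdeal _).mpr h1))
        simpa using this
      · have := sub_mem h4 (Ideal.mul_mem_left _ q ((mem_maximalIdeal _).mpr h0))
        simpa using this
    rw [pow_two]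
    exact sub_mem (Ideal.mul_mem_mul (hz j) (ha i)) (Ideal.mul_mem_mul (hz i) (ha j))
  · refine (sup_le (Ideal.span_le.mpr ?_) le_rfl :
      Ideal.span {x | ∃ i j, x = A i j} ⊔ (maximalIdeal S ^ 2 ⊔ L) ≤ _) (h2 i j hij k)
    rintro _ ⟨i, j, rfl⟩
    exact Ideal.mem_sup_left (hA i j)

end HilbertBurchCone

theorem IsHilbertBurch.isSpannedMod_burchIdeal {S : Type u} [CommRing S] [IsLocalRing S]
    [IsNoetherianRing S] {m r : ℕ} {f : Fin m → S} {A : Matrix (Fin m) (Fin r) S}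
    (h : IsHilbertBurch f A) {xs : List S} (hxs : Ideal.ofList xs ≤ maximalIdeal S)
    (hreg : IsRegularMod (Ideal.span (Set.range f)) xs) :
    (¬ maximalIdeal S ≤ Ideal.span (Set.range f) ⊔ Ideal.ofList xs) ∧
    IsSpannedMod (maximalIdeal S) (burchIdeal (Ideal.span (Set.range f) ⊔ Ideal.ofList xs)) 2 ∧
    ((∃ w ∈ maximalIdeal S, ∀ i j, A i j ∈ maximalIdeal S ^ 2 ⊔ Ideal.span {w}) →
      IsSpannedMod (maximalIdeal S)
        (burchIdeal (Ideal.span (Set.range f) ⊔ Ideal.ofList xs)) 1) ∧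
    ((∀ i j, A i j ∈ maximalIdeal S ^ 2) → IsSpannedMod (maximalIdeal S)
      (burchIdeal (Ideal.span (Set.range f) ⊔ Ideal.ofList xs)) 0) := by
  obtain ⟨t, H₂, H₃, _, _, _, _, ⟨F⟩⟩ := HilbertBurchCone.exists_of_isRegularMod xs h.baseCone hreg
  rw [bot_sup_eq] at F
  refine ⟨fun hle => F.not_le_sup_span_singleton h hxs rfl (zero_mem _) (hle.trans ?_),
    F.isSpannedMod_burchIdeal h hxs rfl⟩
  exact le_sup_right.trans le_sup_left

end Burch

/-! ### Lower bounds in dimension two -/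

namespace Burch

open IsLocalRing
open scoped Matrix

namespace IsHilbertBurch

section General

variable {S : Type*} [CommRing S] [IsLocalRing S] {m r : ℕ} {f : Fin m → S}
  {A : Matrix (Fin m) (Fin r) S}

theorem coeff_mem (h : IsHilbertBurch f A) {u : Fin m → S} (hu : f ⬝ᵥ u = 0) (i : Fin m) :
    u i ∈ maximalIdeal S := by
  obtain ⟨c, rfl⟩ := h.exact u hu
  change ∑ j, A i j * c j ∈ _
  exact Ideal.sum_mem _ fun j _ => Ideal.mul_mem_right _ _ (h.entry_mem i j)

theorem generator_ne_zero (h : IsHilbertBurch f A) (i : Fin m) : f i ≠ 0 := by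
  intro hi
  have := h.coeff_mem (u := Pi.single i 1) (by simp [hi]) i
  rw [Pi.single_eq_same] at this
  exact (Ideal.ne_top_iff_one _).mp Ideal.IsPrime.ne_top' this

theorem span_le (h : IsHilbertBurch f A) : Ideal.span (Set.range f) ≤ maximalIdeal S ^ 2 := by
  rw [Ideal.span_le]
  rintro _ ⟨i, rfl⟩
  exact h.generator_mem i

theorem mem_span_iff {S : Type*} [CommRing S] {m : ℕ} {f : Fin m → S} {x : S} : x ∈ Ideal.span (Set.range f) ↔ ∃ u, f ⬝ᵥ u = x := by
  rw [Ideal.mem_span_range_iff_exists_fun]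
  simp [dotProduct, mul_comm]

theorem dotProduct_mem {S : Type*} [CommRing S] {m : ℕ} {f : Fin m → S} (u : Fin m → S) : f ⬝ᵥ u ∈ Ideal.span (Set.range f) :=
  mem_span_iff.mpr ⟨u, rfl⟩

theorem mem_span_mul_iff {x : S} : x ∈ Ideal.span (Set.range f) * maximalIdeal S ↔
    ∃ u, (∀ i, u i ∈ maximalIdeal S) ∧ f ⬝ᵥ u = x := by
  constructor
  · intro hx
    refine Submodule.mul_induction_on hx ?_ ?_
    · intro a ha b hb
      obtain ⟨u, rfl⟩ := mem_span_iff.mp ha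
      exact ⟨b • u, fun i => Ideal.mul_mem_right _ _ hb, by
        rw [dotProduct_smul, smul_eq_mul, mul_comm]⟩
    · rintro _ _ ⟨u, hu, rfl⟩ ⟨v, hv, rfl⟩
      exact ⟨u + v, fun i => add_mem (hu i) (hv i), dotProduct_add _ _ _⟩
  · rintro ⟨u, hu, rfl⟩
    exact Ideal.sum_mem _ fun i _ => Ideal.mul_mem_mul (Ideal.subset_span ⟨i, rfl⟩) (hu i)

end General

section DimTwo

variable {T : Type*} [CommRing T] [IsRegularLocalRing T] {m r : ℕ} {f : Fin m → T}
  {A : Matrix (Fin m) (Fin r) T}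

/-- In dimension two every column of the Hilbert–Burch matrix gives an element of the socle. -/
theorem exists_socle (h : IsHilbertBurch f A) {z : Fin 2 → T}
    (hz : Ideal.span (Set.range z) = maximalIdeal T)
    (hd : (maximalIdeal T).spanFinrank = 2) (j : Fin r) {a b : Fin m → T}
    (hab : ∀ i, A i j = z 1 * a i - z 0 * b i) :
    ∃ s, f ⬝ᵥ a = z 0 * s ∧ f ⬝ᵥ b = z 1 * s := by
  -- A column gives `z 1 * (f ⬝ᵥ a) = z 0 * (f ⬝ᵥ b)`; the relations between two parameters are
  -- multiples of the Koszul one, and the factor is `s`.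
  have hk := mem_koszul_of_sum_mul_eq_zero 2 T z hz hd ![-(f ⬝ᵥ b), f ⬝ᵥ a] (by
    have h0 := h.comp_eq_zero (Pi.single j 1)
    rw [Matrix.mulVec_single_one] at h0
    have h1 : A.col j = z 1 • a - z 0 • b := funext fun i => hab i
    rw [h1, dotProduct_sub, dotProduct_smul, dotProduct_smul] at h0
    rw [Fin.sum_univ_two]
    simp only [Matrix.cons_val_zero, Matrix.cons_val_one, smul_eq_mul] at h0 ⊢
    linear_combination h0)
  have key : ∀ c ∈ koszul z, ∃ s, c 0 = -(z 1 * s) ∧ c 1 = z 0 * s := by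
    intro c hc
    refine Submodule.span_induction ?_ ?_ ?_ ?_ hc
    · rintro _ ⟨i, j, rfl⟩
      fin_cases i <;> fin_cases j
      · exact ⟨0, by simp⟩
      · exact ⟨-1, by simp⟩
      · exact ⟨1, by simp⟩
      · exact ⟨0, by simp⟩
    · exact ⟨0, by simp⟩
    · rintro c c' - - ⟨s, h1, h2⟩ ⟨s', h1', h2'⟩
      exact ⟨s + s', by rw [Pi.add_apply, h1, h1']; ring, by rw [Pi.add_apply, h2, h2']; ring⟩
    · rintro k c - ⟨s, h1, h2⟩
      exact ⟨k * s, by rw [Pi.smul_apply, h1, smul_eq_mul]; ring, by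
        rw [Pi.smul_apply, h2, smul_eq_mul]; ring⟩
  obtain ⟨s, h1, h2⟩ := key _ hk
  exact ⟨s, h2, neg_inj.mp h1⟩

/-- The lower bounds in dimension two. -/
theorem not_isSpannedMod_burchIdeal (h : IsHilbertBurch f A)
    (hd : (maximalIdeal T).spanFinrank = 2) {l : ℕ} (hl : l < 2)
    {ι : Fin (l + 1) → Fin m} {κ : Fin (l + 1) → Fin r}
    (hind : ∀ α : Fin (l + 1) → T, ∑ q, α q * A (ι q) (κ q) ∈ maximalIdeal T ^ 2 →
      ∀ q, α q ∈ maximalIdeal T) :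
    (∃ s ∉ Ideal.span (Set.range f), ∀ y ∈ maximalIdeal T, s * y ∈ Ideal.span (Set.range f)) ∧
    ¬ IsSpannedMod (maximalIdeal T) (burchIdeal (Ideal.span (Set.range f))) l := by
  obtain ⟨z, hz⟩ : ∃ z : Fin 2 → T, Ideal.span (Set.range z) = maximalIdeal T :=
    hd ▸ exists_fin_spanFinrank_generators T
  have hzm : ∀ i, z i ∈ maximalIdeal T := fun i => hz ▸ Ideal.subset_span ⟨i, rfl⟩
  have hex : ∀ i j, ∃ a b, A i j = z 1 * a - z 0 * b := by
    intro i j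
    have := h.entry_mem i j
    rw [← hz, Ideal.mem_span_range_iff_exists_fun] at this
    obtain ⟨c, hc⟩ := this
    refine ⟨c 1, -c 0, ?_⟩
    rw [← hc, Fin.sum_univ_two]; ring
  choose a b hab using hex
  have hsoc := fun j => h.exists_socle hz hd j (fun i => hab i j)
  choose s hsa hsb using hsoc
  have hsn : ∀ j, ∀ y ∈ maximalIdeal T, s j * y ∈ Ideal.span (Set.range f) := by
    intro j y hy
    rw [← hz, Ideal.mem_span_range_iff_exists_fun] at hy
    obtain ⟨c, rfl⟩ := hy
    rw [Fin.sum_univ_two]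
    convert add_mem (Ideal.mul_mem_left _ (c 0) (dotProduct_mem (f := f) fun i => a i j))
      (Ideal.mul_mem_left _ (c 1) (dotProduct_mem (f := f) fun i => b i j)) using 1
    rw [hsa, hsb]; ring
  have hone : (1 : T) ∉ maximalIdeal T := (Ideal.ne_top_iff_one _).mp Ideal.IsPrime.ne_top'
  have hsq : ∀ i j, a i j ∈ maximalIdeal T → b i j ∈ maximalIdeal T →
      A i j ∈ maximalIdeal T ^ 2 := by
    intro i j h1 h2
    rw [hab, pow_two]
    exact sub_mem (Ideal.mul_mem_mul (hzm 1) h1) (Ideal.mul_mem_mul (hzm 0) h2)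
  have hnot : ∀ q, A (ι q) (κ q) ∉ maximalIdeal T ^ 2 := by
    intro q hq
    have := hind (Pi.single q 1) (by simpa [Pi.single_apply] using hq) q
    rw [Pi.single_eq_same] at this
    exact hone this
  refine ⟨⟨s (κ 0), fun hs => ?_, hsn _⟩, ?_⟩
  -- If `s = f ⬝ᵥ u`, then `a - z 0 • u` and `b - z 1 • u` are syzygies and have coefficients in 𝔫,
  -- so the chosen entry would lie in 𝔫².
  · obtain ⟨u, hu⟩ := mem_span_iff.mp hs
    refine hnot 0 (hsq _ _ ?_ ?_)
    · have := h.coeff_mem (u := (fun i => a i (κ 0)) - z 0 • u)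
        (by rw [dotProduct_sub, dotProduct_smul, hu, hsa, smul_eq_mul, sub_self]) (ι 0)
      simpa using add_mem this (Ideal.mul_mem_right (u (ι 0)) _ (hzm 0))
    · have := h.coeff_mem (u := (fun i => b i (κ 0)) - z 1 • u)
        (by rw [dotProduct_sub, dotProduct_smul, hu, hsb, smul_eq_mul, sub_self]) (ι 0)
      simpa using add_mem this (Ideal.mul_mem_right (u (ι 0)) _ (hzm 1))
  -- The product of `p * z 0 + q * z 1` with `s j` is `f ⬝ᵥ (p • a + q • b)`. It lies in `I𝔫` only
  -- if the coefficients lie in 𝔫, since those of syzygies do.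
  have hBI : ∀ p q, p * z 0 + q * z 1 ∈ burchIdeal (Ideal.span (Set.range f)) → ∀ i j,
      p * a i j + q * b i j ∈ maximalIdeal T := by
    intro p q hpq i j
    obtain ⟨v, hv, hv'⟩ := mem_span_mul_iff.mp (mem_burchIdeal.mp hpq (s j) (hsn j))
    have := h.coeff_mem (u := p • (fun i => a i j) + q • (fun i => b i j) - v) (by
      rw [dotProduct_sub, dotProduct_add, dotProduct_smul, dotProduct_smul, hsa, hsb, hv',
        smul_eq_mul, smul_eq_mul]
      ring) i
    simpa using add_mem this (hv i)
  rintro ⟨w, hw, hle⟩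
  obtain rfl | rfl : l = 0 ∨ l = 1 := by omega
  · have hle' : maximalIdeal T ≤ burchIdeal (Ideal.span (Set.range f)) :=
      hle.trans (sup_le le_rfl (by simp))
    refine hnot 0 (hsq _ _ ?_ ?_)
    · simpa using hBI 1 0 (by simpa using hle' (hzm 0)) (ι 0) (κ 0)
    · simpa using hBI 0 1 (by simpa using hle' (hzm 1)) (ι 0) (κ 0)
  · have hind₂ : ∀ x y, x * A (ι 0) (κ 0) + y * A (ι 1) (κ 1) ∈ maximalIdeal T ^ 2 →
        x ∈ maximalIdeal T ∧ y ∈ maximalIdeal T := fun x y hxy => by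
      have := hind ![x, y] (by erw [Fin.sum_univ_two]; exact hxy)
      exact ⟨this 0, this 1⟩
    -- Eliminating `z 0` or `z 1` from the two entries leaves the determinant times the other
    -- parameter. With the determinant in 𝔫 this would be a dependence modulo 𝔫².
    have hdet : a (ι 0) (κ 0) * b (ι 1) (κ 1) - a (ι 1) (κ 1) * b (ι 0) (κ 0) ∉
        maximalIdeal T := by
      intro hD
      have h1 := hind₂ (b (ι 1) (κ 1)) (-b (ι 0) (κ 0)) (by
        rw [pow_two]
        convert Ideal.mul_mem_mul (hzm 1) hD using 1
        rw [hab, hab]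
        ring)
      have h2 := hind₂ (a (ι 1) (κ 1)) (-a (ι 0) (κ 0)) (by
        rw [pow_two]
        convert Ideal.mul_mem_mul (hzm 0) hD using 1
        rw [hab, hab]
        ring)
      exact hnot 1 (hsq _ _ h2.1 h1.1)
    have hzero : ∀ p q, p * z 0 + q * z 1 ∈ burchIdeal (Ideal.span (Set.range f)) →
        p ∈ maximalIdeal T ∧ q ∈ maximalIdeal T := by
      intro p q hpq
      have h0 := hBI p q hpq (ι 0) (κ 0)
      have h1 := hBI p q hpq (ι 1) (κ 1)
      constructor
      · refine (Ideal.IsPrime.mem_or_mem inferInstance ?_).resolve_right hdet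
        convert sub_mem (Ideal.mul_mem_left _ (b (ι 1) (κ 1)) h0)
          (Ideal.mul_mem_left _ (b (ι 0) (κ 0)) h1) using 1
        ring
      · refine (Ideal.IsPrime.mem_or_mem inferInstance ?_).resolve_right hdet
        convert sub_mem (Ideal.mul_mem_left _ (a (ι 0) (κ 0)) h1)
          (Ideal.mul_mem_left _ (a (ι 1) (κ 1)) h0) using 1
        ring
    obtain ⟨c, hc⟩ := Ideal.mem_span_range_iff_exists_fun.mp (hz.ge (hw 0))
    rw [Fin.sum_univ_two] at hc
    have hex : ∀ y ∈ maximalIdeal T, ∃ t, y - t * w 0 ∈ burchIdeal (Ideal.span (Set.range f)) := by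
      intro y hy
      obtain ⟨x, hx, v, hv, rfl⟩ := Submodule.mem_sup.mp (hle hy)
      obtain ⟨t, rfl⟩ := Ideal.mem_span_range_iff_exists_fun.mp hv
      exact ⟨t 0, by simpa using hx⟩
    obtain ⟨t, ht⟩ := hex _ (hzm 0)
    obtain ⟨t', ht'⟩ := hex _ (hzm 1)
    obtain ⟨h1, h2⟩ := hzero (1 - t * c 0) (-(t * c 1)) (by
      convert ht using 1; rw [← hc]; ring)
    obtain ⟨h3, h4⟩ := hzero (-(t' * c 0)) (1 - t' * c 1) (by
      convert ht' using 1; rw [← hc]; ring)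
    -- Modulo 𝔫 the identity matrix of size two would be the product of the column `(t, t')` and the
    -- row `(c 0, c 1)`.
    refine hone ?_
    convert sub_mem (add_mem h1 (Ideal.mul_mem_left _ (t * c 0) h4))
      (Ideal.mul_mem_left _ (t' * c 0) h2) using 1
    ring

end DimTwo

end IsHilbertBurch

end Burch

/-! ### General elements, socles in higher dimension, and quotients -/

namespace Burch

open IsLocalRing
open scoped Matrix

section Avoidance

variable {S : Type*} [CommRing S]

/-- The associated primes of `S/I` in terms of elements. -/
theorem exists_finset_primes [IsNoetherianRing S] (I : Ideal S) :
    ∃ s : Finset (Ideal S), (∀ P ∈ s, P.IsPrime ∧ ∃ a ∉ I, ∀ y ∈ P, a * y ∈ I) ∧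
      ∀ x, (∀ P ∈ s, x ∉ P) → ∀ a, x * a ∈ I → a ∈ I := by
  have hfin := associatedPrimes.finite S (S ⧸ I)
  refine ⟨hfin.toFinset, fun P hP => ?_, fun x hx a ha => ?_⟩
  · rw [Set.Finite.mem_toFinset, AssociatedPrimes.mem_iff] at hP
    refine ⟨hP.isPrime, ?_⟩
    obtain ⟨hp, a, ha⟩ := isAssociatedPrime_iff.mp hP
    obtain ⟨a, rfl⟩ := Ideal.Quotient.mk_surjective a
    have hmem : ∀ y, y ∈ P ↔ a * y ∈ I := by
      intro y
      rw [ha, Submodule.mem_colon_singleton, Submodule.mem_bot, ← Ideal.Quotient.eq_zero_iff_mem,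
        mul_comm]
      rfl
    refine ⟨a, fun h => hp.ne_top ((Ideal.eq_top_iff_one _).mpr ((hmem 1).mpr (by simpa using h))),
      fun y hy => (hmem y).mp hy⟩
  · by_contra hna
    have h0 : x ∈ {r : S | ∃ b : S ⧸ I, b ≠ 0 ∧ r • b = 0} :=
      ⟨Ideal.Quotient.mk I a, fun h => hna (Ideal.Quotient.eq_zero_iff_mem.mp h),
        Ideal.Quotient.eq_zero_iff_mem.mpr ha⟩
    rw [← biUnion_associatedPrimes_eq_zero_divisors, Set.mem_iUnion₂] at h0
    obtain ⟨P, hP, hxP⟩ := h0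
    exact hx P (hfin.mem_toFinset.mpr hP) hxP

variable [IsLocalRing S] [IsNoetherianRing S]

/-- By prime avoidance the maximal ideal lies in an associated prime, and the element annihilated by
that prime is in the socle. -/
theorem exists_socle_of_forall_exists {I : Ideal S}
    (h : ∀ x ∈ maximalIdeal S, ∃ a ∉ I, x * a ∈ I) :
    ∃ s ∉ I, ∀ y ∈ maximalIdeal S, s * y ∈ I := by
  obtain ⟨s, hs, hx⟩ := exists_finset_primes I
  have hsub : ((maximalIdeal S : Ideal S) : Set S) ⊆ ⋃ P ∈ (s : Set (Ideal S)), (P : Set S) := by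
    intro x hxn
    by_contra hn
    simp only [Set.mem_iUnion, not_exists] at hn
    obtain ⟨a, ha, hxa⟩ := h x hxn
    exact ha (hx x (fun P hP => hn P hP) a hxa)
  obtain ⟨P, hP, hle⟩ := (Ideal.subset_union_prime (s := s) (f := id) ⊥ ⊥
    (fun P hP _ _ => (hs P hP).1)).mp hsub
  obtain ⟨a, ha, haP⟩ := (hs P hP).2
  exact ⟨a, ha, fun y hy => haP y (hle hy)⟩

/-- Over an infinite residue field a general element of the maximal ideal avoids finitely many
ideals that do not contain all of `𝔫` modulo `𝔫²`. -/
theorem exists_forall_notMem_sup_sq [Infinite (ResidueField S)] (s : Finset (Ideal S))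
    (hs : ∀ J ∈ s, ¬ maximalIdeal S ≤ J) :
    ∃ x ∈ maximalIdeal S, ∀ J ∈ s, x ∉ J ⊔ maximalIdeal S ^ 2 := by
  classical
  obtain ⟨z, hz⟩ := exists_fin_spanFinrank_generators S
  have hzm : ∀ i, z i ∈ maximalIdeal S := fun i => hz ▸ Ideal.subset_span ⟨i, rfl⟩
  have hsmall : ∀ J : Ideal S, ∀ c : Fin (maximalIdeal S).spanFinrank → S,
      (∀ i, residue S (c i) = 0) → ∑ i, c i * z i ∈ J ⊔ maximalIdeal S ^ 2 := by
    intro J c hc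
    refine Ideal.mem_sup_right ?_
    rw [pow_two]
    exact Ideal.sum_mem _ fun i _ => Ideal.mul_mem_mul ((residue_eq_zero_iff _).mp (hc i)) (hzm i)
  -- `W J` consists of the linear forms lying in `J + 𝔫²`, in coordinates. It is proper by Nakayama,
  -- and a vector space over an infinite field is no finite union of proper subspaces. Working
  -- modulo 𝔫² allows ideals that are not prime.
  let W : Ideal S → Subspace (ResidueField S)
      (Fin (maximalIdeal S).spanFinrank → ResidueField S) := fun J =>
    { carrier := {v | ∃ c : Fin (maximalIdeal S).spanFinrank → S, (∀ i, residue S (c i) = v i) ∧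
        ∑ i, c i * z i ∈ J ⊔ maximalIdeal S ^ 2}
      add_mem' := by
        rintro v w ⟨c, hc, hcJ⟩ ⟨e, he, heJ⟩
        refine ⟨c + e, fun i => by simp [hc, he], ?_⟩
        simp only [Pi.add_apply, add_mul, Finset.sum_add_distrib]
        exact add_mem hcJ heJ
      zero_mem' := ⟨0, by simp, by simp⟩
      smul_mem' := by
        rintro k v ⟨c, hc, hcJ⟩
        obtain ⟨k, rfl⟩ := residue_surjective k
        refine ⟨k • c, fun i => by simp [hc], ?_⟩
        simp only [Pi.smul_apply, smul_eq_mul, mul_assoc]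
        rw [← Finset.mul_sum]
        exact Ideal.mul_mem_left _ _ hcJ }
  have htop : ⊤ ∉ s.image W := by
    rw [Finset.mem_image]
    rintro ⟨J, hJ, hW⟩
    refine hs J hJ (le_of_le_sup_maximalIdeal_smul (IsNoetherian.noetherian _) ?_)
    rw [smul_eq_mul, ← pow_two]
    nth_rewrite 1 [← hz]
    rw [Ideal.span_le]
    rintro _ ⟨i, rfl⟩
    obtain ⟨c, hc, hcJ⟩ : Pi.single i 1 ∈ W J := hW ▸ Submodule.mem_top
    have h1 := hsmall J (Pi.single i 1 - c) (fun j => by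
      rw [Pi.sub_apply, map_sub, hc, sub_eq_zero]
      by_cases hij : j = i
      · subst hij; simp
      · simp [Pi.single_eq_of_ne hij])
    have h2 := add_mem h1 hcJ
    simpa [sub_mul, Finset.sum_sub_distrib, Pi.single_apply] using h2
  have hne := Subspace.biUnion_ne_univ_of_top_notMem htop
  obtain ⟨v, hv⟩ := (Set.ne_univ_iff_exists_notMem _).mp hne
  choose c hc using fun i => residue_surjective (v i)
  refine ⟨∑ i, c i * z i, Ideal.sum_mem _ fun i _ => Ideal.mul_mem_left _ _ (hzm i),
    fun J hJ hmem => hv ?_⟩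
  exact Set.mem_iUnion₂.mpr ⟨W J, Finset.mem_image_of_mem W hJ, c, hc, hmem⟩

end Avoidance

section Triple

theorem exists_mem_notMem_sq {S : Type*} [CommRing S] [IsLocalRing S] [IsNoetherianRing S]
    (h : (maximalIdeal S).spanFinrank ≠ 0) :
    ∃ x ∈ maximalIdeal S, x ∉ maximalIdeal S ^ 2 := by
  by_contra! hall
  have hbot : maximalIdeal S ≤ ⊥ := le_of_le_sup_maximalIdeal_smul
    (IsNoetherian.noetherian _) (by
      rw [bot_sup_eq, smul_eq_mul, ← pow_two]; exact hall)
  rw [le_bot_iff.mp hbot] at h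
  exact h (Submodule.spanFinrank_bot)

variable {T : Type u} [CommRing T] [IsRegularLocalRing T]

/-- Elements outside the square of the maximal ideal are chosen in successive quotients; these are
again regular, hence domains, so the lifts form a regular sequence. -/
theorem exists_regular_triple (h : 3 ≤ (maximalIdeal T).spanFinrank) :
    ∃ x ∈ maximalIdeal T, ∃ y ∈ maximalIdeal T, ∃ z ∈ maximalIdeal T, x ≠ 0 ∧
      (∀ a b, y * a = x * b → x ∣ a) ∧
      (∀ a b c, z * c = y * b - x * a → ∃ p q, c = x * p + y * q) := by
  obtain ⟨x, hx, hx2⟩ := exists_mem_notMem_sq (S := T) (by omega)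
  obtain ⟨hQ, hdQ⟩ := isRegularLocalRing_quotient_span_singleton hx hx2
  replace hdQ := hdQ
  obtain ⟨y, hy, hy2⟩ := exists_mem_notMem_sq (S := T ⧸ Ideal.span {x}) (by omega)
  obtain ⟨hP, hdP⟩ := isRegularLocalRing_quotient_span_singleton hy hy2
  replace hdP := hdP
  obtain ⟨z, hz, hz2⟩ := exists_mem_notMem_sq
    (S := (T ⧸ Ideal.span {x}) ⧸ Ideal.span {y}) (by omega)
  have hs := Ideal.Quotient.mk_surjective (I := Ideal.span {x})
  have hs' := Ideal.Quotient.mk_surjective (I := Ideal.span {y})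
  obtain ⟨y, rfl⟩ := hs y
  obtain ⟨z, rfl⟩ := hs' z
  obtain ⟨z, rfl⟩ := hs z
  have hy0 : Ideal.Quotient.mk (Ideal.span {x}) y ≠ 0 := fun h0 => hy2 (h0 ▸ zero_mem _)
  have hx0 : Ideal.Quotient.mk (Ideal.span {x}) x = 0 :=
    Ideal.Quotient.eq_zero_iff_mem.mpr (Ideal.mem_span_singleton_self x)
  refine ⟨x, hx, y, (map_mem_maximalIdeal_iff hs).mp hy, z,
    (map_mem_maximalIdeal_iff hs).mp ((map_mem_maximalIdeal_iff hs').mp hz),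
    fun h0 => hx2 (h0 ▸ zero_mem _), fun a b hab => ?_, fun a b c habc => ?_⟩
  · have h1 := congrArg (Ideal.Quotient.mk (Ideal.span {x})) hab
    rw [map_mul, map_mul, hx0, zero_mul] at h1
    exact Ideal.mem_span_singleton.mp
      (Ideal.Quotient.eq_zero_iff_mem.mp ((mul_eq_zero.mp h1).resolve_left hy0))
  · have h1 := congrArg (Ideal.Quotient.mk (Ideal.span {x})) habc
    rw [map_mul, map_sub, map_mul, map_mul, hx0, zero_mul, sub_zero] at h1
    have h2 := congrArg (Ideal.Quotient.mk (Ideal.span {Ideal.Quotient.mk (Ideal.span {x}) y})) h1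
    rw [map_mul, map_mul, Ideal.Quotient.eq_zero_iff_mem.mpr (Ideal.mem_span_singleton_self _),
      zero_mul] at h2
    have h3 := (mul_eq_zero.mp h2).resolve_left fun h0 => hz2 (h0 ▸ zero_mem _)
    obtain ⟨q, hq⟩ := Ideal.mem_span_singleton.mp (Ideal.Quotient.eq_zero_iff_mem.mp h3)
    obtain ⟨q, rfl⟩ := hs q
    rw [← map_mul, Ideal.Quotient.eq] at hq
    obtain ⟨p, hp⟩ := Ideal.mem_span_singleton.mp hq
    exact ⟨p, q, by rw [← hp]; ring⟩

end Triple

namespace IsHilbertBurch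

variable {T : Type u} [CommRing T] [IsRegularLocalRing T] {m r : ℕ} {f : Fin m → T}
  {A : Matrix (Fin m) (Fin r) T}

/-- In dimension at least three the quotient by a Hilbert–Burch ideal has no socle. -/
theorem mem_of_forall_mul_mem (h : IsHilbertBurch f A) (hd : 3 ≤ (maximalIdeal T).spanFinrank)
    {s : T} (hs : ∀ y ∈ maximalIdeal T, s * y ∈ Ideal.span (Set.range f)) :
    s ∈ Ideal.span (Set.range f) := by
  obtain ⟨x, hx, y, hy, z, hz, hx0, hxy, hxyz⟩ := exists_regular_triple hd
  obtain ⟨a, ha⟩ := mem_span_iff.mp (hs x hx)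
  obtain ⟨b, hb⟩ := mem_span_iff.mp (hs y hy)
  obtain ⟨c, hc⟩ := mem_span_iff.mp (hs z hz)
  obtain ⟨d, hd⟩ := h.exact (y • a - x • b) (by
    rw [dotProduct_sub, dotProduct_smul, dotProduct_smul, ha, hb, smul_eq_mul, smul_eq_mul]; ring)
  obtain ⟨d', hd'⟩ := h.exact (z • a - x • c) (by
    rw [dotProduct_sub, dotProduct_smul, dotProduct_smul, ha, hc, smul_eq_mul, smul_eq_mul]; ring)
  obtain ⟨d'', hd''⟩ := h.exact (z • b - y • c) (by
    rw [dotProduct_sub, dotProduct_smul, dotProduct_smul, hb, hc, smul_eq_mul, smul_eq_mul]; ring)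
  -- A Koszul identity among the three syzygies descends to `d`, `d'`, `d''` because `A` is
  -- injective. Regularity of the triple puts `d` into `(x, y)`; subtracting `A *ᵥ q` makes `a`
  -- divisible by `x`, and the quotient represents `s`.
  have hrel := h.injective (z • d - y • d' + x • d'') (by
    rw [Matrix.mulVec_add, Matrix.mulVec_sub, Matrix.mulVec_smul, Matrix.mulVec_smul,
      Matrix.mulVec_smul, ← hd, ← hd', ← hd'']
    module)
  have hpq : ∀ i, ∃ p q, d i = x * p + y * q := fun i => hxyz (d'' i) (d' i) (d i) (by
    have := congrFun hrel i
    simp only [Pi.add_apply, Pi.sub_apply, Pi.smul_apply, smul_eq_mul, Pi.zero_apply] at this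
    linear_combination this)
  choose p q hpq using hpq
  have hdpq : d = x • p + y • q := funext fun i => by simp [hpq]
  have hu : ∀ i, x ∣ (a - A *ᵥ q) i := fun i => hxy _ (b i + (A *ᵥ p) i) (by
    have := congrFun hd i
    rw [hdpq, Matrix.mulVec_add, Matrix.mulVec_smul, Matrix.mulVec_smul] at this
    simp only [Pi.add_apply, Pi.sub_apply, Pi.smul_apply, smul_eq_mul] at this ⊢
    linear_combination this)
  choose u hu using hu
  refine mem_span_iff.mpr ⟨u, mul_left_cancel₀ hx0 ?_⟩
  rw [← smul_eq_mul x (f ⬝ᵥ u), ← dotProduct_smul,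
    show x • u = a - A *ᵥ q from funext fun i => (hu i).symm, dotProduct_sub, ha,
    h.comp_eq_zero, sub_zero, mul_comm]

/-- The Hilbert–Burch resolution passes to the quotient by an element that is regular modulo the
ideal. -/
theorem quotient (h : IsHilbertBurch f A) {x : T} (hx0 : x ≠ 0)
    (hreg : ∀ a, x * a ∈ Ideal.span (Set.range f) → a ∈ Ideal.span (Set.range f))
    [IsLocalRing (T ⧸ Ideal.span {x})] :
    IsHilbertBurch (fun i => Ideal.Quotient.mk (Ideal.span {x}) (f i))
      (A.map (Ideal.Quotient.mk (Ideal.span {x}))) := by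
  have hs := Ideal.Quotient.mk_surjective (I := Ideal.span {x})
  have hdot : ∀ u : Fin m → T, (fun i => Ideal.Quotient.mk (Ideal.span {x}) (f i)) ⬝ᵥ
      (fun i => Ideal.Quotient.mk (Ideal.span {x}) (u i)) =
      Ideal.Quotient.mk (Ideal.span {x}) (f ⬝ᵥ u) := fun u => by
    simp [dotProduct]
  have hmul : ∀ c : Fin r → T, A.map (Ideal.Quotient.mk (Ideal.span {x})) *ᵥ
      (fun j => Ideal.Quotient.mk (Ideal.span {x}) (c j)) =
      fun i => Ideal.Quotient.mk (Ideal.span {x}) ((A *ᵥ c) i) := fun c => by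
    funext i
    simp [Matrix.mulVec, dotProduct]
  have hlift : ∀ {k : ℕ} (u : Fin k → T ⧸ Ideal.span {x}),
      ∃ v : Fin k → T, u = fun i => Ideal.Quotient.mk (Ideal.span {x}) (v i) := by
    intro k u
    choose v hv using fun i => hs (u i)
    exact ⟨v, funext fun i => (hv i).symm⟩
  have hdvd : ∀ {k : ℕ} (v : Fin k → T),
      (∀ i, Ideal.Quotient.mk (Ideal.span {x}) (v i) = 0) → ∃ w, v = x • w := by
    intro k v hv
    choose w hw using fun i => Ideal.mem_span_singleton.mp
      (Ideal.Quotient.eq_zero_iff_mem.mp (hv i))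
    exact ⟨w, funext hw⟩
  refine ⟨h.pos, fun i j => map_mem_maximalIdeal hs (h.entry_mem i j), fun i => ?_, fun c => ?_,
    fun u hu => ?_, fun c hc => ?_⟩
  · rw [← map_maximalIdeal_of_surjective _ hs, ← Ideal.map_pow]
    exact Ideal.mem_map_of_mem _ (h.generator_mem i)
  · obtain ⟨c, rfl⟩ := hlift c
    rw [hmul, hdot, h.comp_eq_zero, map_zero]
  · obtain ⟨u, rfl⟩ := hlift u
    rw [hdot, Ideal.Quotient.eq_zero_iff_mem, Ideal.mem_span_singleton] at hu
    obtain ⟨t, ht⟩ := hu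
    -- A relation modulo `x` means `f ⬝ᵥ u = x * t`; regularity gives `t = f ⬝ᵥ v`, so `u - x • v`
    -- is a relation over `T`.
    obtain ⟨v, rfl⟩ := mem_span_iff.mp (hreg t (ht ▸ dotProduct_mem u))
    obtain ⟨c, hc⟩ := h.exact (u - x • v) (by
      rw [dotProduct_sub, dotProduct_smul, ht, smul_eq_mul, sub_self])
    refine ⟨fun j => Ideal.Quotient.mk (Ideal.span {x}) (c j), ?_⟩
    rw [hmul, ← hc]
    funext i
    rw [Ideal.Quotient.eq]
    exact Ideal.mem_span_singleton.mpr ⟨v i, by simp⟩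
  · obtain ⟨c, rfl⟩ := hlift c
    rw [hmul] at hc
    -- From `A *ᵥ c = x • w` follows `f ⬝ᵥ w = 0`, hence `w = A *ᵥ e` and `c = x • e`.
    obtain ⟨w, hw⟩ := hdvd (A *ᵥ c) fun i => congrFun hc i
    have hfw : f ⬝ᵥ w = 0 := by
      have := h.comp_eq_zero c
      rw [hw, dotProduct_smul, smul_eq_mul] at this
      exact (mul_eq_zero.mp this).resolve_left hx0
    obtain ⟨e, rfl⟩ := h.exact w hfw
    have := h.injective (c - x • e) (by rw [Matrix.mulVec_sub, Matrix.mulVec_smul, hw, sub_self])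
    rw [sub_eq_zero] at this
    funext j
    rw [this]
    exact Ideal.Quotient.eq_zero_iff_mem.mpr
      (Ideal.mem_span_singleton.mpr ⟨e j, by simp⟩)

end IsHilbertBurch

end Burch

/-! ### Cutting down to dimension two -/

namespace Burch

open IsLocalRing
open scoped Matrix

theorem isRegularMod_comap_iff {S R : Type*} [CommRing S] [CommRing R] {φ : S →+* R}
    (hφ : Function.Surjective φ) (xs : List S) (J : Ideal R) :
    IsRegularMod (J.comap φ) xs ↔ IsRegularMod J (xs.map φ) := by
  induction xs generalizing J with
  | nil => exact Iff.rfl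
  | cons x xs ih =>
    have h1 : J.comap φ ⊔ Ideal.span {x} = (J ⊔ Ideal.span {φ x}).comap φ := by
      have hJ : J ⊔ Ideal.span {φ x} = (J.comap φ ⊔ Ideal.span {x}).map φ := by
        rw [Ideal.map_sup, Ideal.map_comap_of_surjective φ hφ, Ideal.map_span, Set.image_singleton]
      rw [hJ, Ideal.comap_map_of_surjective _ hφ, ← RingHom.ker_eq_comap_bot, eq_comm, sup_eq_left]
      refine le_trans (fun a ha => ?_) le_sup_left
      rw [Ideal.mem_comap, RingHom.mem_ker.mp ha]
      exact zero_mem _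
    rw [IsRegularMod, List.map_cons, IsRegularMod, h1, ih]
    refine and_congr_left' ⟨fun h a ha => ?_, fun h a ha => ?_⟩
    · obtain ⟨a, rfl⟩ := hφ a
      exact h a (by rwa [Ideal.mem_comap, map_mul])
    · exact h _ (by rwa [Ideal.mem_comap, map_mul] at ha)

theorem infinite_residueField_of_ringHom {S R : Type*} [CommRing S] [IsLocalRing S] [CommRing R]
    [IsLocalRing R] (φ : S →+* R) [IsLocalHom φ] [Infinite (ResidueField S)] :
    Infinite (ResidueField R) :=
  Infinite.of_injective _ (ResidueField.map φ).injective

theorem exists_list_map_eq {α β : Type*} {g : α → β} (hg : Function.Surjective g) (ys : List β) :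
    ∃ xs, List.map g xs = ys := by
  induction ys with
  | nil => exact ⟨[], rfl⟩
  | cons y ys ih =>
    obtain ⟨xs, rfl⟩ := ih
    obtain ⟨x, rfl⟩ := hg y
    exact ⟨x :: xs, rfl⟩

/-- Over an infinite residue field a Hilbert–Burch ideal can be cut down to a two-dimensional
regular local ring in such a way that its Burch index stays large. -/
theorem IsHilbertBurch.exists_isRegularMod : ∀ (d : ℕ) (T : Type u) [CommRing T]
    [IsRegularLocalRing T] [Infinite (ResidueField T)] {m r : ℕ} {f : Fin m → T}
    {A : Matrix (Fin m) (Fin r) T} (_ : IsHilbertBurch f A) {l : ℕ} (_ : l < 2)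
    {ι : Fin (l + 1) → Fin m} {κ : Fin (l + 1) → Fin r}
    (_ : ∀ α : Fin (l + 1) → T, ∑ q, α q * A (ι q) (κ q) ∈ maximalIdeal T ^ 2 →
      ∀ q, α q ∈ maximalIdeal T) (_ : (maximalIdeal T).spanFinrank = d + 2),
    ∃ xs : List T, Ideal.ofList xs ≤ maximalIdeal T ∧ IsRegularMod (Ideal.span (Set.range f)) xs ∧
      ∃ (T₀ : Type u) (_ : CommRing T₀) (_ : IsRegularLocalRing T₀) (ψ : T →+* T₀),
        Function.Surjective ψ ∧ RingHom.ker ψ = Ideal.ofList xs ∧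
        (Ideal.span (Set.range f)).map ψ ≤ maximalIdeal T₀ ^ 2 ∧
        (Ideal.span (Set.range f)).map ψ ≠ ⊥ ∧
        (∃ s ∉ (Ideal.span (Set.range f)).map ψ, ∀ y ∈ maximalIdeal T₀,
          s * y ∈ (Ideal.span (Set.range f)).map ψ) ∧
        ¬ IsSpannedMod (maximalIdeal T₀)
          (burchIdeal ((Ideal.span (Set.range f)).map ψ)) l := by
  classical
  intro d
  induction d with
  | zero =>
    intro T _ _ _ m r f A h l hl ι κ hind hd
    refine ⟨[], by simp, trivial, T, _, ‹_›, RingHom.id T, Function.surjective_id, by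
      rw [Ideal.ofList_nil, ← RingHom.injective_iff_ker_eq_bot]; exact Function.injective_id, ?_⟩
    rw [Ideal.map_id]
    refine ⟨h.span_le, fun h0 => ?_, h.not_isSpannedMod_burchIdeal hd hl hind⟩
    have hm := h.two_le
    refine h.generator_ne_zero ⟨0, by omega⟩ ?_
    rw [← Ideal.mem_bot, ← h0]
    exact Ideal.subset_span ⟨_, rfl⟩
  | succ d ih =>
    intro T _ _ _ m r f A h l hl ι κ hind hd
    obtain ⟨s, hs, hsreg⟩ := exists_finset_primes (Ideal.span (Set.range f))
    -- Avoiding the associated primes makes `x` regular modulo the ideal; avoiding the span of the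
    -- chosen entries keeps them independent in the quotient. That span is not 𝔫, which needs at
    -- least three generators, and no associated prime is 𝔫, since there is no socle.
    obtain ⟨x, hx, hxs⟩ := exists_forall_notMem_sup_sq
      (insert (Ideal.span (Set.range fun q => A (ι q) (κ q))) s) (by
        intro J hJ hle
        rw [Finset.mem_insert] at hJ
        rcases hJ with rfl | hJ
        · have := spanFinrank_le_of_span_eq (le_antisymm (by
            rw [Ideal.span_le]
            rintro _ ⟨q, rfl⟩
            exact h.entry_mem _ _) hle)
          omega
        · obtain ⟨a, ha, haJ⟩ := (hs J hJ).2
          exact ha (h.mem_of_forall_mul_mem (by omega) fun y hy => haJ y (hle hy)))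
    have hx2 : x ∉ maximalIdeal T ^ 2 := fun hmem =>
      hxs _ (Finset.mem_insert_self _ _) (Ideal.mem_sup_right hmem)
    have hx0 : x ≠ 0 := fun h0 => hx2 (h0 ▸ zero_mem _)
    have hreg := hsreg x fun P hP hmem =>
      hxs P (Finset.mem_insert_of_mem hP) (Ideal.mem_sup_left hmem)
    obtain ⟨hQ, hdQ⟩ := isRegularLocalRing_quotient_span_singleton hx hx2
    replace hdQ := hdQ
    have hs' := Ideal.Quotient.mk_surjective (I := Ideal.span {x})
    have := hs'.isLocalHom
    have := infinite_residueField_of_ringHom (Ideal.Quotient.mk (Ideal.span {x}))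
    have hspan : Ideal.span (Set.range fun i => Ideal.Quotient.mk (Ideal.span {x}) (f i)) =
        (Ideal.span (Set.range f)).map (Ideal.Quotient.mk (Ideal.span {x})) := by
      rw [Ideal.map_span, ← Set.range_comp]
      rfl
    obtain ⟨ys, hys, hysreg, T₀, _, hT₀, ψ, hψ, hker, hK⟩ := ih (T ⧸ Ideal.span {x})
      (h.quotient hx0 hreg) hl (ι := ι) (κ := κ) (by
        intro α hα q
        choose β hβ using fun q => hs' (α q)
        obtain rfl : (fun q => Ideal.Quotient.mk (Ideal.span {x}) (β q)) = α := funext hβ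
        have h1 : Ideal.Quotient.mk (Ideal.span {x}) (∑ q, β q * A (ι q) (κ q)) ∈
            (maximalIdeal T ^ 2).map (Ideal.Quotient.mk (Ideal.span {x})) := by
          rw [Ideal.map_pow, map_maximalIdeal_of_surjective _ hs']
          simpa using hα
        obtain ⟨ν, hν, hν'⟩ := (Ideal.mem_map_iff_of_surjective _ hs').mp h1
        rw [Ideal.Quotient.eq, Ideal.mem_span_singleton] at hν'
        obtain ⟨t, ht⟩ := hν'
        -- A unit `t` would put `x` into the span of the entries modulo 𝔫².
        have htm : t ∈ maximalIdeal T := by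
          by_contra htu
          refine hxs _ (Finset.mem_insert_self _ _) ?_
          rw [← Ideal.mul_unit_mem_iff_mem _ (isUnit_of_notMem htu), ← ht, sup_comm]
          refine sub_mem (Ideal.mem_sup_left hν) (Ideal.mem_sup_right ?_)
          exact Ideal.mem_span_range_iff_exists_fun.mpr ⟨β, rfl⟩
        refine map_mem_maximalIdeal hs' (hind β ?_ q)
        rw [← sub_sub_cancel ν (∑ q, β q * A (ι q) (κ q)), ht]
        refine sub_mem hν ?_
        rw [pow_two]
        exact Ideal.mul_mem_mul hx htm) (by omega)
    obtain ⟨xs, rfl⟩ := exists_list_map_eq hs' ys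
    rw [← Ideal.map_ofList] at hys hker
    have hcomap : ∀ J : Ideal T, (J.map (Ideal.Quotient.mk (Ideal.span {x}))).comap
        (Ideal.Quotient.mk (Ideal.span {x})) = J ⊔ Ideal.span {x} := fun J => by
      rw [Ideal.comap_map_of_surjective _ hs', ← RingHom.ker_eq_comap_bot, Ideal.mk_ker]
    rw [hspan, Ideal.map_map] at hK
    refine ⟨x :: xs, ?_, ⟨hreg, ?_⟩, T₀, _, hT₀,
      ψ.comp (Ideal.Quotient.mk (Ideal.span {x})), hψ.comp hs', ?_, hK⟩
    · rw [Ideal.ofList_cons, sup_le_iff, Ideal.span_singleton_le_iff_mem]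
      refine ⟨hx, fun y hy => (map_mem_maximalIdeal_iff hs').mp (hys (Ideal.mem_map_of_mem _ hy))⟩
    · rwa [← hcomap, isRegularMod_comap_iff hs', ← hspan]
    · rw [← RingHom.comap_ker, hker, hcomap, Ideal.ofList_cons, sup_comm]

end Burch

/-! ### The Hilbert–Burch matrix and its linear entries -/

namespace Burch

open IsLocalRing CategoryTheory
open scoped Matrix

/-- Projective dimension at most 1 makes the kernel of a minimal free cover projective, hence free;
a basis gives the columns of `A`. There is at least one column, as otherwise `I` would be free. -/
theorem exists_isHilbertBurch {S : Type u} [CommRing S] [IsLocalRing S] [IsNoetherianRing S]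
    {I : Ideal S} (hI : I ≤ maximalIdeal S ^ 2)
    (hpd : projectiveDimension (ModuleCat.of S I) = 1) :
    ∃ (m r : ℕ) (f : Fin m → S) (A : Matrix (Fin m) (Fin r) S), IsHilbertBurch f A ∧
      Ideal.span (Set.range f) = I := by
  obtain ⟨m, f, hf, hspan, hind⟩ := exists_minimal_generators_mod (I : Set S) ⊥
  rw [Ideal.span_eq, bot_sup_eq] at hspan
  have hfI : Ideal.span (Set.range f) = I := le_antisymm (by
    rw [Ideal.span_le]; rintro _ ⟨i, rfl⟩; exact hf i) hspan
  have hdot : ∀ u, f ⬝ᵥ u ∈ I := fun u => hfI ▸ IsHilbertBurch.dotProduct_mem u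
  let π : (Fin m → S) →ₗ[S] I :=
    { toFun := fun u => ⟨f ⬝ᵥ u, hdot u⟩
      map_add' := fun u v => Subtype.ext
        (show f ⬝ᵥ (u + v) = f ⬝ᵥ u + f ⬝ᵥ v from dotProduct_add f u v)
      map_smul' := fun k u => Subtype.ext
        (show f ⬝ᵥ (k • u) = k • (f ⬝ᵥ u) from dotProduct_smul k f u) }
  have hker : ∀ u, u ∈ LinearMap.ker π ↔ f ⬝ᵥ u = 0 := fun u => by
    rw [LinearMap.mem_ker]; exact ⟨fun h => congrArg Subtype.val h, fun h => Subtype.ext h⟩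
  have hπ : Function.Surjective π := by
    rintro ⟨x, hx⟩
    rw [← hfI, IsHilbertBurch.mem_span_iff] at hx
    obtain ⟨u, rfl⟩ := hx
    exact ⟨u, rfl⟩
  have hproj : Module.Projective S (LinearMap.ker π) := by
    have hle : HasProjectiveDimensionLT (ModuleCat.of S I) 2 :=
      projectiveDimension_lt_iff.mp (by rw [hpd]; norm_num)
    let C : ShortComplex (ModuleCat.{u} S) := ShortComplex.mk
      (ModuleCat.ofHom (LinearMap.ker π).subtype) (ModuleCat.ofHom π) (by
        ext u; exact congrArg Subtype.val (LinearMap.mem_ker.mp u.2))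
    have hC : C.ShortExact := by
      have := (ModuleCat.mono_iff_injective C.f).mpr Subtype.val_injective
      have := (ModuleCat.epi_iff_surjective C.g).mpr hπ
      refine ⟨?_⟩
      rw [ShortComplex.ShortExact.moduleCat_exact_iff_function_exact C]
      intro u
      exact ⟨fun h => ⟨⟨u, h⟩, rfl⟩, by rintro ⟨v, rfl⟩; exact v.2⟩
    have h1 := (hC.hasProjectiveDimensionLT_X₃_iff 0
      ((IsProjective.iff_projective (Fin m → S)).mp inferInstance)).mp hle
    rw [zero_add, ← projective_iff_hasProjectiveDimensionLT_one] at h1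
    exact (IsProjective.iff_projective (LinearMap.ker π)).mpr h1
  have hfree : Module.Free S (LinearMap.ker π) := Module.free_of_flat_of_isLocalRing
  let b := Module.finBasis S (LinearMap.ker π)
  let A : Matrix (Fin m) (Fin (Module.finrank S (LinearMap.ker π))) S :=
    Matrix.of fun i j => (b j : Fin m → S) i
  have hA : ∀ c, A *ᵥ c = ((b.equivFun.symm c : LinearMap.ker π) : Fin m → S) := by
    intro c
    rw [b.equivFun_symm_apply]
    funext i
    simp [A, Matrix.mulVec, dotProduct, mul_comm]
  refine ⟨m, _, f, A, ⟨?_, fun i j => ?_, fun i => hI (hf i), fun c => ?_, fun u hu => ?_,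
    fun c hc => ?_⟩, hfI⟩
  · rw [Nat.pos_iff_ne_zero]
    intro h0
    have hbot : LinearMap.ker π = ⊥ := by
      rw [eq_bot_iff]
      intro u hu
      have h1 := hA (b.equivFun ⟨u, hu⟩)
      rw [LinearEquiv.symm_apply_apply] at h1
      have : b.equivFun ⟨u, hu⟩ = 0 := funext fun j => (Fin.cast h0 j).elim0
      rw [this, Matrix.mulVec_zero] at h1
      exact h1.symm
    have e := LinearEquiv.ofBijective π ⟨LinearMap.ker_eq_bot.mp hbot, hπ⟩
    have : Module.Projective S I := Module.Projective.of_equiv e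
    have h2 : projectiveDimension (ModuleCat.of S I) < 1 :=
      projectiveDimension_lt_iff.mpr (projective_iff_hasProjectiveDimensionLT_one.mp
        ((IsProjective.iff_projective I).mp this))
    rw [hpd] at h2
    exact lt_irrefl _ h2
  · refine hind (b j) ?_ i
    have := (hker _).mp (b j).2
    rw [Ideal.mem_bot, ← this]
    simp [dotProduct, mul_comm]
  · rw [hA, ← hker]
    exact Subtype.prop _
  · refine ⟨b.equivFun ⟨u, (hker u).mpr hu⟩, ?_⟩
    rw [hA, LinearEquiv.symm_apply_apply]
  · rw [hA] at hc
    have : b.equivFun.symm c = 0 := Subtype.ext hc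
    exact (LinearEquiv.map_eq_zero_iff _).mp this

namespace IsHilbertBurch

variable {S : Type u} [CommRing S] [IsLocalRing S] {m r : ℕ} {f : Fin m → S}
  {A : Matrix (Fin m) (Fin r) S}

/-- The augmentation of the Hilbert–Burch resolution. -/
def augmentation (f : Fin m → S) : (Fin m → S) →ₗ[S] Ideal.span (Set.range f) where
  toFun u := ⟨f ⬝ᵥ u, dotProduct_mem u⟩
  map_add' u v := Subtype.ext
    (show f ⬝ᵥ (u + v) = f ⬝ᵥ u + f ⬝ᵥ v from dotProduct_add f u v)
  map_smul' k u := Subtype.ext (show f ⬝ᵥ (k • u) = k • (f ⬝ᵥ u) from dotProduct_smul k f u)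

theorem isMinimalPresentation (h : IsHilbertBurch f A) :
    IsMinimalPresentation A (augmentation f) := by
  have hker : ∀ u, u ∈ LinearMap.ker (augmentation f) ↔ f ⬝ᵥ u = 0 := fun u => by
    rw [LinearMap.mem_ker]; exact ⟨fun h => congrArg Subtype.val h, fun h => Subtype.ext h⟩
  refine ⟨?_, ?_, fun u hu => ?_, fun c hc => ?_⟩
  · rintro ⟨x, hx⟩
    obtain ⟨u, rfl⟩ := mem_span_iff.mp hx
    exact ⟨u, rfl⟩
  · ext u
    rw [hker]
    exact ⟨by rintro ⟨c, rfl⟩; exact h.comp_eq_zero c,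
      fun hu => (h.exact u hu).imp fun c hc => hc.symm⟩
  · rw [mem_smul_top_pi_iff]
    exact h.coeff_mem ((hker u).mp hu)
  · rw [h.injective c hc]
    exact zero_mem _

/-- Every minimal presentation matrix has the same entries as the Hilbert–Burch matrix modulo
the square of the maximal ideal. -/
theorem entryIdeal_le (h : IsHilbertBurch f A) {m' n' : ℕ} {B : Matrix (Fin m') (Fin n') S}
    {π' : (Fin m' → S) →ₗ[S] Ideal.span (Set.range f)} (hB : IsMinimalPresentation B π') :
    entryIdeal B ≤ Ideal.span {a | ∃ i j, a = A i j} ⊔ maximalIdeal S ^ 2 := by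
  have hA := h.isMinimalPresentation
  -- Lifts of the identity compare the two free covers; each composite differs from the identity by
  -- relations.
  obtain ⟨P, hP⟩ := Module.projective_lifting_property (augmentation f) π' hA.surjective
  obtain ⟨P', hP'⟩ := Module.projective_lifting_property π' (augmentation f) hB.surjective
  have hP := fun u => LinearMap.congr_fun hP u
  have hP' := fun u => LinearMap.congr_fun hP' u
  simp only [LinearMap.comp_apply] at hP hP'
  have hBmem : ∀ i j, B i j ∈ maximalIdeal S := by
    intro i j
    have : B.col j ∈ LinearMap.ker π' := hB.exact.le ⟨Pi.single j 1, by simp⟩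
    exact (mem_smul_top_pi_iff _ _).mp (hB.minimal_generators this) i
  have hcol : ∀ j, B.col j ∈ LinearMap.ker π' := fun j => hB.exact.le ⟨Pi.single j 1, by simp⟩
  -- The default value of `entryIdeal` cannot occur: without columns `P'` would kill the columns of
  -- `A`, and comparison through `P ∘ P'` gives a vector in the kernel of `A` with a coordinate in
  -- `1 + 𝔫`.
  have hn' : n' ≠ 0 := by
    rintro rfl
    have hbot : ∀ v, π' v = 0 → v = 0 := by
      intro v hv
      obtain ⟨c, rfl⟩ := hB.exact.ge hv
      rw [Subsingleton.elim c 0, map_zero]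
    have hC : ∀ i : Fin m, ∃ c, A.mulVecLin c = P (P' (Pi.single i 1)) - Pi.single i 1 := fun i =>
      hA.exact.ge (by rw [LinearMap.mem_ker, map_sub, hP, hP', sub_self])
    choose c hc using hC
    let j : Fin r := ⟨0, h.pos⟩
    have h1 : P' (A.col j) = 0 := hbot _ (by
      rw [hP']
      exact hA.exact.le ⟨Pi.single j 1, by simp⟩)
    have h2 : A.col j = ∑ i, A i j • Pi.single i (1 : S) := by
      funext k
      simp [Finset.sum_apply, Pi.single_apply]
    have h3 : A *ᵥ (Pi.single j 1 + ∑ i, A i j • c i) = 0 := by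
      rw [Matrix.mulVec_add, Matrix.mulVec_single_one, ← Matrix.mulVecLin_apply, map_sum]
      simp only [map_smul, hc, smul_sub, Finset.sum_sub_distrib]
      rw [← h2]
      simp only [← map_smul]
      rw [← map_sum, ← map_sum, ← h2, h1, map_zero, zero_sub, add_neg_cancel]
    have h4 := congrFun (h.injective _ h3) j
    rw [Pi.add_apply, Pi.single_eq_same, Pi.zero_apply, Finset.sum_apply] at h4
    refine (Ideal.ne_top_iff_one _).mp (Ideal.IsPrime.ne_top' : maximalIdeal S ≠ ⊤) ?_
    rw [eq_neg_of_add_eq_zero_left h4]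
    exact neg_mem (Ideal.sum_mem _ fun i _ => Ideal.mul_mem_right _ _ (h.entry_mem i j))
  rw [entryIdeal, if_neg hn', Ideal.span_le]
  rintro _ ⟨i, j, rfl⟩
  have hC : ∀ i : Fin m', ∃ c, B.mulVecLin c = P' (P (Pi.single i 1)) - Pi.single i 1 := fun i =>
    hB.exact.ge (by rw [LinearMap.mem_ker, map_sub, hP', hP, sub_self])
  choose c hc using hC
  have h2 : B.col j = ∑ i, B i j • Pi.single i (1 : S) := by
    funext k
    simp [Finset.sum_apply, Pi.single_apply]
  obtain ⟨e, he⟩ := hA.exact.ge (show P (B.col j) ∈ _ by rw [LinearMap.mem_ker, hP]; exact hcol j)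
  -- The first term has coordinates in the ideal of entries of `A`; the second is `B` applied to a
  -- vector over 𝔫, so its coordinates lie in 𝔫².
  have h3 : B.col j = P' (A *ᵥ e) - B *ᵥ ∑ i, B i j • c i := by
    rw [← Matrix.mulVecLin_apply, he, ← Matrix.mulVecLin_apply, map_sum]
    simp only [map_smul, hc, smul_sub, Finset.sum_sub_distrib]
    rw [← h2]
    simp only [← map_smul]
    rw [← map_sum, ← map_sum, ← h2, sub_sub_cancel]
  have h4 : B i j = P' (A *ᵥ e) i - (B *ᵥ ∑ i, B i j • c i) i := congrFun h3 i
  rw [SetLike.mem_coe, h4]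
  refine sub_mem (Ideal.mem_sup_left ?_) (Ideal.mem_sup_right ?_)
  · have hmem : A *ᵥ e ∈ Ideal.span {a | ∃ i j, a = A i j} •
        (⊤ : Submodule S (Fin m → S)) := by
      rw [mem_smul_top_pi_iff]
      intro k
      change ∑ q, A k q * e q ∈ _
      exact Ideal.sum_mem _ fun q _ => Ideal.mul_mem_right _ _ (Ideal.subset_span ⟨k, q, rfl⟩)
    have := Submodule.mem_map_of_mem (f := P') hmem
    rw [Submodule.map_smul''] at this
    exact (mem_smul_top_pi_iff _ _).mp (Submodule.smul_mono le_rfl le_top this) i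
  · change ∑ q, B i q * (∑ i, B i j • c i) q ∈ _
    rw [pow_two]
    refine Ideal.sum_mem _ fun q _ => Ideal.mul_mem_mul (hBmem i q) ?_
    rw [Finset.sum_apply]
    exact Ideal.sum_mem _ fun k _ => Ideal.mul_mem_right _ _ (hBmem k j)

theorem presentationIdeal_sup (h : IsHilbertBurch f A) :
    presentationIdeal S (Ideal.span (Set.range f)) ⊔ maximalIdeal S ^ 2 =
      Ideal.span {a | ∃ i j, a = A i j} ⊔ maximalIdeal S ^ 2 := by
  refine le_antisymm (sup_le (sSup_le ?_) le_sup_right) (sup_le_sup_right ?_ _)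
  · rintro _ ⟨m', n', B, π', hB, rfl⟩
    exact h.entryIdeal_le hB
  · refine le_sSup ⟨m, r, A, augmentation f, h.isMinimalPresentation, ?_⟩
    rw [entryIdeal, if_neg h.pos.ne']

theorem lin₁_le_iff (h : IsHilbertBurch f A) (l : ℕ) :
    lin₁ S (Ideal.span (Set.range f)) ≤ l ↔
      IsSpannedMod (Ideal.span {a | ∃ i j, a = A i j} ⊔ maximalIdeal S ^ 2)
        (maximalIdeal S ^ 2) l := by
  have hle : Ideal.span {a | ∃ i j, a = A i j} ⊔ maximalIdeal S ^ 2 ≤ maximalIdeal S := by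
    refine sup_le (Ideal.span_le.mpr ?_) (Ideal.pow_le_self two_ne_zero)
    rintro _ ⟨i, j, rfl⟩
    exact h.entry_mem i j
  rw [← length_quotient_submoduleOf_le_iff (by
    rw [pow_two]
    exact Ideal.mul_mono_right (by rwa [pow_two] at hle)) l, lin₁, linSp₁, h.presentationIdeal_sup]
  set N := Ideal.span {a | ∃ i j, a = A i j} ⊔ maximalIdeal S ^ 2
  let φ := (Submodule.mkQ (maximalIdeal S ^ 2)).submoduleMap N
  have hφ : Function.Surjective φ := LinearMap.submoduleMap_surjective _ _
  have hk : (maximalIdeal S ^ 2).submoduleOf N = LinearMap.ker φ := by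
    ext x
    rw [LinearMap.mem_ker, Submodule.submoduleOf, Submodule.mem_comap]
    exact ⟨fun h => Subtype.ext ((Submodule.Quotient.mk_eq_zero _).mpr h),
      fun h => (Submodule.Quotient.mk_eq_zero _).mp (congrArg Subtype.val h)⟩
  rw [((Submodule.quotEquivOfEq _ _ hk).trans (φ.quotKerEquivOfSurjective hφ)).length_eq]

/-- A small number of linear entries. -/
theorem exists_of_lin₁_le (h : IsHilbertBurch f A) {l : ℕ}
    (hl : lin₁ S (Ideal.span (Set.range f)) ≤ l) :
    ∃ w : Fin l → S, (∀ i, w i ∈ maximalIdeal S) ∧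
      ∀ i j, A i j ∈ maximalIdeal S ^ 2 ⊔ Ideal.span (Set.range w) := by
  obtain ⟨w, hw, hle⟩ := (h.lin₁_le_iff l).mp hl
  refine ⟨w, fun i => ?_, fun i j => hle (Ideal.mem_sup_left (Ideal.subset_span ⟨i, j, rfl⟩))⟩
  refine (sup_le (Ideal.span_le.mpr ?_) (Ideal.pow_le_self two_ne_zero) :
    Ideal.span {a | ∃ i j, a = A i j} ⊔ maximalIdeal S ^ 2 ≤ maximalIdeal S) (hw i)
  rintro _ ⟨i, j, rfl⟩
  exact h.entry_mem i j

/-- Many linear entries. -/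
theorem exists_of_lt_lin₁ [IsNoetherianRing S] (h : IsHilbertBurch f A) {l : ℕ}
    (hl : (l : ℕ∞) < lin₁ S (Ideal.span (Set.range f))) :
    ∃ (ι : Fin (l + 1) → Fin m) (κ : Fin (l + 1) → Fin r),
      ∀ α : Fin (l + 1) → S, ∑ q, α q * A (ι q) (κ q) ∈ maximalIdeal S ^ 2 →
        ∀ q, α q ∈ maximalIdeal S := by
  obtain ⟨e, z, hz, hspan, hind⟩ := exists_minimal_generators_mod {a | ∃ i j, a = A i j}
    (maximalIdeal S ^ 2)
  -- At most `l` generators, padded by zeros, would contradict the number of linear entries.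
  have hle : l + 1 ≤ e := by
    by_contra! hlt
    refine hl.not_ge ((h.lin₁_le_iff l).mpr
      ⟨fun q => if hq : (q : ℕ) < e then z ⟨q, hq⟩ else 0, fun q => ?_, ?_⟩)
    · dsimp only
      split_ifs with hq
      · exact Ideal.mem_sup_left (Ideal.subset_span (hz _))
      · exact zero_mem _
    · refine sup_le (hspan.trans (sup_le_sup_left (Ideal.span_mono ?_) _)) le_sup_left
      rintro _ ⟨q, rfl⟩
      exact ⟨⟨q, by omega⟩, by simp⟩
  choose ι κ hικ using hz
  refine ⟨fun q => ι (Fin.castLE hle q), fun q => κ (Fin.castLE hle q), fun α hα q => ?_⟩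
  have hinj := Fin.castLE_injective hle
  have hval : ∀ q, Function.extend (Fin.castLE hle) α 0 (Fin.castLE hle q) = α q := fun q =>
    hinj.extend_apply _ _ _
  have := hind (Function.extend (Fin.castLE hle) α 0) (by
    rw [← Finset.sum_subset (Finset.subset_univ (Finset.univ.map ⟨_, hinj⟩)), Finset.sum_map]
    · simpa [hval, hικ] using hα
    · intro x _ hx
      rw [Function.extend_apply' _ _ _ (by simpa using hx), Pi.zero_apply, zero_mul])
    (Fin.castLE hle q)
  rwa [hval] at this

end IsHilbertBurch

end Burch

/-! ### Flat base change and regular sequences -/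

namespace Burch

open IsLocalRing
open scoped Matrix

section Flat

variable {S S' : Type*} [CommRing S] [CommRing S'] [Algebra S S'] [Module.Flat S S']

/-- The solutions of a homogeneous linear system in a flat extension are combinations of solutions
in the base ring. -/
theorem exists_solutions_of_flat {p q : ℕ} {B : Matrix (Fin p) (Fin q) S} {c : Fin q → S'}
    (h : B.map (algebraMap S S') *ᵥ c = 0) :
    ∃ (k : ℕ) (y : Fin k → S') (a : Fin k → Fin q → S), (∀ t, B *ᵥ a t = 0) ∧
      ∀ j, c j = ∑ t, y t * algebraMap S S' (a t j) := by
  classical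
  obtain ⟨k, a, y, hxy, ha⟩ := Module.Flat.exists_factorization_of_comp_eq_zero_of_free
    (f := B.vecMulLinear) (x := Fintype.linearCombination S c) (by
      refine LinearMap.pi_ext' fun i => LinearMap.ext_ring ?_
      have := congrFun h i
      simp only [LinearMap.comp_apply, LinearMap.single_apply, Matrix.vecMulLinear_apply,
        Matrix.single_one_vecMul, Fintype.linearCombination_apply]
      simpa [Matrix.mulVec, dotProduct, Algebra.smul_def] using this)
  refine ⟨k, fun t => y (Finsupp.single t 1), fun t j => a (Pi.single j 1) t, fun t => ?_,
    fun j => ?_⟩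
  · funext i
    have h1 : B.row i = ∑ j, B i j • Pi.single j (1 : S) := by
      funext l
      simp [Finset.sum_apply, Pi.single_apply]
    have h2 := LinearMap.congr_fun ha (Pi.single i 1)
    rw [LinearMap.comp_apply, Matrix.vecMulLinear_apply, Matrix.single_one_vecMul, h1,
      map_sum] at h2
    have h3 := DFunLike.congr_fun h2 t
    simpa [Matrix.mulVec, dotProduct, Finsupp.finsetSum_apply] using h3
  · have h1 := LinearMap.congr_fun hxy (Pi.single j 1)
    rw [Fintype.linearCombination_apply_single, one_smul, LinearMap.comp_apply,
      ← Finsupp.univ_sum_single (a (Pi.single j 1)), map_sum] at h1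
    rw [h1]
    refine Finset.sum_congr rfl fun t _ => ?_
    rw [mul_comm, ← Algebra.smul_def, ← map_smul, Finsupp.smul_single, smul_eq_mul, mul_one]

theorem dotProduct_algebraMap {S S' : Type*} [CommRing S] [CommRing S'] [Algebra S S'] {q : ℕ}
    (u v : Fin q → S) : (fun i => algebraMap S S' (u i)) ⬝ᵥ (fun i => algebraMap S S' (v i)) =
      algebraMap S S' (u ⬝ᵥ v) := by
  simp [dotProduct]

/-- Relations over a flat extension are combinations of relations over `S`, which preserves
exactness and injectivity; minimality survives because the maximal ideal extends to the maximal
ideal. -/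
theorem IsHilbertBurch.map_of_flat [IsLocalRing S] [IsLocalRing S']
    (hmax : (maximalIdeal S).map (algebraMap S S') = maximalIdeal S') {m r : ℕ} {f : Fin m → S}
    {A : Matrix (Fin m) (Fin r) S} (h : IsHilbertBurch f A) :
    IsHilbertBurch (fun i => algebraMap S S' (f i)) (A.map (algebraMap S S')) := by
  refine ⟨h.pos, fun i j => hmax ▸ Ideal.mem_map_of_mem _ (h.entry_mem i j), fun i => ?_,
    fun c => ?_, fun u hu => ?_, fun c hc => ?_⟩
  · rw [← hmax, ← Ideal.map_pow]
    exact Ideal.mem_map_of_mem _ (h.generator_mem i)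
  · rw [Matrix.dotProduct_mulVec]
    refine (congrArg (· ⬝ᵥ c) (funext fun j => ?_)).trans (zero_dotProduct c)
    have := h.comp_eq_zero (Pi.single j 1)
    rw [Matrix.mulVec_single_one] at this
    exact (dotProduct_algebraMap f (A.col j)).trans (by rw [this, map_zero]; rfl)
  · obtain ⟨k, y, a, ha, hua⟩ := exists_solutions_of_flat (B := Matrix.of fun _ : Fin 1 => f)
      (c := u) (by funext i; exact hu)
    choose c hc using fun t => h.exact (a t) (congrFun (ha t) 0)
    refine ⟨fun j => ∑ t, y t * algebraMap S S' (c t j), funext fun i => ?_⟩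
    rw [hua]
    simp only [Matrix.mulVec, dotProduct, Matrix.map_apply, Finset.mul_sum]
    rw [Finset.sum_comm]
    refine Finset.sum_congr rfl fun t _ => ?_
    rw [hc, Matrix.mulVec, dotProduct, map_sum, Finset.mul_sum]
    refine Finset.sum_congr rfl fun j _ => ?_
    rw [map_mul]; ring
  · obtain ⟨k, y, a, ha, hca⟩ := exists_solutions_of_flat hc
    funext j
    rw [hca]
    exact Finset.sum_eq_zero fun t _ => by rw [h.injective _ (ha t)]; simp

/-- Membership in the square of the maximal ideal is a linear relation between the `b q` and
generators of 𝔫²; over `S'` it is a combination of such relations over `S`. -/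
theorem mem_maximalIdeal_of_sum_mem_sq_of_flat [IsLocalRing S] [IsNoetherianRing S] [IsLocalRing S']
    (hmax : (maximalIdeal S).map (algebraMap S S') = maximalIdeal S') {l : ℕ} {b : Fin l → S}
    (h : ∀ α : Fin l → S, ∑ q, α q * b q ∈ maximalIdeal S ^ 2 → ∀ q, α q ∈ maximalIdeal S)
    {α : Fin l → S'} (hα : ∑ q, α q * algebraMap S S' (b q) ∈ maximalIdeal S' ^ 2) (q : Fin l) :
    α q ∈ maximalIdeal S' := by
  obtain ⟨e, z, hz⟩ := Submodule.fg_iff_exists_fin_generating_family.mp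
    (IsNoetherian.noetherian (maximalIdeal S ^ 2))
  have hz' : maximalIdeal S' ^ 2 = Ideal.span (Set.range fun i => algebraMap S S' (z i)) := by
    rw [← hmax, ← Ideal.map_pow, ← hz, Ideal.submodule_span_eq, Ideal.map_span, ← Set.range_comp]
    rfl
  rw [hz', Ideal.mem_span_range_iff_exists_fun] at hα
  obtain ⟨β, hβ⟩ := hα
  obtain ⟨k, y, a, ha, hc⟩ := exists_solutions_of_flat (S' := S')
    (B := Matrix.of fun _ : Fin 1 => Fin.append b (-z)) (c := Fin.append α β) (by
      funext i
      change ∑ j, algebraMap S S' (Fin.append b (-z) j) * Fin.append α β j = 0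
      rw [Fin.sum_univ_add]
      simp only [Fin.append_left, Fin.append_right, Pi.neg_apply, map_neg, neg_mul,
        Finset.sum_neg_distrib]
      rw [add_neg_eq_zero]
      simpa only [mul_comm] using hβ.symm)
  have := hc (Fin.castAdd e q)
  rw [Fin.append_left] at this
  rw [this]
  refine Ideal.sum_mem _ fun t _ => Ideal.mul_mem_left _ _ ?_
  rw [← hmax]
  refine Ideal.mem_map_of_mem _ (h (fun q => a t (Fin.castAdd e q)) ?_ q)
  have h1 : ∑ j, Fin.append b (-z) j * a t j = 0 := congrFun (ha t) 0
  rw [Fin.sum_univ_add] at h1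
  simp only [Fin.append_left, Fin.append_right, Pi.neg_apply, neg_mul,
    Finset.sum_neg_distrib, add_neg_eq_zero] at h1
  simp only [mul_comm (a t _)]
  rw [h1]
  refine Ideal.sum_mem _ fun i _ => Ideal.mul_mem_right _ _ ?_
  rw [← hz]
  exact Submodule.subset_span ⟨i, rfl⟩

end Flat

section RegularSequence

variable {R : Type*} [CommRing R]

theorem isRegularMod_iff (xs : List R) (J : Ideal R) : IsRegularMod J xs ↔
    ∀ i (h : i < xs.length) (a : R), xs[i] * a ∈ J ⊔ Ideal.ofList (xs.take i) →
      a ∈ J ⊔ Ideal.ofList (xs.take i) := by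
  induction xs generalizing J with
  | nil => simp [IsRegularMod]
  | cons x xs ih =>
    rw [IsRegularMod, ih]
    constructor
    · rintro ⟨h0, h1⟩ i hi a ha
      cases i with
      | zero => simpa using h0 a (by simpa using ha)
      | succ i =>
        rw [List.take_succ_cons, Ideal.ofList_cons, ← sup_assoc] at ha ⊢
        exact h1 i (by simpa using hi) a ha
    · intro h
      refine ⟨fun a ha => by simpa using h 0 (by simp) a (by simpa using ha), fun i hi a ha => ?_⟩
      have := h (i + 1) (by simpa using hi) a
      rw [List.take_succ_cons, Ideal.ofList_cons, ← sup_assoc] at this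
      exact this ha

theorem isSMulRegular_quotient_iff (K : Ideal R) (x : R) :
    IsSMulRegular (R ⧸ (K • ⊤ : Submodule R R)) x ↔ ∀ a, x * a ∈ K → a ∈ K := by
  rw [smul_eq_mul, Ideal.mul_top, isSMulRegular_iff_right_eq_zero_of_smul]
  constructor
  · intro h a ha
    exact (Submodule.Quotient.mk_eq_zero K).mp
      (h (Submodule.Quotient.mk a) ((Submodule.Quotient.mk_eq_zero K).mpr ha))
  · intro h a ha
    obtain ⟨a, rfl⟩ := Submodule.Quotient.mk_surjective K a
    exact (Submodule.Quotient.mk_eq_zero K).mpr (h a ((Submodule.Quotient.mk_eq_zero K).mp ha))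

theorem isWeaklyRegular_iff_isRegularMod (xs : List R) :
    RingTheory.Sequence.IsWeaklyRegular R xs ↔ IsRegularMod ⊥ xs := by
  rw [RingTheory.Sequence.isWeaklyRegular_iff, isRegularMod_iff]
  simp only [isSMulRegular_quotient_iff, bot_sup_eq]

theorem isRegular_iff_isRegularMod [IsLocalRing R] (xs : List R) :
    RingTheory.Sequence.IsRegular R xs ↔
      IsRegularMod ⊥ xs ∧ Ideal.ofList xs ≤ maximalIdeal R := by
  rw [RingTheory.Sequence.isRegular_iff, isWeaklyRegular_iff_isRegularMod, smul_eq_mul,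
    Ideal.mul_top]
  exact and_congr_right fun _ => ⟨fun h => le_maximalIdeal h.symm,
    fun h h0 => (Ideal.IsPrime.ne_top' : maximalIdeal R ≠ ⊤) (top_le_iff.mp (h0.trans_le h))⟩

/-- A regular sequence whose quotient has socle is maximal. -/
theorem isMaximalRegularSequence_of_socle [IsLocalRing R] {xs : List R} (hreg : IsRegularMod ⊥ xs)
    (hle : Ideal.ofList xs ≤ maximalIdeal R)
    (hs : ∃ s ∉ Ideal.ofList xs, ∀ y ∈ maximalIdeal R, s * y ∈ Ideal.ofList xs) :
    IsMaximalRegularSequence xs := by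
  refine ⟨(isRegular_iff_isRegularMod xs).mpr ⟨hreg, hle⟩, fun y hy => ?_⟩
  obtain ⟨h1, h2⟩ := (isRegular_iff_isRegularMod _).mp hy
  obtain ⟨s, hs, hsy⟩ := hs
  have hym : y ∈ maximalIdeal R := h2 (Ideal.subset_span (by simp))
  have := (isRegularMod_iff _ _).mp h1 xs.length (by simp) s
  simp only [bot_sup_eq, List.take_left, List.getElem_concat_length] at this
  exact hs (this (by rw [mul_comm]; exact hsy y hym))

end RegularSequence

section Bounds

variable {S Q : Type u} [CommRing S] [IsRegularLocalRing S] [CommRing Q] [IsLocalRing Q]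
  {m r : ℕ} {f : Fin m → S} {A : Matrix (Fin m) (Fin r) S}

theorem IsHilbertBurch.maximalIdeal_ne_bot (h : IsHilbertBurch f A) {xs : List S}
    (hxs : Ideal.ofList xs ≤ maximalIdeal S) (hreg : IsRegularMod (Ideal.span (Set.range f)) xs)
    {φ : S →+* Q} (hφ : Function.Surjective φ)
    (hker : RingHom.ker φ = Ideal.span (Set.range f) ⊔ Ideal.ofList xs) :
    maximalIdeal Q ≠ ⊥ := by
  intro hbot
  refine (h.isSpannedMod_burchIdeal hxs hreg).1 fun x hx => ?_
  rw [← hker, RingHom.mem_ker, ← Ideal.mem_bot, ← hbot]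
  exact map_mem_maximalIdeal hφ hx

/-- The upper bounds for the Burch index of the quotient by a regular sequence. -/
theorem IsHilbertBurch.burchIndexDepthZero_le [IsNoetherianRing Q] (h : IsHilbertBurch f A) {xs : List S}
    (hxs : Ideal.ofList xs ≤ maximalIdeal S) (hreg : IsRegularMod (Ideal.span (Set.range f)) xs)
    {φ : S →+* Q} (hφ : Function.Surjective φ)
    (hker : RingHom.ker φ = Ideal.span (Set.range f) ⊔ Ideal.ofList xs) :
    burchIndexDepthZero Q ≤ (2 : ℕ) ∧
    ((∃ w ∈ maximalIdeal S, ∀ i j, A i j ∈ maximalIdeal S ^ 2 ⊔ Ideal.span {w}) →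
      burchIndexDepthZero Q ≤ (1 : ℕ)) ∧
    ((∀ i j, A i j ∈ maximalIdeal S ^ 2) → burchIndexDepthZero Q ≤ (0 : ℕ)) := by
  obtain ⟨-, h2, h1, h0⟩ := h.isSpannedMod_burchIdeal hxs hreg
  have hQ := h.maximalIdeal_ne_bot hxs hreg hφ hker
  obtain ⟨y, hy⟩ := exists_fin_spanFinrank_generators Q
  have key : ∀ l, IsSpannedMod (maximalIdeal S)
      (burchIdeal (Ideal.span (Set.range f) ⊔ Ideal.ofList xs)) l → burchIndexDepthZero Q ≤ l := by
    intro l hl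
    rw [← hker, isSpannedMod_burchIdeal_ker_iff hφ hQ hy] at hl
    exact Burch.burchIndexDepthZero_le hQ hy hl
  exact ⟨key 2 h2, fun hw => key 1 (h1 hw), fun hA => key 0 (h0 hA)⟩

end Bounds

end Burch

/-! ### The extension with infinite residue field -/

namespace Burch

open IsLocalRing Polynomial

section ResidueExtension

variable (S : Type u) [CommRing S] [IsLocalRing S]

theorem comap_C_map_maximalIdeal :
    ((maximalIdeal S).map (C : S →+* S[X])).comap C = maximalIdeal S := by
  ext x
  rw [Ideal.mem_comap, Ideal.mem_map_C_iff]
  refine ⟨fun h => by simpa using h 0, fun h n => ?_⟩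
  rw [coeff_C]
  split_ifs
  · exact h
  · exact zero_mem _

theorem isRegularLocalRing_residueExtension (S : Type u) [CommRing S] [IsRegularLocalRing S] :
    IsRegularLocalRing (ResidueExtension S) :=
  isRegularLocalRing_localization_atPrime_of_comap_eq_maximalIdeal S _ (comap_C_map_maximalIdeal S)

theorem algebraMap_residueExtension (x : S) : algebraMap S (ResidueExtension S) x =
    algebraMap S[X] (ResidueExtension S) (C x) :=
  IsScalarTower.algebraMap_apply S S[X] (ResidueExtension S) x

theorem map_ideal_residueExtension (I : Ideal S) : I.map (algebraMap S (ResidueExtension S)) =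
    (I.map (C : S →+* S[X])).map (algebraMap S[X] (ResidueExtension S)) := by
  rw [Ideal.map_map]
  exact congrArg (fun g => I.map g) (RingHom.ext (algebraMap_residueExtension S))

theorem map_maximalIdeal_residueExtension :
    (maximalIdeal S).map (algebraMap S (ResidueExtension S)) =
      maximalIdeal (ResidueExtension S) := by
  rw [map_ideal_residueExtension, Localization.AtPrime.map_eq_maximalIdeal]

theorem flat_residueExtension : Module.Flat S (ResidueExtension S) :=
  Module.Flat.trans S S[X] (ResidueExtension S)

/-- Powers of the variable have distinct residues: the difference of two of them has a coefficient
1, so it avoids the prime that is localized at. -/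
theorem infinite_residueField_residueExtension :
    Infinite (ResidueField (ResidueExtension S)) := by
  refine Infinite.of_injective
    (fun i : ℕ => residue (ResidueExtension S) (algebraMap S[X] _ (X ^ i))) fun i j hij => ?_
  by_contra hne
  rw [← sub_eq_zero, ← map_sub, residue_eq_zero_iff, ← map_sub,
    IsLocalization.AtPrime.to_map_mem_maximal_iff (ResidueExtension S)
      ((maximalIdeal S).map (C : S →+* S[X])), Ideal.mem_map_C_iff] at hij
  have := hij i
  rw [coeff_sub, coeff_X_pow_self, coeff_X_pow, if_neg hne, sub_zero] at this
  exact (Ideal.ne_top_iff_one _).mp Ideal.IsPrime.ne_top' this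

end ResidueExtension

section Map

variable {S R : Type u} [CommRing S] [IsLocalRing S] [CommRing R] [IsLocalRing R] {φ : S →+* R}

theorem map_C_eq_comap (hφ : Function.Surjective φ) :
    (maximalIdeal S).map (C : S →+* S[X]) =
      ((maximalIdeal R).map (C : R →+* R[X])).comap (mapRingHom φ) := by
  ext p
  rw [Ideal.mem_comap, Ideal.mem_map_C_iff, Ideal.mem_map_C_iff]
  simp only [coe_mapRingHom, coeff_map, map_mem_maximalIdeal_iff hφ]

/-- The map of the extensions that is induced by a surjection of local rings. -/
noncomputable def residueExtensionMap (hφ : Function.Surjective φ) :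
    ResidueExtension S →+* ResidueExtension R :=
  Localization.localRingHom _ _ (mapRingHom φ) (map_C_eq_comap hφ)

theorem residueExtensionMap_surjective (hφ : Function.Surjective φ) :
    Function.Surjective (residueExtensionMap hφ) := by
  intro y
  obtain ⟨a, b, rfl⟩ := IsLocalization.exists_mk'_eq
    ((maximalIdeal R).map (C : R →+* R[X])).primeCompl y
  obtain ⟨a, rfl⟩ := map_surjective φ hφ a
  obtain ⟨b, hb⟩ := b
  obtain ⟨b, rfl⟩ := map_surjective φ hφ b
  have hb' : b ∈ ((maximalIdeal S).map (C : S →+* S[X])).primeCompl := fun h =>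
    hb ((map_C_eq_comap hφ).le h)
  exact ⟨IsLocalization.mk' _ a ⟨b, hb'⟩, Localization.localRingHom_mk' _ _ _ _ _ _⟩

/-- Together with surjectivity this presents `R'` as `S'/IS'` over the regular ring `S'`. It holds
coefficientwise for polynomials and then localizes. -/
theorem ker_residueExtensionMap (hφ : Function.Surjective φ) :
    RingHom.ker (residueExtensionMap hφ) =
      (RingHom.ker φ).map (algebraMap S (ResidueExtension S)) := by
  rw [map_ideal_residueExtension]
  have hC : ∀ p : S[X], p ∈ (RingHom.ker φ).map (C : S →+* S[X]) ↔ p.map φ = 0 := by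
    intro p
    rw [Ideal.mem_map_C_iff, Polynomial.ext_iff]
    simp [RingHom.mem_ker]
  apply le_antisymm
  · intro x hx
    obtain ⟨a, b, rfl⟩ := IsLocalization.exists_mk'_eq
      ((maximalIdeal S).map (C : S →+* S[X])).primeCompl x
    rw [RingHom.mem_ker, residueExtensionMap, Localization.localRingHom_mk',
      IsLocalization.mk'_eq_zero_iff] at hx
    obtain ⟨⟨t, ht⟩, hta⟩ := hx
    obtain ⟨t, rfl⟩ := map_surjective φ hφ t
    have ht' : t ∈ ((maximalIdeal S).map (C : S →+* S[X])).primeCompl := fun h =>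
      ht ((map_C_eq_comap hφ).le h)
    have hmem : t * a ∈ (RingHom.ker φ).map (C : S →+* S[X]) := by
      rw [hC, Polynomial.map_mul]
      exact hta
    have h1 := Ideal.mem_map_of_mem (algebraMap S[X] (ResidueExtension S)) hmem
    rw [map_mul, Ideal.unit_mul_mem_iff_mem _
      (IsLocalization.map_units (ResidueExtension S) (⟨t, ht'⟩ :
        ((maximalIdeal S).map (C : S →+* S[X])).primeCompl))] at h1
    rw [IsLocalization.mk'_eq_mul_mk'_one]
    exact Ideal.mul_mem_right _ _ h1
  · rw [Ideal.map_le_iff_le_comap]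
    intro p hp
    rw [Ideal.mem_comap, RingHom.mem_ker, residueExtensionMap, Localization.localRingHom_to_map,
      coe_mapRingHom, (hC p).mp hp, map_zero]

end Map

end Burch

/-! ### The two bounds and the theorem -/

namespace Burch

open IsLocalRing

theorem exists_socle_of_hasDepthZero {S : Type u} [CommRing S] [IsLocalRing S] [IsNoetherianRing S]
    {I : Ideal S} [IsLocalRing (S ⧸ I)] (h : HasDepthZero (S ⧸ I) (S ⧸ I)) :
    ∃ s ∉ I, ∀ y ∈ maximalIdeal S, s * y ∈ I := by
  refine exists_socle_of_forall_exists fun x hx => ?_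
  have := h _ (map_mem_maximalIdeal Ideal.Quotient.mk_surjective hx)
  rw [isSMulRegular_iff_right_eq_zero_of_smul] at this
  push Not at this
  obtain ⟨a, ha, ha0⟩ := this
  obtain ⟨a, rfl⟩ := Ideal.Quotient.mk_surjective a
  rw [smul_eq_mul, ← map_mul, Ideal.Quotient.eq_zero_iff_mem] at ha
  exact ⟨a, fun h0 => ha0 (Ideal.Quotient.eq_zero_iff_mem.mpr h0), ha⟩

namespace IsHilbertBurch

variable {S : Type u} [CommRing S] [IsRegularLocalRing S] {m r : ℕ} {f : Fin m → S}
  {A : Matrix (Fin m) (Fin r) S}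

theorem two_le_spanFinrank (h : IsHilbertBurch f A) : 2 ≤ (maximalIdeal S).spanFinrank := by
  have key : ∀ z ∈ maximalIdeal S, ¬ maximalIdeal S ≤ Ideal.span {z} := fun z hz hle =>
    h.baseCone.not_le_sup_span_singleton h bot_le (sup_bot_eq _).symm hz (hle.trans le_sup_right)
  by_contra! hlt
  obtain ⟨z, hz⟩ := exists_fin_spanFinrank_generators S
  generalize (maximalIdeal S).spanFinrank = d at z hz hlt
  interval_cases d
  · exact key 0 (zero_mem _) (hz.ge.trans (by simp))
  · refine key (z 0) (hz.le (Ideal.subset_span ⟨0, rfl⟩)) (hz.ge.trans ?_)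
    rw [Set.range_unique]
    rfl

/-- In positive depth each regular sequence of `R'` lifts to a sequence in `S'` that is regular
modulo `IS'`, where the mapping cone bounds apply to every member of the supremum. -/
theorem burchIndex_le (h : IsHilbertBurch f A) [IsLocalRing (S ⧸ Ideal.span (Set.range f))] :
    burchIndex (S ⧸ Ideal.span (Set.range f)) ≤ (2 : ℕ) ∧
    ((∃ w ∈ maximalIdeal S, ∀ i j, A i j ∈ maximalIdeal S ^ 2 ⊔ Ideal.span {w}) →
      burchIndex (S ⧸ Ideal.span (Set.range f)) ≤ (1 : ℕ)) ∧
    ((∀ i j, A i j ∈ maximalIdeal S ^ 2) →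
      burchIndex (S ⧸ Ideal.span (Set.range f)) ≤ (0 : ℕ)) := by
  have hsurj := Ideal.Quotient.mk_surjective (I := Ideal.span (Set.range f))
  rw [burchIndex]
  split_ifs with hdepth
  · exact h.burchIndexDepthZero_le (xs := []) (by simp) trivial hsurj (by simp)
  have hmax := map_maximalIdeal_residueExtension S
  have hflat := flat_residueExtension S
  have hreg := isRegularLocalRing_residueExtension S
  have h' := h.map_of_flat hmax
  have hker : RingHom.ker (residueExtensionMap hsurj) =
      Ideal.span (Set.range fun i => algebraMap S (ResidueExtension S) (f i)) := by
    rw [ker_residueExtensionMap, Ideal.mk_ker, Ideal.map_span, ← Set.range_comp]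
    rfl
  have hΦ := residueExtensionMap_surjective hsurj
  have key : ∀ (xs : List (ResidueExtension (S ⧸ Ideal.span (Set.range f)))),
      IsMaximalRegularSequence xs →
      ∀ _ : IsLocalRing (ResidueExtension (S ⧸ Ideal.span (Set.range f)) ⧸ Ideal.ofList xs),
      burchIndexDepthZero
        (ResidueExtension (S ⧸ Ideal.span (Set.range f)) ⧸ Ideal.ofList xs) ≤ (2 : ℕ) ∧
      ((∃ w ∈ maximalIdeal (ResidueExtension S), ∀ i j,
          A.map (algebraMap S (ResidueExtension S)) i j ∈
          maximalIdeal (ResidueExtension S) ^ 2 ⊔ Ideal.span {w}) → burchIndexDepthZero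
        (ResidueExtension (S ⧸ Ideal.span (Set.range f)) ⧸ Ideal.ofList xs) ≤ (1 : ℕ)) ∧
      ((∀ i j, A.map (algebraMap S (ResidueExtension S)) i j ∈
          maximalIdeal (ResidueExtension S) ^ 2) → burchIndexDepthZero
        (ResidueExtension (S ⧸ Ideal.span (Set.range f)) ⧸ Ideal.ofList xs) ≤ (0 : ℕ)) :=
    fun xs hxs _ => by
      obtain ⟨h1, h2⟩ := (isRegular_iff_isRegularMod _).mp hxs.1
      obtain ⟨ys, rfl⟩ := exists_list_map_eq hΦ xs
      rw [← isRegularMod_comap_iff hΦ, ← RingHom.ker_eq_comap_bot, hker] at h1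
      rw [← Ideal.map_ofList] at h2
      exact h'.burchIndexDepthZero_le (xs := ys)
        (φ := (Ideal.Quotient.mk (Ideal.ofList (ys.map (residueExtensionMap hsurj)))).comp
          (residueExtensionMap hsurj))
        (fun y hy => (map_mem_maximalIdeal_iff hΦ).mp (h2 (Ideal.mem_map_of_mem _ hy))) h1
        (Ideal.Quotient.mk_surjective.comp hΦ) (by
          rw [← RingHom.comap_ker, Ideal.mk_ker, ← Ideal.map_ofList,
            Ideal.comap_map_of_surjective _ hΦ, ← RingHom.ker_eq_comap_bot, hker, sup_comm])
  refine ⟨sSup_le ?_, fun hw => sSup_le ?_, fun hA => sSup_le ?_⟩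
  · rintro _ ⟨xs, hxs, hloc, rfl⟩
    exact (key xs hxs hloc).1
  · rintro _ ⟨xs, hxs, hloc, rfl⟩
    obtain ⟨w, hw, hA⟩ := hw
    refine (key xs hxs hloc).2.1 ⟨algebraMap S _ w, hmax ▸ Ideal.mem_map_of_mem _ hw,
      fun i j => ?_⟩
    rw [← hmax, ← Ideal.map_pow, ← Set.image_singleton, ← Ideal.map_span, ← Ideal.map_sup]
    exact Ideal.mem_map_of_mem _ (hA i j)
  · rintro _ ⟨xs, hxs, hloc, rfl⟩
    refine (key xs hxs hloc).2.2 fun i j => ?_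
    rw [← hmax, ← Ideal.map_pow]
    exact Ideal.mem_map_of_mem _ (hA i j)

/-- In depth zero the socle forces dimension two and the estimate is direct. In positive depth one
sequence suffices: it is found over `S'`, and its image in `R'` is a maximal regular sequence
because the quotient has a socle. -/
theorem lt_burchIndex (h : IsHilbertBurch f A) [IsLocalRing (S ⧸ Ideal.span (Set.range f))]
    {l : ℕ} (hl : l < 2) {ι : Fin (l + 1) → Fin m} {κ : Fin (l + 1) → Fin r}
    (hind : ∀ α : Fin (l + 1) → S, ∑ q, α q * A (ι q) (κ q) ∈ maximalIdeal S ^ 2 →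
      ∀ q, α q ∈ maximalIdeal S) :
    (l : ℕ∞) < burchIndex (S ⧸ Ideal.span (Set.range f)) := by
  have hsurj := Ideal.Quotient.mk_surjective (I := Ideal.span (Set.range f))
  have hm := h.two_le_spanFinrank
  rw [burchIndex]
  split_ifs with hdepth
  · have hd : (maximalIdeal S).spanFinrank = 2 := by
      refine le_antisymm ?_ hm
      by_contra! hlt
      obtain ⟨s, hs, hsy⟩ := exists_socle_of_hasDepthZero hdepth
      exact hs (h.mem_of_forall_mul_mem hlt hsy)
    obtain ⟨hs, hspan⟩ := h.not_isSpannedMod_burchIdeal hd hl hind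
    have hm2 := h.two_le
    refine lt_burchIndexDepthZero hsurj
      (h.maximalIdeal_ne_bot (xs := []) (by simp) trivial hsurj (by simp)) ?_ ?_ ?_ ?_
    all_goals rw [Ideal.mk_ker]
    · exact h.span_le
    · exact fun h0 => h.generator_ne_zero ⟨0, by omega⟩
        (by rw [← Ideal.mem_bot, ← h0]; exact Ideal.subset_span ⟨_, rfl⟩)
    · exact hs
    · exact hspan
  have hmax := map_maximalIdeal_residueExtension S
  have hflat := flat_residueExtension S
  have hreg := isRegularLocalRing_residueExtension S
  have hinf := infinite_residueField_residueExtension S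
  have h' := h.map_of_flat hmax
  have hker : RingHom.ker (residueExtensionMap hsurj) =
      Ideal.span (Set.range fun i => algebraMap S (ResidueExtension S) (f i)) := by
    rw [ker_residueExtensionMap, Ideal.mk_ker, Ideal.map_span, ← Set.range_comp]
    rfl
  have hΦ := residueExtensionMap_surjective hsurj
  have hm' := h'.two_le_spanFinrank
  obtain ⟨ys, hys, hysreg, T₀, _, _, ψ, hψ, hψker, hK2, hK0, hs, hspan⟩ :=
    exists_isRegularMod ((maximalIdeal (ResidueExtension S)).spanFinrank - 2) _ h' hl
      (ι := ι) (κ := κ)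
      (fun α hα q => mem_maximalIdeal_of_sum_mem_sq_of_flat hmax hind hα q) (by omega)
  rw [← hker] at hK2 hK0 hs hspan
  set Φ := residueExtensionMap hsurj
  set xs := ys.map Φ
  have hcomap : (Ideal.ofList xs).comap Φ = RingHom.ker Φ ⊔ RingHom.ker ψ := by
    rw [← Ideal.map_ofList, Ideal.comap_map_of_surjective _ hΦ, ← RingHom.ker_eq_comap_bot,
      hψker, sup_comm]
  have hxs : Ideal.ofList xs ≤ maximalIdeal _ := by
    rw [← Ideal.map_ofList, Ideal.map_le_iff_le_comap]
    exact fun y hy => map_mem_maximalIdeal hΦ (hys hy)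
  have hxsreg : IsRegularMod ⊥ xs := by
    rwa [← isRegularMod_comap_iff hΦ, ← RingHom.ker_eq_comap_bot, hker]
  have hloc := isLocalRing_quotient_of_le hxs
  let θ := (Ideal.Quotient.mk (Ideal.ofList xs)).comp Φ
  have hθ : Function.Surjective θ := Ideal.Quotient.mk_surjective.comp hΦ
  have hθker : RingHom.ker θ = RingHom.ker Φ ⊔ RingHom.ker ψ := by
    rw [← hcomap, ← RingHom.comap_ker, Ideal.mk_ker]
  have hle : RingHom.ker ψ ≤ RingHom.ker θ := hθker ▸ le_sup_right
  -- `R'` modulo the sequence is also the quotient of the two-dimensional ring `T₀` by the image of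
  -- the Hilbert–Burch ideal, which gives the minimal presentation needed.
  let φ := ψ.liftOfSurjective hψ ⟨θ, hle⟩
  have hφψ : ∀ x, φ (ψ x) = θ x := fun x =>
    ψ.liftOfRightInverse_comp_apply _ (Function.rightInverse_surjInv hψ) ⟨θ, hle⟩ x
  have hφ : Function.Surjective φ := fun y => by
    obtain ⟨x, rfl⟩ := hθ y
    exact ⟨ψ x, hφψ x⟩
  have hφker : RingHom.ker φ = (RingHom.ker Φ).map ψ := by
    have : (RingHom.ker φ).comap ψ = RingHom.ker θ := by
      ext x
      rw [Ideal.mem_comap, RingHom.mem_ker, hφψ, RingHom.mem_ker]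
    rw [← Ideal.map_comap_of_surjective ψ hψ (RingHom.ker φ), this, hθker, Ideal.map_sup,
      sup_eq_left.mpr]
    rw [Ideal.map_le_iff_le_comap]
    intro x hx
    rw [Ideal.mem_comap, RingHom.mem_ker.mp hx]
    exact zero_mem _
  have hmemK : ∀ x, ψ x ∈ (RingHom.ker Φ).map ψ ↔ Φ x ∈ Ideal.ofList xs := fun x => by
    rw [← hφker, RingHom.mem_ker, hφψ, ← Ideal.Quotient.eq_zero_iff_mem]
    rfl
  refine lt_of_lt_of_le (lt_burchIndexDepthZero hφ
    (h'.maximalIdeal_ne_bot hys hysreg hθ (by rw [hθker, hker, hψker])) (hφker ▸ hK2)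
    (hφker ▸ hK0) (hφker ▸ hs) (hφker ▸ hspan)) (le_sSup ⟨xs, ?_, hloc, rfl⟩)
  refine isMaximalRegularSequence_of_socle hxsreg hxs ?_
  obtain ⟨s, hsK, hsy⟩ := hs
  obtain ⟨s, rfl⟩ := hψ s
  refine ⟨Φ s, fun hmem => hsK ((hmemK s).mpr hmem), fun y hy => ?_⟩
  obtain ⟨y, rfl⟩ := hΦ y
  rw [← map_mul, ← hmemK, map_mul]
  exact hsy _ (map_mem_maximalIdeal hψ ((map_mem_maximalIdeal_iff hΦ).mp hy))

theorem burchIndex_eq (h : IsHilbertBurch f A) [IsLocalRing (S ⧸ Ideal.span (Set.range f))] :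
    burchIndex (S ⧸ Ideal.span (Set.range f)) =
      min (lin₁ S (Ideal.span (Set.range f))) 2 := by
  obtain ⟨h2, h1, h0⟩ := h.burchIndex_le
  have hlow : ∀ l : ℕ, l < 2 → (l : ℕ∞) < lin₁ S (Ideal.span (Set.range f)) →
      (l : ℕ∞) < burchIndex (S ⧸ Ideal.span (Set.range f)) := fun l hl hlt => by
    obtain ⟨ι, κ, hind⟩ := h.exists_of_lt_lin₁ hlt
    exact h.lt_burchIndex hl hind
  have hup : ∀ l : ℕ, l < 2 → lin₁ S (Ideal.span (Set.range f)) ≤ l →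
      burchIndex (S ⧸ Ideal.span (Set.range f)) ≤ l := fun l hl hle => by
    obtain ⟨w, hw, hA⟩ := h.exists_of_lin₁_le hle
    obtain rfl | rfl : l = 0 ∨ l = 1 := by omega
    · exact h0 fun i j => by simpa using hA i j
    · exact h1 ⟨w 0, hw 0, fun i j => by
        have := hA i j
        rwa [Set.range_unique] at this⟩
  -- A number at most 2 is determined by which of 0 and 1 it exceeds.
  have key : ∀ a b : ℕ∞, b ≤ (2 : ℕ) → (∀ l : ℕ, l < 2 → ((l : ℕ∞) < a ↔ (l : ℕ∞) < b)) →
      b = min a 2 := by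
    intro a b hb hab
    refine le_antisymm (le_min ?_ hb) ?_
    · by_contra! hlt
      lift a to ℕ using (hlt.trans_le le_top).ne
      exact lt_irrefl _ ((hab a (by exact_mod_cast hlt.trans_le hb)).mpr hlt)
    · by_contra! hlt
      lift b to ℕ using (hlt.trans_le le_top).ne
      have hb2 : (b : ℕ∞) < (2 : ℕ) := hlt.trans_le (min_le_right _ _)
      exact lt_irrefl _ ((hab b (by exact_mod_cast hb2)).mp (hlt.trans_le (min_le_left _ _)))
  exact key _ _ h2 fun l hl => ⟨hlow l hl, fun hlt => by
    by_contra! hle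
    exact hlt.not_ge (hup l hl hle)⟩

end IsHilbertBurch

end Burch

theorem theorem4p1 {S : Type u} [CommRing S] [IsRegularLocalRing S] (I : Ideal S)
    (hI : I ≤ IsLocalRing.maximalIdeal S ^ 2)
    (hpd : CategoryTheory.projectiveDimension (ModuleCat.of S I) = 1) :
    haveI : IsLocalRing (S ⧸ I) := Burch.isLocalRing_quotient hI
    Burch.burchIndex (S ⧸ I) = min (Burch.lin₁ S I) 2 := by
  have := Burch.isLocalRing_quotient hI
  obtain ⟨m, r, f, A, h, rfl⟩ := Burch.exists_isHilbertBurch hI hpd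
  exact h.burchIndex_eq
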